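/- A Weil algebra is a finite-dimensional local commutative unital $\mathbb R$-algebra $A$ with residue field $\mathbb R$; $\mathfrak m_A$ is its maximal ideal and $\mathrm{Aut}(A)$ its group of $\mathbb R$-algebra automorphisms. Manifolds are smooth, Hausdorff, second countable and of pure finite dimension. For a manifold $M$, the set $\check M^A$ of regular $A$-points consists of the surjective $\mathbb R$-algebra morphisms $C^\infty(M)\to A$; its smooth structure is the one determined by the real components of the values of smooth functions. The jet space $J^AM$ is the set of ideals $\mathfrak p\subset C^\infty(M)$ with $A_{\mathfrak p}=C^\infty(M)/\mathfrak p\simeq A$; its smooth structure is that of the quotient of $\check M^A$ by $\mathrm{Aut}(A)$ under $x\mapsto\ker x$. Its tangent space at $\mathfrak p$ is $T_{\mathfrak p}(J^AM)=\mathrm{Der}(C^\infty(M),A_{\mathfrak p})/\{\delta:\delta(\mathfrak p)=0\}$. Let $A$ be a Weil algebra and $I\subset A$ an ideal that is invariant, i.e. $\sigma(I)=I$ for all $\sigma\in\mathrm{Aut}(A)$, and satisfies $I\subseteq \mathrm{Ann}(I)\cap\mathfrak m_A^2$. Put $B=A/I$, with canonical projection $\phi\colon A\to B$. Let $\phi_*\colon\mathrm{Aut}(A)\to\mathrm{Aut}(B)$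 be the induced morphism and $$K(I)=\{\sigma\in\mathrm{Aut}(A):\ \sigma(a)-a\in I\ \ \forall a\in A,\quad \sigma(b)=b\ \ \forall b\in I\}.$$ The affine sequence $K(I)\to\mathrm{Aut}(A)\to\mathrm{Aut}(B)$ is called exact if $K(I)=\ker\phi_*$ and $\phi_*$ is surjective. Let $\phi^J\colon J^AM\to J^BM$ be the projection $\ker x\mapsto\ker(\phi\circ x)$; write $\bar{\mathfrak p}=\phi^J(\mathfrak p)$, and let $TV_{\mathfrak p}(J^AM)$ be the kernel of the linearised map $T_{\mathfrak p}(J^AM)\to T_{\bar{\mathfrak p}}(J^BM)$. For $D\in\mathrm{Der}(C^\infty(M),\bar{\mathfrak p}/\mathfrak p)$ put $$\mathfrak p+D=\ker(\pi_{\mathfrak p}+D),\qquad \pi_{\mathfrak p}\colon C^\infty(M)\to A_{\mathfrak p}\ \text{the canonical projection.}$$ **Theorem.** The following are equivalent. 1. For every manifold $M$ with $J^AM\neq\emptyset$, the addition law $(\mathfrak p,[D])\mapsto\mathfrak p+D$ defines on $\phi^J\colon J^AM\to J^BM$ the structure of a smooth affine bundle whose model vector bundle is the vertical tangent bundle. That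 is: every vector of $TV_{\mathfrak p}(J^AM)$ is the class $[D]$ of some $D\in\mathrm{Der}(C^\infty(M),\bar{\mathfrak p}/\mathfrak p)$; there are real vector spaces $V_b$ ($b\in J^BM$), structures of affine space over $V_b$ on the fibres of $\phi^J$, and linear isomorphisms $\theta_{\mathfrak p}\colon TV_{\mathfrak p}(J^AM)\to V_{\bar{\mathfrak p}}$ such that the translate of $\mathfrak p$ by $\theta_{\mathfrak p}([D])$ is $\mathfrak p+D$; the map $\phi^J$ is smooth; and $J^BM$ is covered by open sets over which $\phi^J$ has smooth local trivialisations that are affine on the fibres and whose linear parts, read through $\theta$, are smooth local trivialisations of the vertical tangent bundle. 2. The affine sequence $K(I)\to\mathrm{Aut}(A)\to\mathrm{Aut}(B)$ associated to $I$ is exact. -/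

import Mathlib

open scoped Manifold ContDiff Topology

universe u v w

noncomputable section

/-! ### Diffeological preliminaries

Smoothness is expressed with Mathlib's diffeological spaces: a smooth structure is recorded by its
smooth maps from the spaces `ℝᵏ` (the plots), a map is smooth when it preserves plots, and the
topology is the D-topology. For a smooth manifold this is the usual notion of smooth map and the
manifold topology. -/

namespace Diffeology

/-- The pullback diffeology along `f`: `p` is a plot iff `f ∘ p` is one. -/
@[reducible] def induced {X : Type u} {Y : Type v} (f : X → Y) (d : DiffeologicalSpace Y) :
    DiffeologicalSpace X where
  plots _ := {p | IsPlot (f ∘ p)}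
  constant_plots x := isPlot_const (x := f x)
  plot_reparam {_ _ p _} hp hf := isPlot_reparam (p := f ∘ p) hp hf
  locality hp := d.locality hp

/-- The quotient (pushforward) diffeology along `f`, generated by the maps `f ∘ p`, `p` a plot. -/
@[reducible] def coinduced {X : Type u} {Y : Type v} (f : X → Y) (_ : DiffeologicalSpace X) :
    DiffeologicalSpace Y :=
  DiffeologicalSpace.generateFrom
    {q | ∃ p : EuclideanSpace ℝ (Fin q.1) → X, IsPlot p ∧ q.2 = f ∘ p}

instance instSubtype {X : Type u} [d : DiffeologicalSpace X] (P : X → Prop) :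
    DiffeologicalSpace {x // P x} := induced Subtype.val d

instance instProd {X : Type u} {Y : Type v} [dX : DiffeologicalSpace X]
    [dY : DiffeologicalSpace Y] : DiffeologicalSpace (X × Y) :=
  induced Prod.fst dX ⊓ induced Prod.snd dY

end Diffeology

open Diffeology

/-! ### Affine bundles -/

/-- The fibre of `π` over `b`. -/
abbrev Fibre {E : Type u} {X : Type v} (π : E → X) (b : X) : Type u := {e : E // π e = b}

/-- A family of real vector spaces `V b` together with a structure of affine space over `V b` on
the fibre of `π` over `b`, for every `b`. -/
structure AffineFibres {E : Type u} {X : Type v} (π : E → X) where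
  V : X → Type w
  addCommGroup : ∀ b, AddCommGroup (V b)
  module : ∀ b, Module ℝ (V b)
  torsor : ∀ b, AddTorsor (V b) (Fibre π b)

attribute [instance] AffineFibres.addCommGroup AffineFibres.module

/-- The fibre of `π` over `b`, as an affine space over `S.V b`. -/
def AffineFibres.Point {E : Type u} {X : Type v} {π : E → X} (S : AffineFibres.{u, v, w} π)
    (b : X) : Type u := Fibre π b

instance AffineFibres.instPoint {E : Type u} {X : Type v} {π : E → X}
    (S : AffineFibres.{u, v, w} π) (b : X) : AddTorsor (S.V b) (S.Point b) := S.torsor b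

/-- A point of the total space, as a point of its fibre. -/
def AffineFibres.pt {E : Type u} {X : Type v} {π : E → X} (S : AffineFibres.{u, v, w} π)
    (e : E) : S.Point (π e) := ⟨e, rfl⟩

/-- A local trivialisation over an open set `U` of the base: a diffeomorphism
`U × ℝʳ ≃ π ⁻¹' U` over `U` that is an affine isomorphism on every fibre. -/
structure AffineFibres.LocalTriv {E : Type u} {X : Type v} [DiffeologicalSpace E]
    [DiffeologicalSpace X] {π : E → X} (S : AffineFibres.{u, v, w} π) where
  U : Set X
  isOpen : IsOpen[dTopology] U
  r : ℕ
  toFibre : ∀ b : U, EuclideanSpace ℝ (Fin r) ≃ᵃ[ℝ] S.Point (b : X)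
  smooth_toFun : DSmooth fun z : U × EuclideanSpace ℝ (Fin r) => (toFibre z.1 z.2).1
  smooth_invFun : DSmooth fun e : {e : E // π e ∈ U} => (toFibre ⟨π e.1, e.2⟩).symm (S.pt e.1)

/-! ### Weil algebras and the affine sequence of an invariant ideal -/

/-- A Weil algebra: a finite dimensional local commutative real algebra with unit, with residue
field `ℝ`, that is, with an algebra morphism onto `ℝ`. -/
class IsWeilAlgebra (A : Type v) [CommRing A] [Algebra ℝ A] : Prop
    extends Module.Finite ℝ A, IsLocalRing A where
  exists_augmentation : Nonempty (A →ₐ[ℝ] ℝ)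

/-- `I` is an invariant ideal: `σ(I) = I` for every automorphism `σ` of `A`. -/
def IsInvariantIdeal {A : Type v} [CommRing A] [Algebra ℝ A] (I : Ideal A) : Prop :=
  ∀ σ : A ≃ₐ[ℝ] A, I.map (σ : A →+* A) = I

/-- The subgroup `K(I)` of the automorphisms of `A` that induce the identity in `A ⧸ I` and
in `I`. -/
def kernelGroup {A : Type v} [CommRing A] [Algebra ℝ A] (I : Ideal A) :
    Subgroup (A ≃ₐ[ℝ] A) where
  carrier := {σ | (∀ a, σ a - a ∈ I) ∧ ∀ b ∈ I, σ b = b}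
  one_mem' := by simp
  mul_mem' := by
    rintro σ τ ⟨h1, h2⟩ ⟨h3, h4⟩
    refine ⟨fun a => ?_, fun b hb => by simp [h4 b hb, h2 b hb]⟩
    have h := I.add_mem (h3 a) (h1 a)
    rw [← h2 _ (h3 a), map_sub] at h
    simpa using h
  inv_mem' := by
    rintro σ ⟨h1, h2⟩
    refine ⟨fun a => ?_, fun b hb => ?_⟩
    · have h := I.neg_mem (h1 (σ⁻¹ a))
      have e : σ (σ⁻¹ a) = a := σ.apply_symm_apply a
      rwa [e, neg_sub] at h
    · have h := congrArg (σ⁻¹ : A ≃ₐ[ℝ] A) (h2 b hb)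
      have e : σ⁻¹ (σ b) = b := σ.symm_apply_apply b
      exact h.symm.trans e

/-- The morphism `φ_* : Aut(A) → Aut(A ⧸ I)` induced by passing to the quotient. -/
def autMap {A : Type v} [CommRing A] [Algebra ℝ A] (I : Ideal A) (hI : IsInvariantIdeal I) :
    (A ≃ₐ[ℝ] A) →* ((A ⧸ I) ≃ₐ[ℝ] (A ⧸ I)) where
  toFun σ := Ideal.quotientEquivAlg I I σ (hI σ).symm
  map_one' := by
    ext x
    obtain ⟨a, rfl⟩ := Ideal.Quotient.mk_surjective x
    rfl
  map_mul' σ τ := by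
    ext x
    obtain ⟨a, rfl⟩ := Ideal.Quotient.mk_surjective x
    rfl

/-- The affine sequence `K(I) → Aut(A) → Aut(A ⧸ I)` is exact: on the left side,
`K(I) = ker φ_*`, and on the right side, `φ_*` is surjective. -/
def AffineSequenceExact {A : Type v} [CommRing A] [Algebra ℝ A] (I : Ideal A)
    (hI : IsInvariantIdeal I) : Prop :=
  kernelGroup I = (autMap I hI).ker ∧ Function.Surjective (autMap I hI)

/-! ### Near-points and jets -/

section Jets

variable (n : ℕ) (M : Type u) [TopologicalSpace M] [ChartedSpace (EuclideanSpace ℝ (Fin n)) M]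
variable (A : Type v) [CommRing A] [Algebra ℝ A]

/-- The algebra `C^∞(M)` of smooth real functions on the `n`-dimensional manifold `M`. -/
abbrev SmoothFn : Type u := C^∞⟮𝓡 n, M; ℝ⟯

/-- The space `M^A` of `A`-points of `M`. -/
abbrev NearPoint : Type max u v := SmoothFn n M →ₐ[ℝ] A

/-- A family of elements of the finite dimensional space `A` is smooth when its real components
are. -/
def SmoothFamily {A : Type v} [CommRing A] [Algebra ℝ A] {k : ℕ}
    (g : EuclideanSpace ℝ (Fin k) → A) : Prop :=
  ∀ l : A →ₗ[ℝ] ℝ, ContDiff ℝ ∞ fun t => l (g t)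

/-- The smooth structure of `M^A`: a family of `A`-points is smooth when the real components of
all smooth functions on `M` are smooth along it. -/
instance NearPoint.instDiffeologicalSpace : DiffeologicalSpace (NearPoint n M A) :=
  ⨅ (f : SmoothFn n M) (l : A →ₗ[ℝ] ℝ), induced (fun x : NearPoint n M A => l (x f)) inferInstance

/-- The space of regular (that is, surjective) `A`-points of `M`, an open part of `M^A`. -/
abbrev RegularPoint : Type max u v := {x : NearPoint n M A // Function.Surjective x}

/-- The jet space `J^A M`: the ideals `𝔭` of `C^∞(M)` with `C^∞(M) ⧸ 𝔭` isomorphic to `A`. -/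
def JetSpace : Type u :=
  {𝔭 : Ideal (SmoothFn n M) // Nonempty ((SmoothFn n M ⧸ 𝔭) ≃ₐ[ℝ] A)}

variable {n M A}

/-- The kernel of a regular `A`-point. -/
def RegularPoint.jet (x : RegularPoint n M A) : JetSpace n M A :=
  ⟨RingHom.ker x.1, ⟨Ideal.quotientKerAlgEquivOfSurjective x.2⟩⟩

/-- The smooth structure of `J^A M` as the quotient of the space of regular points under `ker`. -/
instance JetSpace.instDiffeologicalSpace : DiffeologicalSpace (JetSpace n M A) :=
  coinduced RegularPoint.jet inferInstance

/-- A regular `A`-point with kernel `𝔭`. -/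
def JetSpace.rep (𝔭 : JetSpace n M A) : RegularPoint n M A :=
  ⟨(𝔭.2.some : (SmoothFn n M ⧸ 𝔭.1) →ₐ[ℝ] A).comp (Ideal.Quotient.mkₐ ℝ 𝔭.1),
    𝔭.2.some.surjective.comp (Ideal.Quotient.mkₐ_surjective ℝ 𝔭.1)⟩

theorem JetSpace.jet_rep (𝔭 : JetSpace n M A) : 𝔭.rep.jet = 𝔭 := by
  apply Subtype.ext
  ext f
  change 𝔭.2.some (Ideal.Quotient.mk 𝔭.1 f) = 0 ↔ f ∈ 𝔭.1
  rw [map_eq_zero_iff _ 𝔭.2.some.injective, Ideal.Quotient.eq_zero_iff_mem]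

/-- The projection `x ↦ φ ∘ x` of regular points, for `φ : A → A ⧸ I` the canonical projection. -/
def RegularPoint.proj (I : Ideal A) (x : RegularPoint n M A) : RegularPoint n M (A ⧸ I) :=
  ⟨(Ideal.Quotient.mkₐ ℝ I).comp x.1, (Ideal.Quotient.mkₐ_surjective ℝ I).comp x.2⟩

/-- The projection `φ^J : J^A M → J^B M`, `B = A ⧸ I`, which sends `ker x` to `ker (φ ∘ x)`; see
`jetMap_jet` for the independence of the choice of the regular point `x`. -/
def jetMap (I : Ideal A) (𝔭 : JetSpace n M A) : JetSpace n M (A ⧸ I) := (𝔭.rep.proj I).jet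

theorem jetMap_jet (I : Ideal A) (hI : IsInvariantIdeal I) (x : RegularPoint n M A) :
    jetMap I x.jet = (x.proj I).jet := by
  have hk : RingHom.ker x.jet.rep.1 = RingHom.ker x.1 := congrArg Subtype.val x.jet.jet_rep
  let e := (Ideal.quotientKerAlgEquivOfSurjective x.jet.rep.2).symm.trans
    ((Ideal.quotientEquivAlgOfEq ℝ hk).trans (Ideal.quotientKerAlgEquivOfSurjective x.2))
  have he : ∀ f, e (x.jet.rep.1 f) = x.1 f := by
    intro f
    have h : (Ideal.quotientKerAlgEquivOfSurjective x.jet.rep.2).symm (x.jet.rep.1 f) =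
        Ideal.Quotient.mk _ f := by
      rw [AlgEquiv.symm_apply_eq]; rfl
    simp only [e, AlgEquiv.trans_apply, h]
    rfl
  have hmem : ∀ a, e a ∈ I ↔ a ∈ I := by
    intro a
    have h1 : ∀ (σ : A ≃ₐ[ℝ] A) (b : A), b ∈ I → σ b ∈ I := fun σ b hb => by
      have := Ideal.mem_map_of_mem (σ : A →+* A) hb
      rwa [hI σ] at this
    exact ⟨fun h => by simpa using h1 e.symm _ h, h1 e a⟩
  apply Subtype.ext
  ext f
  change Ideal.Quotient.mk I (x.jet.rep.1 f) = 0 ↔ Ideal.Quotient.mk I (x.1 f) = 0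
  rw [Ideal.Quotient.eq_zero_iff_mem, Ideal.Quotient.eq_zero_iff_mem, ← he f, hmem]

theorem le_jetMap (I : Ideal A) (𝔭 : JetSpace n M A) : 𝔭.1 ≤ (jetMap I 𝔭).1 := by
  intro f hf
  change Ideal.Quotient.mk I (𝔭.2.some (Ideal.Quotient.mk 𝔭.1 f)) = 0
  rw [Ideal.Quotient.eq_zero_iff_mem.2 hf, map_zero, map_zero]

/-! ### Tangent spaces of jet spaces -/

/-- The derivations `C^∞(M) → A_𝔭 = C^∞(M) ⧸ 𝔭`. -/
abbrev JetSpace.Der (𝔭 : JetSpace n M A) : Type u :=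
  Derivation ℝ (SmoothFn n M) (SmoothFn n M ⧸ 𝔭.1)

/-- The derivations `C^∞(M) → A_𝔭` that vanish on `𝔭`, that is, those which come from
`Der(A_𝔭, A_𝔭)`. -/
def JetSpace.nullDer (𝔭 : JetSpace n M A) : Submodule ℝ 𝔭.Der where
  carrier := {D | ∀ f ∈ 𝔭.1, D f = 0}
  add_mem' h1 h2 f hf := by simp [h1 f hf, h2 f hf]
  zero_mem' f _ := rfl
  smul_mem' c D h f hf := by simp [h f hf]

/-- The tangent space `T_𝔭(J^A M) = Der(C^∞(M), A_𝔭) / Der(A_𝔭, A_𝔭)`. -/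
abbrev JetSpace.Tangent (𝔭 : JetSpace n M A) : Type u := 𝔭.Der ⧸ 𝔭.nullDer

/-- Composition of derivations with the projection `A_𝔭 → A_𝔭̄`, where `𝔭̄ = φ^J(𝔭)`. -/
def JetSpace.pushDer (I : Ideal A) (𝔭 : JetSpace n M A) : 𝔭.Der →ₗ[ℝ] (jetMap I 𝔭).Der where
  toFun D := (Submodule.factor (le_jetMap I 𝔭)).compDer D
  map_add' D D' := by ext f; simp
  map_smul' c D := by
    ext f
    obtain ⟨g, hg⟩ := Ideal.Quotient.mk_surjective (D f)
    change Submodule.factor (le_jetMap I 𝔭) (c • D f) = c • Submodule.factor (le_jetMap I 𝔭) (D f)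
    rw [← hg]
    rfl

/-- The vertical tangent space `TV_𝔭(J^A M)`, the kernel of the linearisation
`T_𝔭(J^A M) → T_𝔭̄(J^B M)`, `[δ] ↦ [δ mod 𝔭̄]`: the classes of those derivations `δ` for which
`[δ mod 𝔭̄]` is the null vector of `T_𝔭̄(J^B M)`. -/
def JetSpace.vertical (I : Ideal A) (𝔭 : JetSpace n M A) : Submodule ℝ 𝔭.Tangent :=
  (LinearMap.ker ((jetMap I 𝔭).nullDer.mkQ ∘ₗ 𝔭.pushDer I)).map 𝔭.nullDer.mkQ

/-- The space `Der(C^∞(M), 𝔭̄ / 𝔭)` of derivations with values in the ideal `𝔭̄ / 𝔭` of `A_𝔭`. -/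
def JetSpace.relDer (I : Ideal A) (𝔭 : JetSpace n M A) : Submodule ℝ 𝔭.Der where
  carrier := {D | ∀ f, D f ∈ (jetMap I 𝔭).1.map (Ideal.Quotient.mk 𝔭.1)}
  add_mem' h1 h2 f := add_mem (h1 f) (h2 f)
  zero_mem' _ := zero_mem _
  smul_mem' c D h f := by
    have := Ideal.mul_mem_left _ (algebraMap ℝ _ c) (h f)
    rwa [← Algebra.smul_def] at this

theorem JetSpace.pushDer_relDer (I : Ideal A) (𝔭 : JetSpace n M A) (D : 𝔭.Der)
    (hD : D ∈ 𝔭.relDer I) : 𝔭.pushDer I D = 0 := by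
  ext f
  obtain ⟨g, hg, h⟩ := (Ideal.mem_map_iff_of_surjective _ Ideal.Quotient.mk_surjective).1 (hD f)
  change Submodule.factor (le_jetMap I 𝔭) (D f) = 0
  rw [← h]
  exact Ideal.Quotient.eq_zero_iff_mem.2 hg

/-- The vertical vector `[D] ∈ TV_𝔭(J^A M)` defined by `D ∈ Der(C^∞(M), 𝔭̄ / 𝔭)`. -/
def JetSpace.verticalClass (I : Ideal A) (𝔭 : JetSpace n M A) :
    𝔭.relDer I →ₗ[ℝ] 𝔭.vertical I :=
  (𝔭.nullDer.mkQ ∘ₗ (𝔭.relDer I).subtype).codRestrict _ fun D =>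
    Submodule.mem_map_of_mem (by simp [𝔭.pushDer_relDer I D.1 D.2])

/-- The kernel `𝔭 + D = ker(π_𝔭 + D)` of the addition law, as a linear subspace of `C^∞(M)`. -/
def JetSpace.addKer (𝔭 : JetSpace n M A) (D : 𝔭.Der) : Submodule ℝ (SmoothFn n M) :=
  LinearMap.ker ((Ideal.Quotient.mkₐ ℝ 𝔭.1).toLinearMap + (D : SmoothFn n M →ₗ[ℝ] _))

variable (n M A) in
/-- The total space of the tangent bundle of `J^A M`. -/
def JetTangent : Type u := Σ 𝔭 : JetSpace n M A, 𝔭.Tangent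

/-- A tangent vector of `J^A M`, as a point of the total space of the tangent bundle. -/
def JetTangent.mk (𝔭 : JetSpace n M A) (y : 𝔭.Tangent) : JetTangent n M A := ⟨𝔭, y⟩

/-- The smooth structure of the tangent bundle of `J^A M`, as the quotient of that of the space of
regular points: smooth families of tangent vectors of `J^A M` are locally the classes of the
families of derivations `D t` into `C^∞(M) ⧸ ker (x t)` for which `x` is a smooth family of regular
`A`-points and the corresponding tangent vectors of `M^A` at the points `x t`, that is, the
derivations `f ↦ x t (D t f)` with values in `A`, form a smooth family. -/
instance JetTangent.instDiffeologicalSpace : DiffeologicalSpace (JetTangent n M A) :=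
  DiffeologicalSpace.generateFrom
    {q | ∃ (x : EuclideanSpace ℝ (Fin q.1) → RegularPoint n M A) (D : ∀ t, (x t).jet.Der),
      IsPlot x ∧ (∀ f, SmoothFamily fun t => Ideal.kerLiftAlg (x t).1 (D t f)) ∧
      q.2 = fun t => JetTangent.mk (x t).jet ((x t).jet.nullDer.mkQ (D t))}

/-! ### The affine structure given by the addition law -/

variable (n M) in
/-- The addition law `𝔭 + D = ker(π_𝔭 + D)` defines on `φ^J : J^A M → J^B M` the structure of an
affine bundle whose model vector bundle is the vertical tangent bundle. There are vector spaces
`V b` and affine structures over `V b` on the fibres of `φ^J`, `b` in `J^B M`, and linear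
isomorphisms `θ 𝔭` of the vertical tangent spaces `TV_𝔭(J^A M)` with `V (φ^J 𝔭)`, such that

* `φ^J` is smooth;
* every vertical vector at `𝔭` is the class `[D]` of some `D` in `Der(C^∞(M), 𝔭̄ / 𝔭)`;
* the translate of `𝔭` by `[D]` is `ker(π_𝔭 + D)`, for every such `D`;
* `J^B M` is covered by local trivialisations of the affine bundle, whose linear parts, read
  through `θ`, are local trivialisations of the vertical tangent bundle as a smooth vector
  bundle. -/
def AdditionLawIsAffineBundle (I : Ideal A) : Prop :=
  ∃ (S : AffineFibres.{u, u, u} (jetMap I : JetSpace n M A → JetSpace n M (A ⧸ I)))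
    (θ : ∀ 𝔭 : JetSpace n M A, 𝔭.vertical I ≃ₗ[ℝ] S.V (jetMap I 𝔭)),
    DSmooth (jetMap I : JetSpace n M A → JetSpace n M (A ⧸ I)) ∧
    (∀ 𝔭 : JetSpace n M A, Function.Surjective (𝔭.verticalClass I)) ∧
    (∀ (𝔭 : JetSpace n M A) (D : 𝔭.relDer I),
      (θ 𝔭 (𝔭.verticalClass I D) +ᵥ S.pt 𝔭).1.1.restrictScalars ℝ = 𝔭.addKer D.1) ∧
    ∀ b : JetSpace n M (A ⧸ I), ∃ T : S.LocalTriv, b ∈ T.U ∧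
      (DSmooth fun z : {𝔭 : JetSpace n M A // jetMap I 𝔭 ∈ T.U} × EuclideanSpace ℝ (Fin T.r) =>
        JetTangent.mk z.1.1
          ((θ z.1.1).symm ((T.toFibre ⟨jetMap I z.1.1, z.1.2⟩).linear z.2)).1) ∧
      DSmooth fun y : {y : JetTangent n M A // jetMap I y.1 ∈ T.U ∧ y.2 ∈ y.1.vertical I} =>
        (T.toFibre ⟨jetMap I y.1.1, y.2.1⟩).linear.symm (θ y.1.1 ⟨y.1.2, y.2.2⟩)

end Jets

end

noncomputable section

open Diffeology

set_option linter.all false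

/-! Write `φ : A → B = A ⧸ I`. Since `I ^ 2 = 0`, the `A`-points over a fixed regular `B`-point `y`
form a torsor under the derivations along `y` with values in `I` (`idealDer`, `exists_point_add`,
`sub_mem_idealDer`), and since `I ⊆ 𝔪 ^ 2` all of them are regular (`surjective_of_mk_comp`). The
question is what remains of this torsor after division by automorphisms.

Suppose that the sequence is exact. Surjectivity of `φ_*` makes every jet over `ker y` the kernel of
a point over `y` itself (`exists_proj_eq`). As `K(I) = ker φ_*`, an automorphism over the identity
of `B` fixes `I` pointwise, so two points over `y` have the same kernel exactly when they agree on
`ker y` (`ker_eq_iff`); infinitesimally, derivations of `A` into `I` kill `I`. Hence the fibre over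
`ker y` is an affine space over `idealDer` modulo the derivations vanishing on `ker y`, and this
same quotient is the vertical tangent space at each jet of the fibre. That every vertical vector has
a representative with values in `I` requires derivations of `B` to lift to `A`
(`exists_derivation_lift`): among uncountably many arbitrary lifts of the automorphisms `exp (t δ)`,
two are so close that their quotient is the exponential of a derivation, which lifts a nonzero
multiple of `δ`.

Smooth trivialisations rest on three local constructions: a slice for the automorphism group, which
gives smooth normal forms of `B`-points (`exists_multiplicative_slice`); Taylor expansion in
coordinates, which lifts `B`-points smoothly to `A` (`exists_taylor`); and a fixed complement of the
null derivations in coordinates, which remains a complement nearby (`exists_coordMap_bijective`).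

Conversely, suppose that the addition law is affine. Lift `τ ∘ φ ∘ x` to an `A`-point; transitivity
writes its jet as that of some `x + E`, and the automorphism relating the two points induces `τ`.
For `K(I) = ker φ_*`, work in dimension `dim A + 1` with a point `x` whose last coordinate is
constant while the others generate `A`. If `σ` induces the identity on `B`, then `F = σ ∘ x - x`
vanishes on `ker x`, so `E` and `E + F` have the same class and `x + E`, `σ ∘ x + E` the same
kernel. Let `E` be `b ∈ I` on the last coordinate and `0` on the others: the automorphism relating
the two points agrees with `σ` on generators, hence is `σ`, and the last coordinate yields `σ b =
b`. -/

/-! ### Exponentials of derivations of a bilinear product -/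

section BilinearProduct

open NormedSpace

variable {E : Type*} [NormedAddCommGroup E] [NormedSpace ℝ E]

/-- `g` is multiplicative for the bilinear product `μ`. -/
def IsMultiplicative (μ : E →L[ℝ] E →L[ℝ] E) (g : E →L[ℝ] E) : Prop :=
  ∀ a b, g (μ a b) = μ (g a) (g b)

/-- The derivations of the bilinear product `μ`. -/
def bilinDer (μ : E →L[ℝ] E →L[ℝ] E) : Submodule ℝ (E →L[ℝ] E) where
  carrier := {X | ∀ a b, X (μ a b) = μ (X a) b + μ a (X b)}
  add_mem' h1 h2 a b := by simp only [add_apply, h1 a b, h2 a b, map_add]; abel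
  zero_mem' a b := by simp
  smul_mem' c X h a b := by simp [h a b]

/-- The failure of `X` to be a derivation of `μ`. -/
def derDefect (μ : E →L[ℝ] E →L[ℝ] E) (X : E →L[ℝ] E) : E →L[ℝ] E →L[ℝ] E :=
  μ.comp X + (ContinuousLinearMap.compL ℝ E E E).flip X ∘L μ - (ContinuousLinearMap.compL ℝ E E E X) ∘L μ

theorem derDefect_apply (μ : E →L[ℝ] E →L[ℝ] E) (X : E →L[ℝ] E) (a b : E) :
    derDefect μ X a b = μ (X a) b + μ a (X b) - X (μ a b) := rfl

theorem mem_bilinDer_iff (μ : E →L[ℝ] E →L[ℝ] E) (X : E →L[ℝ] E) :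
    X ∈ bilinDer μ ↔ derDefect μ X = 0 := by
  constructor
  · intro h
    ext a b
    rw [derDefect_apply, h a b]; simp
  · intro h a b
    have := derDefect_apply μ X a b
    rw [h] at this
    exact (sub_eq_zero.1 this.symm).symm

variable [CompleteSpace E]

theorem exp_neg_mul_exp_clm (X : E →L[ℝ] E) : exp (-X) * exp X = 1 := by
  let _ : NormedAlgebra ℚ (E →L[ℝ] E) := .restrictScalars ℚ ℝ _
  rw [← exp_add_of_commute (Commute.refl X).neg_left]; simp

theorem exp_mul_exp_neg_clm (X : E →L[ℝ] E) : exp X * exp (-X) = 1 := by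
  simpa using exp_neg_mul_exp_clm (-X)

/-- Transporting `μ` by the flow of `X` measures how far the flow is from being multiplicative. The
velocity involves only the defect of `X`, which yields both directions of the correspondence below.
-/
theorem hasDerivAt_exp_conj (μ : E →L[ℝ] E →L[ℝ] E) (X : E →L[ℝ] E) (a b : E) (t : ℝ) :
    HasDerivAt (fun s : ℝ => exp (-(s • X)) (μ (exp (s • X) a) (exp (s • X) b)))
      (exp (-(t • X)) (derDefect μ X (exp (t • X) a) (exp (t • X) b))) t := by
  have h1 := hasDerivAt_exp_smul_const' (𝕂 := ℝ) X t
  have h2 := hasDerivAt_exp_smul_const (𝕂 := ℝ) (-X) t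
  simp only [smul_neg] at h2
  have ha : HasDerivAt (fun s : ℝ => exp (s • X) a) (X (exp (t • X) a)) t := by
    simpa using h1.clm_apply (hasDerivAt_const t a)
  have hb : HasDerivAt (fun s : ℝ => exp (s • X) b) (X (exp (t • X) b)) t := by
    simpa using h1.clm_apply (hasDerivAt_const t b)
  have hm : HasDerivAt (fun s : ℝ => μ (exp (s • X) a)) (μ (X (exp (t • X) a))) t :=
    μ.hasFDerivAt.comp_hasDerivAt t ha
  have := h2.clm_apply (hm.clm_apply hb)
  convert this using 1
  simp only [derDefect_apply, map_sub, map_add, mul_neg, neg_apply]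
  abel

theorem isMultiplicative_exp (μ : E →L[ℝ] E →L[ℝ] E) {X : E →L[ℝ] E} (hX : X ∈ bilinDer μ) :
    IsMultiplicative μ (exp X) := by
  intro a b
  rw [mem_bilinDer_iff] at hX
  have hd : ∀ t : ℝ, HasDerivAt
      (fun s : ℝ => exp (-(s • X)) (μ (exp (s • X) a) (exp (s • X) b))) 0 t := fun t => by
    simpa [hX] using hasDerivAt_exp_conj μ X a b t
  have h := is_const_of_deriv_eq_zero (fun t => (hd t).differentiableAt)
    (fun t => (hd t).deriv) 1 0
  simp only [one_smul, zero_smul, neg_zero, exp_zero, one_apply_eq_self] at h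
  rw [← h, ← mul_apply_eq_comp, exp_mul_exp_neg_clm, one_apply_eq_self]

/-- Let `w` be the defect of `X`. If `exp X` is multiplicative, the transported product has the same
value at times `0` and `1`, although for small `X` its velocity stays close to `w a b`. The mean
value inequality then gives `‖w‖ ≤ ‖w‖ / 2`. -/
theorem exists_mem_bilinDer_of_isMultiplicative_exp (μ : E →L[ℝ] E →L[ℝ] E) :
    ∃ δ > 0, ∀ X : E →L[ℝ] E, ‖X‖ < δ → IsMultiplicative μ (exp X) → X ∈ bilinDer μ := by
  have hc : ContinuousAt (exp : (E →L[ℝ] E) → (E →L[ℝ] E)) 0 :=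
    (hasStrictFDerivAt_exp_zero (𝕂 := ℝ)).hasFDerivAt.continuousAt
  -- The tolerance `1/8` leads to the relative error `17/64 + 81/512 = 217/512`, just below the
  -- `1/2` needed at the end.
  obtain ⟨δ, hδ, hδ'⟩ := Metric.continuousAt_iff.1 hc (1/8) (by norm_num)
  refine ⟨δ, hδ, fun X hX hm => ?_⟩
  rw [mem_bilinDer_iff]
  set w := derDefect μ X with hw
  have key : ∀ Y : E →L[ℝ] E, ‖Y‖ < δ → ‖exp Y - 1‖ ≤ 1/8 := fun Y hY => by
    have := hδ' (x := Y) (by simpa using hY)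
    rw [exp_zero, dist_eq_norm] at this
    exact this.le
  have bound : ∀ a b, ‖w a b‖ ≤ 1/2 * ‖w‖ * ‖a‖ * ‖b‖ := by
    intro a b
    let ψ : ℝ → E := fun s => exp (-(s • X)) (μ (exp (s • X) a) (exp (s • X) b)) - s • w a b
    have hψ : ∀ t : ℝ, HasDerivAt ψ
        (exp (-(t • X)) (w (exp (t • X) a) (exp (t • X) b)) - w a b) t := fun t => by
      have h := (hasDerivAt_exp_conj μ X a b t).sub ((hasDerivAt_id t).smul_const (w a b))
      rw [one_smul] at h
      exact h
    have hb : ∀ t ∈ Set.Ico (0:ℝ) 1,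
        ‖exp (-(t • X)) (w (exp (t • X) a) (exp (t • X) b)) - w a b‖ ≤ 1/2 * ‖w‖ * ‖a‖ * ‖b‖ := by
      intro t ht
      have hn : ‖t • X‖ < δ := by
        rw [norm_smul, Real.norm_eq_abs, abs_of_nonneg ht.1]
        nlinarith [norm_nonneg X, ht.2]
      have e1 := key _ hn
      have e2 := key (-(t • X)) (by simpa using hn)
      set e := exp (t • X)
      set f := exp (-(t • X))
      have ea : ∀ c, ‖e c - c‖ ≤ 1/8 * ‖c‖ := fun c => by
        have := (e - 1).le_opNorm c
        simp only [sub_apply, one_apply_eq_self] at this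
        nlinarith [norm_nonneg c]
      have fa : ∀ c, ‖f c - c‖ ≤ 1/8 * ‖c‖ := fun c => by
        have := (f - 1).le_opNorm c
        simp only [sub_apply, one_apply_eq_self] at this
        nlinarith [norm_nonneg c]
      have ea' : ∀ c, ‖e c‖ ≤ 9/8 * ‖c‖ := fun c => by
        have := norm_add_le (e c - c) c
        rw [sub_add_cancel] at this
        linarith [ea c]
      have hw2 : ∀ c d, ‖w c d‖ ≤ ‖w‖ * ‖c‖ * ‖d‖ := w.le_opNorm₂
      have s1 : ‖w (e a) (e b) - w a b‖ ≤ (17/64) * (‖w‖ * ‖a‖ * ‖b‖) := by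
        have : w (e a) (e b) - w a b = w (e a - a) (e b) + w a (e b - b) := by
          simp only [map_sub, sub_apply]; abel
        rw [this]
        refine (norm_add_le _ _).trans ?_
        have h1 : ‖w (e a - a) (e b)‖ ≤ ‖w‖ * (1/8 * ‖a‖) * (9/8 * ‖b‖) :=
          (hw2 _ _).trans (by gcongr; exacts [ea a, ea' b])
        have h2 : ‖w a (e b - b)‖ ≤ ‖w‖ * ‖a‖ * (1/8 * ‖b‖) :=
          (hw2 _ _).trans (by gcongr; exact ea b)
        nlinarith
      have hE : 0 ≤ ‖w‖ * ‖a‖ * ‖b‖ := by positivity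
      have s2 : ‖w (e a) (e b)‖ ≤ (81/64) * (‖w‖ * ‖a‖ * ‖b‖) := by
        have : ‖w (e a) (e b)‖ ≤ ‖w‖ * (9/8 * ‖a‖) * (9/8 * ‖b‖) :=
          (hw2 _ _).trans (by gcongr; exacts [ea' a, ea' b])
        nlinarith
      have s3 := norm_add_le (f (w (e a) (e b)) - w (e a) (e b)) (w (e a) (e b) - w a b)
      rw [sub_add_sub_cancel] at s3
      have s4 := fa (w (e a) (e b))
      nlinarith
    have := norm_image_sub_le_of_norm_deriv_le_segment_01'
      (fun t _ => (hψ t).hasDerivWithinAt) hb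
    have e0 : ψ 0 = μ a b := by simp [ψ]
    have e1 : ψ 1 = μ a b - w a b := by
      simp only [ψ, one_smul]
      rw [← hm a b, ← mul_apply_eq_comp, exp_neg_mul_exp_clm,
        one_apply_eq_self]
    rw [e0, e1] at this
    simpa using this
  have hle : ‖w‖ ≤ 1/2 * ‖w‖ :=
    w.opNorm_le_bound₂ (by positivity) (fun a b => bound a b)
  exact ContinuousLinearMap.opNorm_zero_iff _ |>.1 (le_antisymm (by linarith) (norm_nonneg w))

/-- The exponential maps neighbourhoods of `0` onto neighbourhoods of `1`, and a small logarithm of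
a multiplicative map is a derivation. -/
theorem exists_exp_eq_of_isMultiplicative (μ : E →L[ℝ] E →L[ℝ] E) {s : Set (E →L[ℝ] E)}
    (hs : s ∈ 𝓝 0) :
    ∀ᶠ g in 𝓝 (1 : E →L[ℝ] E), IsMultiplicative μ g → ∃ X ∈ bilinDer μ, X ∈ s ∧ exp X = g := by
  obtain ⟨δ, hδ, h⟩ := exists_mem_bilinDer_of_isMultiplicative_exp μ
  have hm : Filter.map (exp : (E →L[ℝ] E) → (E →L[ℝ] E)) (𝓝 0) = 𝓝 1 := by
    have := HasStrictFDerivAt.map_nhds_eq_of_equiv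
      (f' := ContinuousLinearEquiv.refl ℝ (E →L[ℝ] E)) (hasStrictFDerivAt_exp_zero (𝕂 := ℝ))
    rwa [exp_zero] at this
  rw [← hm, Filter.eventually_map]
  filter_upwards [hs, Metric.ball_mem_nhds 0 hδ] with X hX hX' hg
  exact ⟨X, h X (by simpa using hX') hg, hX, rfl⟩

theorem contDiff_exp_clm {n : WithTop ℕ∞} : ContDiff ℝ n (exp : (E →L[ℝ] E) → (E →L[ℝ] E)) :=
  (contDiff_iff_contDiffAt.2 fun X => (exp_analytic (𝕂 := ℝ) X).contDiffAt)

theorem IsMultiplicative.mul {μ : E →L[ℝ] E →L[ℝ] E} {g h : E →L[ℝ] E}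
    (hg : IsMultiplicative μ g) (hh : IsMultiplicative μ h) : IsMultiplicative μ (g * h) :=
  fun a b => by simp [hh a b, hg _ _]

theorem contDiff_submodule_coe {V : Type*} [NormedAddCommGroup V] [NormedSpace ℝ V]
    {n : WithTop ℕ∞} (W : Submodule ℝ V) : ContDiff ℝ n fun x : W => (x : V) :=
  W.subtypeL.contDiff

theorem contDiff_exp_mul_one_add {V : Type*} [NormedRing V] [NormedAlgebra ℝ V] [CompleteSpace V]
    {n : WithTop ℕ∞} (H W : Submodule ℝ V) :
    ContDiff ℝ n fun p : H × W => exp (p.1 : V) * (1 + (p.2 : V)) := by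
  have he : ContDiff ℝ n (exp : V → V) :=
    contDiff_iff_contDiffAt.2 fun X => (exp_analytic (𝕂 := ℝ) X).contDiffAt
  exact (he.comp ((contDiff_submodule_coe H).comp contDiff_fst)).mul
    (contDiff_const.add ((contDiff_submodule_coe W).comp contDiff_snd))

/-- The derivative at the origin is the sum map `H × W → V`, invertible for complements. The inverse
function theorem then splits exponentials of elements of `H` off on the left near `1`. -/
theorem hasFDerivAt_exp_mul_one_add {V : Type*} [NormedRing V] [NormedAlgebra ℝ V]
    [FiniteDimensional ℝ V] [CompleteSpace V] {H W : Submodule ℝ V} (hW : IsCompl H W) :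
    HasFDerivAt (fun p : H × W => exp (p.1 : V) * (1 + (p.2 : V)))
      ((Submodule.prodEquivOfIsCompl H W hW).toContinuousLinearEquiv : H × W →L[ℝ] V) 0 := by
  have h1 : HasFDerivAt (fun p : H × W => exp (p.1 : V))
      (H.subtypeL ∘L ContinuousLinearMap.fst ℝ _ _) 0 := by
    have h := HasFDerivAt.comp (0 : H × W) (g := (exp : V → V))
      (hasStrictFDerivAt_exp_zero (𝕂 := ℝ)).hasFDerivAt
      (H.subtypeL ∘L ContinuousLinearMap.fst ℝ H W).hasFDerivAt
    rw [ContinuousLinearMap.one_def, ContinuousLinearMap.id_comp] at h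
    exact h
  have h2 : HasFDerivAt (fun p : H × W => (1 : V) + p.2)
      (W.subtypeL ∘L ContinuousLinearMap.snd ℝ _ _) 0 :=
    (W.subtypeL ∘L ContinuousLinearMap.snd ℝ H W).hasFDerivAt.const_add 1
  refine (h1.mul' h2).congr_fderiv (ContinuousLinearMap.ext fun p => ?_)
  simp [add_comm]

/-- A local slice for the group of multiplicative maps, which acts by left multiplication on the
space of all endomorphisms. -/
theorem exists_multiplicative_slice [FiniteDimensional ℝ E] (μ : E →L[ℝ] E →L[ℝ] E) :
    ∃ (P : Set (E →L[ℝ] E)) (X : (E →L[ℝ] E) → (E →L[ℝ] E)), IsOpen P ∧ 1 ∈ P ∧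
      ContDiffOn ℝ ∞ X P ∧ (∀ g ∈ P, X g ∈ bilinDer μ) ∧
      ∀ τ g, IsMultiplicative μ τ → g ∈ P → τ * g ∈ P →
        exp (-X (τ * g)) * τ = exp (-X g) := by
  -- Near `1` every `g` is uniquely `exp X * (1 + w)` with `X` a small derivation and `w` small in a
  -- complement `W`; the slice coordinate is `X`.
  obtain ⟨W, hW⟩ := Submodule.exists_isCompl (bilinDer μ)
  let Φ : bilinDer μ × W → (E →L[ℝ] E) := fun p => exp (p.1 : E →L[ℝ] E) * (1 + p.2)
  let L := (Submodule.prodEquivOfIsCompl (bilinDer μ) W hW).toContinuousLinearEquiv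
  have hs1 : ContDiff ℝ ω fun x : bilinDer μ => (x : E →L[ℝ] E) := contDiff_submodule_coe _
  have hΦ : ContDiff ℝ ω Φ := contDiff_exp_mul_one_add _ _
  have hd : HasFDerivAt Φ (L : bilinDer μ × W →L[ℝ] (E →L[ℝ] E)) 0 :=
    hasFDerivAt_exp_mul_one_add hW
  have hne : (ω : WithTop ℕ∞) ≠ 0 := by simp
  let f := hΦ.contDiffAt.toOpenPartialHomeomorph Φ hd hne
  have hf : ∀ p, f p = Φ p := fun _ => rfl
  have h0 : (0 : bilinDer μ × W) ∈ f.source :=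
    hΦ.contDiffAt.mem_toOpenPartialHomeomorph_source hd hne
  have hΦ0 : Φ 0 = 1 := by simp [Φ]
  have h1 : (1 : E →L[ℝ] E) ∈ f.target := by
    rw [← hΦ0]; exact f.map_source h0
  have hsymm : f.symm 1 = 0 := by rw [← hΦ0]; exact f.left_inv h0
  have hcs : ContDiffAt ℝ ω f.symm 1 :=
    f.contDiffAt_symm (f₀' := L) h1 (by rw [hsymm]; exact hd) hΦ.contDiffAt
  obtain ⟨r, hr, hrs⟩ := Metric.isOpen_iff.1 f.open_source 0 h0
  obtain ⟨ε, hε, hεs⟩ := Metric.eventually_nhds_iff.1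
    (exists_exp_eq_of_isMultiplicative μ (Metric.ball_mem_nhds 0 hr))
  -- Below, `u - 1 = w' - w - (u - 1) w` with `‖w‖, ‖w'‖ < η ≤ 1/2`, whence `‖u - 1‖ < 4 η ≤ ε`. The
  -- bound by `r` keeps the pairs in the domain of the chart.
  obtain ⟨η, hη, hη1, hη2, hη3⟩ : ∃ η > 0, η ≤ r ∧ η ≤ 1/2 ∧ 4 * η ≤ ε :=
    ⟨min r (min (1/2) (ε/4)), by positivity, min_le_left _ _,
      (min_le_right _ _).trans (min_le_left _ _), by
        have := (min_le_right r (min (1/2) (ε/4))).trans (min_le_right _ _)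
        linarith⟩
  have hev : ∀ᶠ g in 𝓝 (1 : E →L[ℝ] E), g ∈ f.target ∧ ContDiffAt ℝ ω f.symm g ∧
      ‖(f.symm g).2‖ < η := by
    refine (show ∀ᶠ g in 𝓝 (1 : E →L[ℝ] E), g ∈ f.target from f.open_target.mem_nhds h1).and ((hcs.eventually (by simp)).and ?_)
    have : ContinuousAt (fun g => ‖(f.symm g).2‖) 1 := hcs.continuousAt.snd.norm
    have h2 : ‖(f.symm 1).2‖ < η := by
      rw [hsymm]
      exact (norm_zero (E := W)).trans_lt hη
    exact this.eventually (gt_mem_nhds h2)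
  obtain ⟨P, hP, hPo, hP1⟩ := mem_nhds_iff.1 hev
  have hdec : ∀ g ∈ P, exp ((f.symm g).1 : E →L[ℝ] E) * (1 + (f.symm g).2) = g :=
    fun g hg => f.right_inv (hP hg).1
  refine ⟨P, fun g => (f.symm g).1, hPo, hP1, fun g hg => ?_, fun g _ => (f.symm g).1.2, ?_⟩
  · exact ((hs1.contDiffAt.comp g (hP hg).2.1.fst).of_le (by simp)).contDiffWithinAt
  · intro τ g hτ hg hg'
    set X := (f.symm g).1
    set w := (f.symm g).2
    set X' := (f.symm (τ * g)).1
    set w' := (f.symm (τ * g)).2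
    have hw : ‖w‖ < η := (hP hg).2.2
    have hw' : ‖w'‖ < η := (hP hg').2.2
    -- This `u` is multiplicative and close to `1`, so `u = exp Z` for a small derivation `Z`.
    -- Uniqueness of the decomposition in `exp Z * (1 + w) = 1 + w'` forces `Z = 0`, that is `u =
    -- 1`.
    set u : E →L[ℝ] E := exp (-(X' : E →L[ℝ] E)) * τ * exp (X : E →L[ℝ] E) with hu
    have hum : IsMultiplicative μ u :=
      ((isMultiplicative_exp μ (neg_mem X'.2)).mul hτ).mul (isMultiplicative_exp μ X.2)
    have huw : u * (1 + w) = 1 + w' := by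
      rw [hu, mul_assoc, hdec g hg, mul_assoc, ← hdec _ hg', ← mul_assoc, exp_neg_mul_exp_clm,
        one_mul]
    have hu1 : ‖u - 1‖ < ε := by
      have e : u - 1 = (w' : E →L[ℝ] E) - w - (u - 1) * w := by
        have := congrArg (fun z => z - (1 + (w : E →L[ℝ] E))) huw
        simp only [mul_add, mul_one] at this
        rw [sub_mul, one_mul]
        have h8 : u + u * w - (1 + w) = (1 + w') - (1 + (w : E →L[ℝ] E)) := this
        have h9 : u - 1 = (u + u * w - (1 + w)) - (u * w - w) := by abel
        rw [h9, h8]; abel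
      have h3 := norm_sub_le ((w' : E →L[ℝ] E) - w) ((u - 1) * w)
      rw [← e] at h3
      have h4 := norm_sub_le (w' : E →L[ℝ] E) w
      have h5 := norm_mul_le (u - 1) (w : E →L[ℝ] E)
      have h6 : ‖(w : E →L[ℝ] E)‖ < η := hw
      have h7 : ‖(w' : E →L[ℝ] E)‖ < η := hw'
      nlinarith [norm_nonneg (u - 1)]
    obtain ⟨Z, hZ, hZr, hZu⟩ := hεs (by rwa [dist_eq_norm]) hum
    have hin1 : ((⟨Z, hZ⟩, w) : bilinDer μ × W) ∈ f.source := hrs (by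
      rw [mem_ball_zero_iff] at hZr ⊢
      exact max_lt hZr (hw.trans_le hη1))
    have hin2 : ((0, w') : bilinDer μ × W) ∈ f.source := hrs (by
      rw [mem_ball_zero_iff]
      exact max_lt (by simpa using hr) (hw'.trans_le hη1))
    have heq := f.injOn hin1 hin2 (by
      rw [hf, hf]
      simp only [Φ, hZu, huw, ZeroMemClass.coe_zero, exp_zero, one_mul])
    have hZ0 : Z = 0 := congrArg (fun p : bilinDer μ × W => (p.1 : E →L[ℝ] E)) heq
    rw [hZ0, exp_zero] at hZu
    have := congrArg (fun z => z * exp (-(X : E →L[ℝ] E))) hZu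
    simp only [hu, one_mul] at this
    rw [mul_assoc, exp_mul_exp_neg_clm, mul_one] at this
    exact this.symm

end BilinearProduct

/-! ### Smooth families in finite dimensional spaces -/

/-- The family `g` of elements of `V` is smooth on `u` when its real components are. -/
def SmoothFamilyOn {T V : Type*} [NormedAddCommGroup T] [NormedSpace ℝ T] [AddCommGroup V]
    [Module ℝ V] (u : Set T) (g : T → V) : Prop :=
  ∀ l : V →ₗ[ℝ] ℝ, ContDiffOn ℝ ∞ (fun t => l (g t)) u

namespace SmoothFamilyOn

variable {T V W Z : Type*} [NormedAddCommGroup T] [NormedSpace ℝ T] [AddCommGroup V]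
  [Module ℝ V] [AddCommGroup W] [Module ℝ W] [AddCommGroup Z] [Module ℝ Z] {u u' : Set T}

theorem mono {g : T → V} (hg : SmoothFamilyOn u g) (h : u' ⊆ u) : SmoothFamilyOn u' g :=
  fun l => (hg l).mono h

theorem congr {g g' : T → V} (hg : SmoothFamilyOn u g) (h : ∀ t ∈ u, g' t = g t) :
    SmoothFamilyOn u g' :=
  fun l => (hg l).congr fun t ht => by rw [h t ht]

theorem const (c : V) : SmoothFamilyOn u fun _ => c := fun _ => contDiffOn_const

theorem map {g : T → V} (hg : SmoothFamilyOn u g) (L : V →ₗ[ℝ] W) :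
    SmoothFamilyOn u fun t => L (g t) := fun l => hg (l ∘ₗ L)

theorem add {g g' : T → V} (hg : SmoothFamilyOn u g) (hg' : SmoothFamilyOn u g') :
    SmoothFamilyOn u fun t => g t + g' t := fun l => by
  simpa only [map_add] using! (hg l).add (hg' l)

theorem sub {g g' : T → V} (hg : SmoothFamilyOn u g) (hg' : SmoothFamilyOn u g') :
    SmoothFamilyOn u fun t => g t - g' t := fun l => by
  simpa only [map_sub] using! (hg l).sub (hg' l)

theorem neg {g : T → V} (hg : SmoothFamilyOn u g) : SmoothFamilyOn u fun t => - g t :=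
  hg.map (-LinearMap.id)

theorem sum {ι : Type*} {s : Finset ι} {g : ι → T → V} (hg : ∀ i ∈ s, SmoothFamilyOn u (g i)) :
    SmoothFamilyOn u fun t => ∑ i ∈ s, g i t := fun l => by
  simpa only [map_sum] using! ContDiffOn.sum fun i hi => hg i hi l

theorem smul {c : T → ℝ} {g : T → V} (hc : ContDiffOn ℝ ∞ c u) (hg : SmoothFamilyOn u g) :
    SmoothFamilyOn u fun t => c t • g t := fun l => by
  simpa only [map_smul] using! hc.smul (hg l)

theorem pi {ι : Type*} [Fintype ι] {g : T → ι → V} (hg : ∀ i, SmoothFamilyOn u fun t => g t i) :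
    SmoothFamilyOn u g := by
  classical
  intro l
  have : (fun t => l (g t)) = fun t => ∑ i, (l ∘ₗ LinearMap.single ℝ (fun _ => V) i) (g t i) := by
    funext t
    conv_lhs => rw [← LinearMap.sum_single_apply (fun _ => V) (g t)]
    simp
  rw [this]
  exact ContDiffOn.sum fun i _ => hg i _

theorem bilin [Module.Finite ℝ V] (b : V →ₗ[ℝ] W →ₗ[ℝ] Z) {g : T → V}
    {g' : T → W} (hg : SmoothFamilyOn u g) (hg' : SmoothFamilyOn u g') :
    SmoothFamilyOn u fun t => b (g t) (g' t) := by
  let e := Module.finBasis ℝ V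
  have : (fun t => b (g t) (g' t)) = fun t => ∑ i, (e.coord i) (g t) • b (e i) (g' t) := by
    funext t
    conv_lhs => rw [← e.sum_repr (g t)]
    simp only [map_sum, map_smul, LinearMap.sum_apply, LinearMap.smul_apply, Module.Basis.coord_apply]
  rw [this]
  exact sum fun i _ => smul (hg _) (hg'.map _)

theorem mul {A : Type*} [CommRing A] [Algebra ℝ A] [Module.Finite ℝ A] {g g' : T → A}
    (hg : SmoothFamilyOn u g) (hg' : SmoothFamilyOn u g') :
    SmoothFamilyOn u fun t => g t * g' t :=
  bilin (LinearMap.mul ℝ A) hg hg'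

theorem end_apply [Module.Finite ℝ V] {C : T → V →ₗ[ℝ] W} {g : T → V} (hC : SmoothFamilyOn u C)
    (hg : SmoothFamilyOn u g) : SmoothFamilyOn u fun t => C t (g t) :=
  bilin (LinearMap.applyₗ) hg hC

theorem of_apply [Module.Finite ℝ V] {C : T → V →ₗ[ℝ] W}
    (hC : ∀ v, SmoothFamilyOn u fun t => C t v) : SmoothFamilyOn u C := by
  let e := Module.finBasis ℝ V
  have : C = fun t => ∑ i, LinearMap.smulRightₗ (e.coord i) (C t (e i)) := by
    funext t
    refine LinearMap.ext fun v => ?_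
    conv_lhs => rw [← e.sum_repr v]
    simp only [map_sum, map_smul, LinearMap.sum_apply, LinearMap.smulRightₗ_apply, LinearMap.smulRight_apply,
      Module.Basis.coord_apply]
  rw [this]
  exact sum fun i _ => (hC (e i)).map _

theorem comp [Module.Finite ℝ V] [Module.Finite ℝ W] {C : T → V →ₗ[ℝ] W} {C' : T → W →ₗ[ℝ] Z}
    (hC : SmoothFamilyOn u C) (hC' : SmoothFamilyOn u C') :
    SmoothFamilyOn u fun t => C' t ∘ₗ C t :=
  of_apply fun v => hC'.end_apply (hC.map (LinearMap.applyₗ v))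

theorem iff_contDiffOn {F : Type*} [NormedAddCommGroup F] [NormedSpace ℝ F]
    [FiniteDimensional ℝ F] {g : T → F} : SmoothFamilyOn u g ↔ ContDiffOn ℝ ∞ g u := by
  constructor
  · intro hg
    let e := (Module.finBasis ℝ F).equivFun.toContinuousLinearEquiv
    have : ContDiffOn ℝ ∞ (e ∘ g) u := contDiffOn_pi.2 fun i => hg ((Module.finBasis ℝ F).coord i)
    have h2 := e.symm.contDiff.comp_contDiffOn this
    rwa [← Function.comp_assoc, e.symm_comp_self] at h2
  · intro hg l
    exact (LinearMap.toContinuousLinearMap l).contDiff.comp_contDiffOn hg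

theorem comp_left {F : Type*} [NormedAddCommGroup F] [NormedSpace ℝ F] {g : T → V}
    (hg : SmoothFamilyOn u g) {f : F → T} {s : Set F} (hf : ContDiffOn ℝ ∞ f s)
    (h : Set.MapsTo f s u) : SmoothFamilyOn s (g ∘ f) :=
  fun l => (hg l).comp hf h

theorem of_local {g : T → V}
    (hg : ∀ t ∈ u, ∃ s, IsOpen s ∧ t ∈ s ∧ SmoothFamilyOn s g) : SmoothFamilyOn u g := by
  intro l t ht
  obtain ⟨s, hs, hts, h⟩ := hg t ht
  exact ((h l).contDiffAt (hs.mem_nhds hts)).contDiffWithinAt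

end SmoothFamilyOn

/-- The inverse of a bijective linear map, and `0` for other linear maps. -/
def linInv {V W : Type*} [AddCommGroup V] [Module ℝ V] [AddCommGroup W] [Module ℝ W]
    (C : V →ₗ[ℝ] W) : W →ₗ[ℝ] V :=
  open Classical in
  if h : Function.Bijective C then (LinearEquiv.ofBijective C h).symm else 0

/-! ### Smooth inversion of families of linear maps -/

section LinInv

variable {T V W : Type*} [NormedAddCommGroup T] [NormedSpace ℝ T] [AddCommGroup V]
  [Module ℝ V] [AddCommGroup W] [Module ℝ W]

theorem apply_linInv {C : V →ₗ[ℝ] W} (h : Function.Bijective C) (w : W) : C (linInv C w) = w := by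
  rw [linInv, dif_pos h]
  exact (LinearEquiv.ofBijective C h).apply_symm_apply w

variable [Module.Finite ℝ V] [Module.Finite ℝ W] {u : Set T} {C : T → V →ₗ[ℝ] W}

theorem SmoothFamilyOn.matrix_det {m : Type*} [Fintype m] [DecidableEq m] {A : T → Matrix m m ℝ}
    (hA : ∀ i j, ContDiffOn ℝ ∞ (fun t => A t i j) u) : ContDiffOn ℝ ∞ (fun t => (A t).det) u := by
  simp only [Matrix.det_apply]
  exact ContDiffOn.sum fun σ _ => (contDiffOn_prod fun i _ => hA _ _).const_smul _

/-- Composition with the inverse of `C t₀` turns the family into square matrices, equal to `1` at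
`t₀`. Nonvanishing of the determinant is an open condition, and Cramer's rule makes the inverse
smooth. -/
theorem SmoothFamilyOn.bijective_and_linInv (hC : SmoothFamilyOn u C) (hu : IsOpen u) {t₀ : T}
    (ht₀ : t₀ ∈ u) (hb : Function.Bijective (C t₀)) :
    ∃ s, IsOpen s ∧ t₀ ∈ s ∧ s ⊆ u ∧ (∀ t ∈ s, Function.Bijective (C t)) ∧
      SmoothFamilyOn s fun t => linInv (C t) := by
  let E := LinearEquiv.ofBijective (C t₀) hb
  let e := Module.finBasis ℝ V
  let A : T → Matrix _ _ ℝ := fun t => LinearMap.toMatrix e e (E.symm.toLinearMap ∘ₗ C t)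
  have hA : ∀ i j, ContDiffOn ℝ ∞ (fun t => A t i j) u := fun i j => by
    simp only [A, LinearMap.toMatrix_apply]
    exact hC ((e.coord i) ∘ₗ E.symm.toLinearMap ∘ₗ LinearMap.applyₗ (e j))
  have hdet : ContDiffOn ℝ ∞ (fun t => (A t).det) u := SmoothFamilyOn.matrix_det hA
  have hA₀ : A t₀ = 1 := by
    have : E.symm.toLinearMap ∘ₗ C t₀ = LinearMap.id :=
      LinearMap.ext fun v => E.symm_apply_apply v
    simp only [A, this, LinearMap.toMatrix_id]
  let s := u ∩ (fun t => (A t).det) ⁻¹' {0}ᶜ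
  have hs : IsOpen s := hdet.continuousOn.isOpen_inter_preimage hu isOpen_compl_singleton
  have key : ∀ t ∈ s, (Matrix.toLin e e (A t)⁻¹ ∘ₗ E.symm.toLinearMap) ∘ₗ C t = LinearMap.id ∧
      C t ∘ₗ (Matrix.toLin e e (A t)⁻¹ ∘ₗ E.symm.toLinearMap) = LinearMap.id := by
    intro t ht
    have hunit : IsUnit (A t).det := isUnit_iff_ne_zero.2 ht.2
    have hAt : E.symm.toLinearMap ∘ₗ C t = Matrix.toLin e e (A t) := by simp [A]
    have hCt : C t = E.toLinearMap ∘ₗ Matrix.toLin e e (A t) := by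
      rw [← hAt]; ext v; simp
    constructor
    · rw [LinearMap.comp_assoc, hAt, ← Matrix.toLin_mul, Matrix.nonsing_inv_mul _ hunit,
        Matrix.toLin_one]
    · rw [hCt, LinearMap.comp_assoc, ← LinearMap.comp_assoc _ (Matrix.toLin e e (A t)⁻¹),
        ← Matrix.toLin_mul, Matrix.mul_nonsing_inv _ hunit, Matrix.toLin_one]
      ext v; simp
  have hbij : ∀ t ∈ s, Function.Bijective (C t) := fun t ht =>
    ⟨Function.LeftInverse.injective (g := Matrix.toLin e e (A t)⁻¹ ∘ₗ E.symm.toLinearMap)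
      (LinearMap.congr_fun (key t ht).1),
      Function.RightInverse.surjective (g := Matrix.toLin e e (A t)⁻¹ ∘ₗ E.symm.toLinearMap)
      (LinearMap.congr_fun (key t ht).2)⟩
  refine ⟨s, hs, ⟨ht₀, by simp [hA₀]⟩, Set.inter_subset_left, hbij, ?_⟩
  have hinv : ∀ i j, ContDiffOn ℝ ∞ (fun t => (A t)⁻¹ i j) s := fun i j => by
    simp only [Matrix.inv_def, Matrix.smul_apply, Ring.inverse_eq_inv', smul_eq_mul,
      Matrix.adjugate_apply]
    refine ((hdet.mono Set.inter_subset_left).inv fun t ht => ht.2).mul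
      (SmoothFamilyOn.matrix_det fun k l => ?_)
    by_cases hk : k = j
    · subst hk
      simp only [Matrix.updateRow_self]
      exact contDiffOn_const
    · simp only [Matrix.updateRow_ne hk]
      exact (hA k l).mono Set.inter_subset_left
  refine SmoothFamilyOn.congr
    (g := fun t => Matrix.toLin e e (A t)⁻¹ ∘ₗ E.symm.toLinearMap) ?_ fun t ht => ?_
  · refine SmoothFamilyOn.of_apply fun w => ?_
    simp only [LinearMap.comp_apply, Matrix.toLin_apply, Matrix.mulVec, dotProduct]
    refine SmoothFamilyOn.sum fun i _ => SmoothFamilyOn.smul ?_ (SmoothFamilyOn.const _)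
    exact ContDiffOn.sum fun j _ => (hinv i j).mul contDiffOn_const
  · refine LinearMap.ext fun w => (hbij t ht).1 ?_
    rw [apply_linInv (hbij t ht)]
    exact (LinearMap.congr_fun (key t ht).2 w).symm

end LinInv

/-! ### The exponential of a derivation of a finite dimensional algebra -/

section LinExp

open NormedSpace

variable {V W : Type*} [AddCommGroup V] [Module ℝ V] [Module.Finite ℝ V]
  [AddCommGroup W] [Module ℝ W] [Module.Finite ℝ W]

variable (V) in
/-- Linear coordinates on a finite dimensional space. -/
def coordEquiv : V ≃ₗ[ℝ] (Fin (Module.finrank ℝ V) → ℝ) := (Module.finBasis ℝ V).equivFun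

variable (V) in
/-- The endomorphisms of a finite dimensional space, in coordinates. -/
def endCoord : Module.End ℝ V ≃ₐ[ℝ]
    ((Fin (Module.finrank ℝ V) → ℝ) →L[ℝ] (Fin (Module.finrank ℝ V) → ℝ)) :=
  ((coordEquiv V).conjAlgEquiv ℝ).trans (Module.End.toContinuousLinearMap _)

theorem endCoord_apply (X : Module.End ℝ V) (v : V) :
    endCoord V X (coordEquiv V v) = coordEquiv V (X v) := by
  change coordEquiv V (X ((coordEquiv V).symm (coordEquiv V v))) = _
  rw [LinearEquiv.symm_apply_apply]

theorem endCoord_symm_apply (g : (Fin (Module.finrank ℝ V) → ℝ) →L[ℝ] (Fin (Module.finrank ℝ V) → ℝ))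
    (v : V) : coordEquiv V ((endCoord V).symm g v) = g (coordEquiv V v) := by
  rw [← endCoord_apply, AlgEquiv.apply_symm_apply]

/-- The exponential of an endomorphism of a finite dimensional space. -/
def linExp (X : Module.End ℝ V) : Module.End ℝ V := (endCoord V).symm (exp (endCoord V X))

theorem endCoord_linExp (X : Module.End ℝ V) : endCoord V (linExp X) = exp (endCoord V X) :=
  (endCoord V).apply_symm_apply _

theorem linExp_neg_mul (X : Module.End ℝ V) : linExp (-X) * linExp X = 1 := by
  apply (endCoord V).injective
  rw [map_mul, endCoord_linExp, endCoord_linExp, map_neg, exp_neg_mul_exp_clm, map_one]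

theorem linExp_mul_neg (X : Module.End ℝ V) : linExp X * linExp (-X) = 1 := by
  simpa using linExp_neg_mul (-X)

theorem SmoothFamilyOn.linExp {T : Type*} [NormedAddCommGroup T] [NormedSpace ℝ T] {u : Set T}
    {X : T → Module.End ℝ V} (hX : SmoothFamilyOn u X) :
    SmoothFamilyOn u fun t => linExp (X t) := by
  have h1 : ContDiffOn ℝ ∞ (fun t => endCoord V (X t)) u :=
    SmoothFamilyOn.iff_contDiffOn.1 (hX.map (endCoord V).toLinearMap)
  have h2 : ContDiffOn ℝ ∞ (fun t => exp (endCoord V (X t))) u :=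
    contDiff_exp_clm.comp_contDiffOn h1
  exact (SmoothFamilyOn.iff_contDiffOn.2 h2).map (endCoord V).symm.toLinearMap

theorem hasSum_linExp (X : Module.End ℝ V) (v : V) :
    HasSum (fun n : ℕ => (n.factorial : ℝ)⁻¹ • coordEquiv V ((X ^ n) v))
      (coordEquiv V (linExp X v)) := by
  have h := exp_series_hasSum_exp' (𝕂 := ℝ) (endCoord V X)
  have h2 := h.mapL (ContinuousLinearMap.apply ℝ _ (coordEquiv V v))
  rw [linExp, endCoord_symm_apply]
  refine h2.congr_fun fun n => ?_
  simp only [map_smul, ContinuousLinearMap.apply_apply]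
  rw [← map_pow, endCoord_apply]

/-- A linear map that intertwines two endomorphisms intertwines every term of the exponential
series. -/
theorem linExp_comm (φ : V →ₗ[ℝ] W) {X : Module.End ℝ V} {Y : Module.End ℝ W}
    (h : ∀ v, φ (X v) = Y (φ v)) (v : V) : φ (linExp X v) = linExp Y (φ v) := by
  apply (coordEquiv W).injective
  let Ψ := LinearMap.toContinuousLinearMap
    ((coordEquiv W).toLinearMap ∘ₗ φ ∘ₗ (coordEquiv V).symm.toLinearMap)
  have hΨ : ∀ v, Ψ (coordEquiv V v) = coordEquiv W (φ v) := fun v => by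
    change coordEquiv W (φ ((coordEquiv V).symm (coordEquiv V v))) = _
    rw [LinearEquiv.symm_apply_apply]
  have h1 := (hasSum_linExp X v).mapL Ψ
  rw [hΨ] at h1
  refine h1.unique ((hasSum_linExp Y (φ v)).congr_fun fun n => ?_)
  rw [map_smul, hΨ]
  congr 2
  clear h1
  induction n generalizing v with
  | zero => rfl
  | succ n ih => rw [pow_succ, pow_succ, Module.End.mul_apply, Module.End.mul_apply, ← h, ih]

/-- Recovers `X` from its one-parameter group, so that properties of automorphisms can be
differentiated into properties of derivations. -/
theorem hasDerivAt_linExp_smul (l : V →ₗ[ℝ] ℝ) (X : Module.End ℝ V) (v : V) :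
    HasDerivAt (fun t : ℝ => l (linExp (t • X) v)) (l (X v)) 0 := by
  let Ψ := LinearMap.toContinuousLinearMap (l ∘ₗ (coordEquiv V).symm.toLinearMap)
  have hΨ : ∀ v, l v = Ψ (coordEquiv V v) := fun v => by
    change _ = l ((coordEquiv V).symm (coordEquiv V v))
    rw [LinearEquiv.symm_apply_apply]
  have h := (hasDerivAt_exp_smul_const' (𝕂 := ℝ) (endCoord V X) 0).clm_apply
    (hasDerivAt_const 0 (coordEquiv V v))
  have h2 := Ψ.hasFDerivAt.comp_hasDerivAt (0 : ℝ) h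
  simp only [zero_smul, exp_zero, mul_one, map_zero, add_zero, endCoord_apply, ← hΨ] at h2
  refine h2.congr_of_eventuallyEq (Filter.Eventually.of_forall fun t => ?_)
  simp only [Function.comp_apply]
  rw [hΨ, linExp, endCoord_symm_apply, map_smul]

theorem eventually_linExp_injOn (V : Type*) [AddCommGroup V] [Module ℝ V] [Module.Finite ℝ V] :
    ∃ s ∈ 𝓝 (0 : (Fin (Module.finrank ℝ V) → ℝ) →L[ℝ] (Fin (Module.finrank ℝ V) → ℝ)),
      ∀ X Y : Module.End ℝ V, endCoord V X ∈ s → endCoord V Y ∈ s → linExp X = linExp Y →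
        X = Y := by
  have f : HasStrictFDerivAt
      (exp : ((Fin (Module.finrank ℝ V) → ℝ) →L[ℝ] (Fin (Module.finrank ℝ V) → ℝ)) → _)
      ((ContinuousLinearEquiv.refl ℝ ((Fin (Module.finrank ℝ V) → ℝ) →L[ℝ]
        (Fin (Module.finrank ℝ V) → ℝ))) : _ →L[ℝ] _) 0 :=
    hasStrictFDerivAt_exp_zero (𝕂 := ℝ)
  refine ⟨(f.toOpenPartialHomeomorph exp).source,
    (f.toOpenPartialHomeomorph exp).open_source.mem_nhds f.mem_toOpenPartialHomeomorph_source,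
    fun X Y hX hY h => (endCoord V).injective
      ((f.toOpenPartialHomeomorph exp).injOn hX hY ?_)⟩
  change exp (endCoord V X) = exp (endCoord V Y)
  rw [← endCoord_linExp, ← endCoord_linExp, h]

end LinExp

/-! ### Exponentials of derivations as algebra automorphisms -/

section ExpAut

open NormedSpace

variable {A : Type*} [CommRing A] [Algebra ℝ A] [Module.Finite ℝ A]

variable (A) in
/-- The product of a finite dimensional algebra, in coordinates. -/
def mulCoord : (Fin (Module.finrank ℝ A) → ℝ) →L[ℝ] (Fin (Module.finrank ℝ A) → ℝ) →L[ℝ]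
    (Fin (Module.finrank ℝ A) → ℝ) :=
  LinearMap.toContinuousBilinearMap
    (((LinearMap.mul ℝ A).compl₁₂ (coordEquiv A).symm.toLinearMap
      (coordEquiv A).symm.toLinearMap).compr₂ (coordEquiv A).toLinearMap)

theorem mulCoord_apply (a b : A) :
    mulCoord A (coordEquiv A a) (coordEquiv A b) = coordEquiv A (a * b) := by
  change coordEquiv A ((coordEquiv A).symm (coordEquiv A a) *
    (coordEquiv A).symm (coordEquiv A b)) = _
  simp only [LinearEquiv.symm_apply_apply]

theorem isMultiplicative_endCoord_iff (g : Module.End ℝ A) :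
    IsMultiplicative (mulCoord A) (endCoord A g) ↔ ∀ a b, g (a * b) = g a * g b := by
  refine ⟨fun h a b => (coordEquiv A).injective ?_, fun h a b => ?_⟩
  · rw [← endCoord_apply, ← mulCoord_apply, h, endCoord_apply, endCoord_apply, mulCoord_apply]
  · obtain ⟨a, rfl⟩ := (coordEquiv A).surjective a
    obtain ⟨b, rfl⟩ := (coordEquiv A).surjective b
    rw [mulCoord_apply, endCoord_apply, endCoord_apply, endCoord_apply, mulCoord_apply, h]

theorem endCoord_mem_bilinDer_iff (X : Module.End ℝ A) :
    endCoord A X ∈ bilinDer (mulCoord A) ↔ ∀ a b, X (a * b) = a * X b + b * X a := by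
  refine ⟨fun h a b => (coordEquiv A).injective ?_, fun h a b => ?_⟩
  · rw [← endCoord_apply, ← mulCoord_apply, h, endCoord_apply, endCoord_apply, mulCoord_apply,
      mulCoord_apply, ← map_add, add_comm, mul_comm b]
  · obtain ⟨a, rfl⟩ := (coordEquiv A).surjective a
    obtain ⟨b, rfl⟩ := (coordEquiv A).surjective b
    rw [mulCoord_apply, endCoord_apply, endCoord_apply, endCoord_apply, mulCoord_apply,
      mulCoord_apply, h, ← map_add, add_comm, mul_comm b]

theorem linExp_derivation_mul (D : Derivation ℝ A A) (a b : A) :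
    linExp D.toLinearMap (a * b) = linExp D.toLinearMap a * linExp D.toLinearMap b := by
  refine (isMultiplicative_endCoord_iff _).1 ?_ a b
  rw [endCoord_linExp]
  exact isMultiplicative_exp _ ((endCoord_mem_bilinDer_iff _).2 D.leibniz)

/-- A multiplicative surjection preserves the unit: evaluate it on the product of a preimage of `1`
with `1`. -/
theorem linExp_derivation_one (D : Derivation ℝ A A) : linExp D.toLinearMap 1 = 1 := by
  have h1 : linExp D.toLinearMap (linExp (-D.toLinearMap) 1) = 1 :=
    LinearMap.congr_fun (linExp_mul_neg D.toLinearMap) 1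
  have h := linExp_derivation_mul D (linExp (-D.toLinearMap) 1) 1
  rw [mul_one, h1, one_mul] at h
  exact h.symm

/-- The automorphism `exp D`, for a derivation `D` of a finite dimensional algebra. -/
def expAut (D : Derivation ℝ A A) : A ≃ₐ[ℝ] A :=
  AlgEquiv.ofLinearEquiv
    (LinearEquiv.ofLinearMap (linExp D.toLinearMap) (linExp (-D.toLinearMap))
      (linExp_mul_neg _) (linExp_neg_mul _))
    (linExp_derivation_one D) (linExp_derivation_mul D)

theorem expAut_apply (D : Derivation ℝ A A) (a : A) : expAut D a = linExp D.toLinearMap a := rfl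

theorem expAut_comm {B : Type*} [CommRing B] [Algebra ℝ B] [Module.Finite ℝ B] (φ : A →ₐ[ℝ] B)
    {D : Derivation ℝ A A} {D' : Derivation ℝ B B} (h : ∀ a, φ (D a) = D' (φ a)) (a : A) :
    φ (expAut D a) = expAut D' (φ a) :=
  linExp_comm φ.toLinearMap (X := D.toLinearMap) (Y := D'.toLinearMap) h a

theorem SmoothFamilyOn.expAut {T : Type*} [NormedAddCommGroup T] [NormedSpace ℝ T] {u : Set T}
    {D : T → Derivation ℝ A A} (hD : SmoothFamilyOn u fun t => (D t).toLinearMap)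
    {g : T → A} (hg : SmoothFamilyOn u g) : SmoothFamilyOn u fun t => expAut (D t) (g t) :=
  hD.linExp.end_apply hg

/-- A local slice for the automorphism group of a finite dimensional algebra. -/
theorem exists_automorphism_slice (A : Type*) [CommRing A] [Algebra ℝ A] [Module.Finite ℝ A] :
    ∃ (P : Set (Module.End ℝ A)) (X : Module.End ℝ A → Derivation ℝ A A), 1 ∈ P ∧
      (∀ (T : Type) [NormedAddCommGroup T] [NormedSpace ℝ T] (u : Set T) (g : T → Module.End ℝ A),
        SmoothFamilyOn u g → IsOpen u → IsOpen (u ∩ g ⁻¹' P) ∧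
          SmoothFamilyOn (u ∩ g ⁻¹' P) fun t => (X (g t)).toLinearMap) ∧
      ∀ (τ : A ≃ₐ[ℝ] A) (g : Module.End ℝ A), g ∈ P → τ.toLinearMap ∘ₗ g ∈ P →
        ∀ a, expAut (-X (τ.toLinearMap ∘ₗ g)) (τ a) = expAut (-X g) a := by
  classical
  obtain ⟨P, X, hP, hP1, hX, hXd, hτ⟩ := exists_multiplicative_slice (mulCoord A)
  -- The default value `0` outside the domain of the slice plays no role, since all claims concern
  -- points of `P`.
  let X' : Module.End ℝ A → Derivation ℝ A A := fun g =>
    if h : endCoord A g ∈ P then Derivation.mk' ((endCoord A).symm (X (endCoord A g)))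
      ((endCoord_mem_bilinDer_iff _).1
        (by rw [AlgEquiv.apply_symm_apply]; exact hXd _ h)) else 0
  have hX' : ∀ g, endCoord A g ∈ P →
      (X' g).toLinearMap = (endCoord A).symm (X (endCoord A g)) := fun g h => by
    simp only [X', dif_pos h]; rfl
  refine ⟨endCoord A ⁻¹' P, X', by simpa using hP1, fun T _ _ u g hg hu => ?_,
    fun τ g hg hg' a => ?_⟩
  · have h1 : ContDiffOn ℝ ∞ (fun t => endCoord A (g t)) u :=
      SmoothFamilyOn.iff_contDiffOn.1 (hg.map (endCoord A).toLinearMap)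
    refine ⟨h1.continuousOn.isOpen_inter_preimage hu hP, ?_⟩
    have h2 : ContDiffOn ℝ ∞ (fun t => X (endCoord A (g t))) (u ∩ g ⁻¹' (endCoord A ⁻¹' P)) :=
      hX.comp (h1.mono Set.inter_subset_left) fun t ht => ht.2
    exact ((SmoothFamilyOn.iff_contDiffOn.2 h2).map (endCoord A).symm.toLinearMap).congr
      fun t ht => hX' _ ht.2
  · have hm : endCoord A (τ.toLinearMap ∘ₗ g) = endCoord A τ.toLinearMap * endCoord A g :=
      map_mul (endCoord A) _ _
    have h := hτ (endCoord A τ.toLinearMap) (endCoord A g)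
      ((isMultiplicative_endCoord_iff _).2 (map_mul τ)) hg (by rw [← hm]; exact hg')
    have e1 : expAut (-X' (τ.toLinearMap ∘ₗ g)) (τ a) =
        linExp (-(endCoord A).symm (X (endCoord A (τ.toLinearMap ∘ₗ g)))) (τ a) := by
      rw [expAut_apply, ← hX' _ hg']; rfl
    have e2 : expAut (-X' g) a = linExp (-(endCoord A).symm (X (endCoord A g))) a := by
      rw [expAut_apply, ← hX' _ hg]; rfl
    rw [e1, e2]
    apply (coordEquiv A).injective
    simp only [linExp, endCoord_symm_apply, map_neg, AlgEquiv.apply_symm_apply]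
    rw [← h, hm]
    rw [mul_apply_eq_comp, endCoord_apply]
    rfl

end ExpAut

/-! ### Lifting derivations along a quotient with liftable automorphisms -/

/-- Otherwise the topology induced by `Γ` on `ℝ` would be discrete and second countable, and `ℝ`
would be countable. -/
theorem exists_ne_mem_of_injective_real {Z : Type*} [TopologicalSpace Z]
    [SecondCountableTopology Z] (Γ : ℝ → Z) :
    ∃ t₀, ∀ N ∈ 𝓝 (Γ t₀), ∃ t, t ≠ t₀ ∧ Γ t ∈ N := by
  by_contra! h
  let τ : TopologicalSpace ℝ := TopologicalSpace.induced Γ inferInstance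
  have h2 : @SecondCountableTopology ℝ τ := TopologicalSpace.secondCountableTopology_induced ℝ Z Γ
  have hd : @DiscreteTopology ℝ τ := by
    rw [@discreteTopology_iff_singleton_mem_nhds ℝ τ]
    intro t₀
    obtain ⟨N, hN, h⟩ := h t₀
    rw [nhds_induced]
    refine ⟨N, hN, fun t ht => ?_⟩
    by_contra hne
    exact h t hne ht
  have : Countable ℝ := @countable_of_Lindelof_of_discrete ℝ τ _ hd
  exact Cardinal.not_countable_real (Set.countable_univ_iff.2 this)

theorem linExp_add_smul {V : Type*} [AddCommGroup V] [Module ℝ V] [Module.Finite ℝ V] (a b : ℝ)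
    (X : Module.End ℝ V) : linExp ((a + b) • X) = linExp (a • X) * linExp (b • X) := by
  let _ : NormedAlgebra ℚ ((Fin (Module.finrank ℝ V) → ℝ) →L[ℝ] (Fin (Module.finrank ℝ V) → ℝ)) :=
    .restrictScalars ℚ ℝ _
  apply (endCoord V).injective
  rw [map_mul, endCoord_linExp, endCoord_linExp, endCoord_linExp, map_smul, map_smul, map_smul,
    add_smul, NormedSpace.exp_add_of_commute]
  exact ((Commute.refl _).smul_left _).smul_right _

/-! ### Infinitesimal consequences of invariance and of lifting automorphisms -/

section InvariantIdeal

variable {A : Type*} [CommRing A] [Algebra ℝ A] {I : Ideal A}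

theorem IsInvariantIdeal.apply_mem (hI : IsInvariantIdeal I) (σ : A ≃ₐ[ℝ] A) {a : A}
    (ha : a ∈ I) : σ a ∈ I := by
  have := Ideal.mem_map_of_mem (σ : A →+* A) ha
  rwa [hI σ] at this

theorem autMap_mk (hI : IsInvariantIdeal I) (σ : A ≃ₐ[ℝ] A) (a : A) :
    autMap I hI σ (Ideal.Quotient.mkₐ ℝ I a) = Ideal.Quotient.mkₐ ℝ I (σ a) := rfl

variable [Module.Finite ℝ A]

/-- The automorphisms `exp (t D)` preserve `I`; apply a linear form that vanishes on `I` and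
differentiate at `0`. -/
theorem IsInvariantIdeal.derivation_mem (hI : IsInvariantIdeal I) (D : Derivation ℝ A A) {a : A}
    (ha : a ∈ I) : D a ∈ I := by
  by_contra h
  obtain ⟨l, hl, hlI⟩ := Submodule.exists_le_ker_of_notMem (p := I.restrictScalars ℝ) h
  have hd := hasDerivAt_linExp_smul l D.toLinearMap a
  have h0 : (fun t : ℝ => l (linExp (t • D.toLinearMap) a)) = fun _ => 0 := by
    funext t
    have : expAut (t • D) a ∈ I := hI.apply_mem _ ha
    exact hlI this
  rw [h0] at hd
  exact hl (hd.unique (hasDerivAt_const 0 0))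

/-- Surjectivity on groups passes to derivations by a countability argument. Lift every `exp (t δ)`
to some `σ t`, with no regularity in `t`. Since `ℝ` is uncountable, some `σ t` with `t ≠ t₀` is as
close to `σ t₀` as needed. Then `(σ t₀)⁻¹ (σ t) = exp X` for a derivation `X` of `A`, and local
injectivity of the exponential shows that `X` induces `(t - t₀) δ`. -/
theorem exists_derivation_lift (hI : IsInvariantIdeal I) (hs : Function.Surjective (autMap I hI))
    (δ : Derivation ℝ (A ⧸ I) (A ⧸ I)) :
    ∃ D : Derivation ℝ A A, ∀ a, Ideal.Quotient.mkₐ ℝ I (D a) = δ (Ideal.Quotient.mkₐ ℝ I a) := by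
  set φ := Ideal.Quotient.mkₐ ℝ I with hφ
  obtain ⟨lam, hlam⟩ := φ.toLinearMap.exists_rightInverse_of_surjective
    (LinearMap.range_eq_top.2 (Ideal.Quotient.mkₐ_surjective ℝ I))
  have hlam' : ∀ b, φ (lam b) = b := LinearMap.congr_fun hlam
  choose σ hσ using fun t : ℝ => hs (expAut (t • δ))
  -- The parameter is kept as a component so that `t` is close to `t₀` as well.
  obtain ⟨t₀, ht₀⟩ := exists_ne_mem_of_injective_real
    fun t => (t, endCoord A (σ t).toLinearMap)
  obtain ⟨s, hs, hinj⟩ := eventually_linExp_injOn (A ⧸ I)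
  -- `R` sends an endomorphism of `A` to `φ X lam`, which is the induced endomorphism of the
  -- quotient when `X` preserves `I`. Smallness of `X` can thus be arranged to entail smallness of
  -- what it induces.
  let R := LinearMap.toContinuousLinearMap
    ((endCoord (A ⧸ I)).toLinearMap ∘ₗ (LinearMap.lcomp ℝ _ lam) ∘ₗ
      (LinearMap.compRight ℝ φ.toLinearMap) ∘ₗ (endCoord A).symm.toLinearMap)
  have hR : ∀ X, R (endCoord A X) = endCoord (A ⧸ I) (φ.toLinearMap ∘ₗ X ∘ₗ lam) := fun X => by
    change endCoord (A ⧸ I) (φ.toLinearMap ∘ₗ ((endCoord A).symm (endCoord A X)) ∘ₗ lam) = _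
    rw [AlgEquiv.symm_apply_apply]
  have hRs : R ⁻¹' s ∈ 𝓝 0 := R.continuous.continuousAt (by rwa [map_zero])
  have hc : Filter.Tendsto (fun p : ℝ × ((Fin (Module.finrank ℝ A) → ℝ) →L[ℝ]
      (Fin (Module.finrank ℝ A) → ℝ)) => endCoord A (σ t₀).symm.toLinearMap * p.2)
      (𝓝 (t₀, endCoord A (σ t₀).toLinearMap)) (𝓝 1) := by
    have : Continuous (fun p : ℝ × ((Fin (Module.finrank ℝ A) → ℝ) →L[ℝ]
      (Fin (Module.finrank ℝ A) → ℝ)) => endCoord A (σ t₀).symm.toLinearMap * p.2) := by fun_prop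
    convert this.tendsto _
    rw [← map_mul]
    convert (map_one (endCoord A)).symm
    exact LinearMap.ext (σ t₀).symm_apply_apply
  have hc' : Filter.Tendsto (fun p : ℝ × ((Fin (Module.finrank ℝ A) → ℝ) →L[ℝ]
      (Fin (Module.finrank ℝ A) → ℝ)) => (p.1 - t₀) • endCoord (A ⧸ I) δ.toLinearMap)
      (𝓝 (t₀, endCoord A (σ t₀).toLinearMap)) (𝓝 0) := by
    have : Continuous (fun p : ℝ × ((Fin (Module.finrank ℝ A) → ℝ) →L[ℝ]
      (Fin (Module.finrank ℝ A) → ℝ)) => (p.1 - t₀) • endCoord (A ⧸ I) δ.toLinearMap) := by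
      fun_prop
    convert this.tendsto _
    simp
  obtain ⟨t, hne, h1, h2⟩ := ht₀ _
    ((hc.eventually (exists_exp_eq_of_isMultiplicative (mulCoord A) hRs)).and (hc'.eventually hs))
  simp only at h1 h2
  rw [← map_mul] at h1
  obtain ⟨X, hX, hXs, hXe⟩ := h1 ((isMultiplicative_endCoord_iff _).2 fun a b => by simp)
  obtain ⟨X, rfl⟩ := (endCoord A).surjective X
  let D := Derivation.mk' X ((endCoord_mem_bilinDer_iff _).1 hX)
  have hDY : ∀ a, φ (X a) = (φ.toLinearMap ∘ₗ X ∘ₗ lam) (φ a) := fun a => by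
    have h : D (a - lam (φ a)) ∈ I := hI.derivation_mem D
      (Ideal.Quotient.eq_zero_iff_mem.1 (by
        change φ (a - lam (φ a)) = 0
        rw [map_sub, hlam', sub_self]))
    have h' : φ (X (a - lam (φ a))) = 0 := Ideal.Quotient.eq_zero_iff_mem.2 h
    rw [map_sub, map_sub] at h'
    exact sub_eq_zero.1 h'
  have hXe' : linExp X = (σ t₀).symm.toLinearMap * (σ t).toLinearMap :=
    (endCoord A).injective (by rw [endCoord_linExp, hXe])
  -- Both sides are small logarithms of the same automorphism of the quotient.
  have hY : φ.toLinearMap ∘ₗ X ∘ₗ lam = (t - t₀) • δ.toLinearMap := by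
    refine hinj _ _ (by rw [← hR]; exact hXs) (by rwa [map_smul]) (LinearMap.ext fun b => ?_)
    rw [← hlam' b, ← AlgHom.toLinearMap_apply φ,
      ← linExp_comm (φ.toLinearMap) (X := X) hDY, hXe']
    apply (expAut (t₀ • δ)).injective
    change _ = linExp (t₀ • δ.toLinearMap) _
    rw [← Module.End.mul_apply (linExp (t₀ • δ.toLinearMap)), ← linExp_add_smul,
      add_sub_cancel]
    change _ = expAut (t • δ) _
    rw [← hσ t, ← hσ t₀]
    change autMap I hI (σ t₀) (φ _) = autMap I hI (σ t) (φ _)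
    rw [autMap_mk, autMap_mk]
    congr 1
    exact (σ t₀).apply_symm_apply _
  refine ⟨(t - t₀)⁻¹ • D, fun a => ?_⟩
  have h3 : φ (D a) = (t - t₀) • δ (φ a) := by
    change φ (X a) = _
    rw [hDY, hY]; rfl
  change φ ((t - t₀)⁻¹ • D a) = _
  rw [map_smul, h3, smul_smul, inv_mul_cancel₀ (sub_ne_zero.2 hne), one_smul]

end InvariantIdeal

/-! ### Weil algebras -/

section Weil

variable (A : Type*) [CommRing A] [Algebra ℝ A] [IsWeilAlgebra A]

/-- The augmentation of a Weil algebra. -/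
def aug : A →ₐ[ℝ] ℝ := (IsWeilAlgebra.exists_augmentation (A := A)).some

variable {A}

theorem aug_eq_zero_iff {a : A} : aug A a = 0 ↔ a ∈ IsLocalRing.maximalIdeal A := by
  have hs : Function.Surjective (aug A) := fun r => ⟨algebraMap ℝ A r, by simp⟩
  have hm : (RingHom.ker (aug A)).IsMaximal := RingHom.ker_isMaximal_of_surjective _ hs
  rw [← IsLocalRing.eq_maximalIdeal hm, RingHom.mem_ker]

variable (A) in
theorem exists_maximalIdeal_pow_eq_bot : ∃ N, IsLocalRing.maximalIdeal A ^ N = ⊥ := by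
  have : IsArtinianRing A := IsArtinianRing.of_finite ℝ A
  have h := IsArtinianRing.isNilpotent_jacobson_bot (R := A)
  rwa [IsLocalRing.jacobson_eq_maximalIdeal _ bot_ne_top] at h

/-- The difference of `a` and its augmentation is nilpotent, and a real character kills nilpotent
elements. -/
theorem algHom_eq_aug (ψ : A →ₐ[ℝ] ℝ) : ψ = aug A := by
  ext a
  obtain ⟨N, hN⟩ := exists_maximalIdeal_pow_eq_bot A
  have h : a - algebraMap ℝ A (aug A a) ∈ IsLocalRing.maximalIdeal A := by
    rw [← aug_eq_zero_iff]; simp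
  have h2 : (a - algebraMap ℝ A (aug A a)) ^ N = 0 := by
    have := Ideal.pow_mem_pow h N
    rwa [hN] at this
  have h3 := congrArg ψ h2
  rw [map_pow, map_zero] at h3
  have h4 := eq_zero_of_pow_eq_zero h3
  simpa [sub_eq_zero] using h4

theorem isWeilAlgebra_quotient {I : Ideal A} (hI : I ≤ IsLocalRing.maximalIdeal A) :
    IsWeilAlgebra (A ⧸ I) := by
  have hne : I ≠ ⊤ := fun h => (IsLocalRing.maximalIdeal.isMaximal A).ne_top
    (top_le_iff.1 (h ▸ hI))
  have : Nontrivial (A ⧸ I) := Ideal.Quotient.nontrivial_iff.2 hne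
  have : IsLocalRing (A ⧸ I) :=
    IsLocalRing.of_surjective' (Ideal.Quotient.mk I) Ideal.Quotient.mk_surjective
  have : Module.Finite ℝ (A ⧸ I) :=
    Module.Finite.of_surjective (Ideal.Quotient.mkₐ ℝ I).toLinearMap
      (Ideal.Quotient.mkₐ_surjective ℝ I)
  exact { exists_augmentation := ⟨Ideal.Quotient.liftₐ I (aug A) fun a ha =>
    aug_eq_zero_iff.2 (hI ha)⟩ }

/-- A Nakayama argument: products of approximations by elements of `S` approximate products, so
approximation modulo `𝔪 ^ 2` gives approximation of each `𝔪 ^ (k + 1)` modulo `𝔪 ^ (k + 2)`.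
Successive corrections stop because `𝔪` is nilpotent. -/
theorem subalgebra_eq_top_of_sq {S : Subalgebra ℝ A}
    (h : ∀ a, ∃ s ∈ S, a - s ∈ IsLocalRing.maximalIdeal A ^ 2) : S = ⊤ := by
  set m := IsLocalRing.maximalIdeal A
  have h1 : ∀ k, ∀ a ∈ m ^ (k + 1), ∃ s ∈ S, a - s ∈ m ^ (k + 2) := by
    intro k
    induction k with
    | zero => exact fun a _ => h a
    | succ k ih =>
      intro a ha
      rw [pow_succ] at ha
      refine Submodule.mul_induction_on ha (fun b hb c hc => ?_) (fun b c hb hc => ?_)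
      · obtain ⟨s, hs, hbs⟩ := ih b hb
        obtain ⟨s', hs', hcs⟩ := h c
        refine ⟨s * s', S.mul_mem hs hs', ?_⟩
        have e : b * c - s * s' = b * (c - s') + (b - s) * s' := by ring
        have hs'm : s' ∈ m := by
          have := m.sub_mem hc (Ideal.pow_le_self two_ne_zero hcs)
          rwa [sub_sub_cancel] at this
        rw [e]
        refine Ideal.add_mem _ ?_ ?_
        · have := Ideal.mul_mem_mul hb hcs
          rwa [← pow_add] at this
        · have := Ideal.mul_mem_mul hbs hs'm
          rwa [← pow_succ] at this
      · obtain ⟨s, hs, hbs⟩ := hb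
        obtain ⟨s', hs', hcs⟩ := hc
        refine ⟨s + s', S.add_mem hs hs', ?_⟩
        rw [add_sub_add_comm]
        exact Ideal.add_mem _ hbs hcs
  obtain ⟨N, hN⟩ := exists_maximalIdeal_pow_eq_bot A
  have h2 : ∀ k, ∀ a, ∃ s ∈ S, a - s ∈ m ^ (k + 1) := by
    intro k
    induction k with
    | zero =>
      intro a
      obtain ⟨s, hs, hb⟩ := h a
      exact ⟨s, hs, Ideal.pow_le_pow_right (by omega) hb⟩
    | succ k ih =>
      intro a
      obtain ⟨s, hs, hb⟩ := ih a
      obtain ⟨s', hs', hb'⟩ := h1 k _ hb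
      exact ⟨s + s', S.add_mem hs hs', by rwa [← sub_sub]⟩
  refine eq_top_iff.2 fun a _ => ?_
  obtain ⟨s, hs, hb⟩ := h2 N a
  have : a - s ∈ m ^ N := Ideal.pow_le_pow_right (by omega) hb
  rw [hN, Ideal.mem_bot, sub_eq_zero] at this
  exact this ▸ hs

/-- This is where `I ⊆ 𝔪 ^ 2` matters: regularity modulo `I` gives regularity, so every lift of a
regular point is regular. -/
theorem surjective_of_mk_comp {R : Type*} [CommRing R] [Algebra ℝ R] {I : Ideal A}
    (hI : I ≤ IsLocalRing.maximalIdeal A ^ 2) {x : R →ₐ[ℝ] A}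
    (hx : Function.Surjective ((Ideal.Quotient.mkₐ ℝ I).comp x)) : Function.Surjective x := by
  rw [← AlgHom.range_eq_top]
  refine subalgebra_eq_top_of_sq fun a => ?_
  obtain ⟨f, hf⟩ := hx (Ideal.Quotient.mkₐ ℝ I a)
  exact ⟨x f, ⟨f, rfl⟩, hI (Ideal.Quotient.eq.1 hf.symm)⟩

end Weil

/-! ### Local coordinates on an algebra of functions -/

section Coordinates

open TensorProduct

/-- Local coordinates on an algebra `R` of functions: elements `f j` and derivations `D i` of `R`
with `D i (f j) = δᵢⱼ` where `χ ≠ 0`, such that the `f j` generate the cotangent space at every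
point where `χ ≠ 0`. -/
structure LocalCoordinates (n : ℕ) (R : Type*) [CommRing R] [Algebra ℝ R] where
  χ : R
  f : Fin n → R
  D : Fin n → Derivation ℝ R R
  mul_sub_eq_zero : ∀ i j, χ * (D i (f j) - if i = j then 1 else 0) = 0
  ker_le : ∀ ε : R →ₐ[ℝ] ℝ, ε χ ≠ 0 → RingHom.ker ε ≤
    Ideal.span (Set.range fun j => f j - algebraMap ℝ R (ε (f j))) ⊔ RingHom.ker ε ^ 2

variable {n : ℕ} {R : Type*} [CommRing R] [Algebra ℝ R]
variable {A : Type*} [CommRing A] [Algebra ℝ A] [IsWeilAlgebra A]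

/-- By induction on `k` the two points agree modulo `𝔪 ^ k`. On `ker ε` a function is a combination
of coordinate increments, where the points coincide, plus products from `ker ε`; in either case a
factor with value in `𝔪` improves the order by one. -/
theorem LocalCoordinates.algHom_ext (c : LocalCoordinates n R) {x x' : R →ₐ[ℝ] A}
    (hε : ∀ f, aug A (x f) = aug A (x' f)) (hχ : aug A (x c.χ) ≠ 0)
    (hf : ∀ j, x (c.f j) = x' (c.f j)) : x = x' := by
  set m := IsLocalRing.maximalIdeal A
  let ε : R →ₐ[ℝ] ℝ := (aug A).comp x
  have hm : ∀ g, ε g = 0 → x g ∈ m ∧ x' g ∈ m := fun g hg =>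
    ⟨aug_eq_zero_iff.1 hg, aug_eq_zero_iff.1 ((hε g).symm.trans hg)⟩
  have key : ∀ k, ∀ g, x g - x' g ∈ m ^ k := by
    intro k
    induction k with
    | zero => simp
    | succ k ih =>
      have h0 : ∀ g, ε g = 0 → x g - x' g ∈ m ^ (k + 1) := by
        intro g hg
        obtain ⟨p, hp, q, hq, rfl⟩ := Submodule.mem_sup.1 (c.ker_le ε hχ hg)
        rw [map_add, map_add, add_sub_add_comm]
        refine Ideal.add_mem _ ?_ ?_
        · have hr : ∀ r, x (r * p) - x' (r * p) ∈ m ^ (k + 1) := by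
            refine Submodule.span_induction
              (p := fun p _ => ∀ r, x (r * p) - x' (r * p) ∈ m ^ (k + 1)) ?_ (by simp)
              (fun a b _ _ ha hb r => ?_) (fun r a _ ha r' => ?_) hp
            · rintro _ ⟨j, rfl⟩ r
              have e : x' (c.f j - algebraMap ℝ R (ε (c.f j))) =
                  x (c.f j - algebraMap ℝ R (ε (c.f j))) := by
                rw [map_sub, map_sub, hf j, AlgHom.commutes, AlgHom.commutes]
              rw [map_mul, map_mul, e, ← sub_mul, pow_succ]
              exact Ideal.mul_mem_mul (ih r) (hm _ (by simp)).1
            · rw [mul_add, map_add, map_add, add_sub_add_comm]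
              exact Ideal.add_mem _ (ha r) (hb r)
            · rw [smul_eq_mul, ← mul_assoc]
              exact ha _
          simpa using hr 1
        · rw [pow_two] at hq
          refine Submodule.mul_induction_on hq (fun a ha b hb => ?_) (fun a b ha hb => ?_)
          · have e : x (a * b) - x' (a * b) = x a * (x b - x' b) + x' b * (x a - x' a) := by
              rw [map_mul, map_mul]; ring
            rw [e, pow_succ']
            exact Ideal.add_mem _ (Ideal.mul_mem_mul (hm a ha).1 (ih b))
              (Ideal.mul_mem_mul (hm b hb).2 (ih a))
          · rw [map_add, map_add, add_sub_add_comm]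
            exact Ideal.add_mem _ ha hb
      intro g
      have := h0 (g - algebraMap ℝ R (ε g)) (by simp)
      simpa using this
  obtain ⟨N, hN⟩ := exists_maximalIdeal_pow_eq_bot A
  ext g
  have := key N g
  rwa [hN, Ideal.mem_bot, sub_eq_zero] at this

/-- The derivation `∑ aᵢ ⊗ Dᵢ` of `A ⊗ R`. -/
def LocalCoordinates.tensorDer (c : LocalCoordinates n R) (a : Fin n → A) :
    Module.End ℝ (A ⊗[ℝ] R) :=
  ∑ i, TensorProduct.map (LinearMap.mulLeft ℝ (a i)) (c.D i).toLinearMap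

variable (c : LocalCoordinates n R) (a : Fin n → A)

theorem LocalCoordinates.tensorDer_tmul (b : A) (g : R) :
    c.tensorDer a (b ⊗ₜ g) = ∑ i, (a i * b) ⊗ₜ[ℝ] c.D i g := by
  simp [LocalCoordinates.tensorDer, LinearMap.sum_apply]

theorem LocalCoordinates.tensorDer_tmul_algebraMap (b : A) (r : ℝ) :
    c.tensorDer a (b ⊗ₜ algebraMap ℝ R r) = 0 := by
  simp [LocalCoordinates.tensorDer_tmul]

theorem LocalCoordinates.tensorDer_mul (p q : A ⊗[ℝ] R) :
    c.tensorDer a (p * q) = p * c.tensorDer a q + c.tensorDer a p * q := by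
  induction p with
  | zero => simp
  | add p p' hp hp' => rw [add_mul, map_add, map_add, hp, hp']; ring
  | tmul b g =>
    induction q with
    | zero => simp
    | add q q' hq hq' => rw [mul_add, map_add, map_add, hq, hq']; ring
    | tmul b' g' =>
      rw [Algebra.TensorProduct.tmul_mul_tmul, tensorDer_tmul, tensorDer_tmul, tensorDer_tmul,
        Finset.mul_sum, Finset.sum_mul, ← Finset.sum_add_distrib]
      refine Finset.sum_congr rfl fun i _ => ?_
      rw [Derivation.leibniz, Algebra.TensorProduct.tmul_mul_tmul,
        Algebra.TensorProduct.tmul_mul_tmul, tmul_add, smul_eq_mul, smul_eq_mul]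
      congr 2 <;> ring

/-- Each application multiplies the factor in `A` by some `a i`, which raises its `𝔪`-adic order. -/
theorem LocalCoordinates.tensorDer_pow_eq_zero (ha : ∀ j, a j ∈ IsLocalRing.maximalIdeal A)
    {N : ℕ} (hN : IsLocalRing.maximalIdeal A ^ N = ⊥) : c.tensorDer a ^ N = 0 := by
  have key : ∀ k, ∀ p, (c.tensorDer a ^ k) p ∈ Submodule.span ℝ
      {p : A ⊗[ℝ] R | ∃ b ∈ IsLocalRing.maximalIdeal A ^ k, ∃ g, p = b ⊗ₜ g} := by
    intro k
    induction k with
    | zero =>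
      intro p
      induction p with
      | zero => simp
      | add p q hp hq => rw [map_add]; exact add_mem hp hq
      | tmul b g => exact Submodule.subset_span ⟨b, by simp, g, rfl⟩
    | succ k ih =>
      intro p
      rw [pow_succ' (c.tensorDer a), Module.End.mul_apply]
      refine Submodule.span_induction (p := fun p _ => c.tensorDer a p ∈ Submodule.span ℝ
        {p : A ⊗[ℝ] R | ∃ b ∈ IsLocalRing.maximalIdeal A ^ (k + 1), ∃ g, p = b ⊗ₜ g})
        ?_ (by simp) (fun p q _ _ hp hq => by rw [map_add]; exact add_mem hp hq)
        (fun r p _ hp => by rw [map_smul]; exact Submodule.smul_mem _ _ hp) (ih p)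
      rintro _ ⟨b, hb, g, rfl⟩
      rw [tensorDer_tmul]
      exact sum_mem fun i _ => Submodule.subset_span
        ⟨a i * b, by rw [pow_succ']; exact Ideal.mul_mem_mul (ha i) hb, c.D i g, rfl⟩
  refine LinearMap.ext fun p => ?_
  have h := key N p
  rw [hN] at h
  have h0 : {p : A ⊗[ℝ] R | ∃ b ∈ (⊥ : Ideal A), ∃ g, p = b ⊗ₜ g} ⊆ {0} := by
    rintro _ ⟨b, hb, g, rfl⟩
    rw [Ideal.mem_bot] at hb
    simp [hb]
  simpa using Submodule.span_mono h0 h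

/-- The algebra morphism `A ⊗ R → A` of evaluation at the character `ε` of `R`. -/
def tensorEval (A : Type*) [CommRing A] [Algebra ℝ A] (ε : R →ₐ[ℝ] ℝ) : A ⊗[ℝ] R →ₐ[ℝ] A :=
  Algebra.TensorProduct.productMap (AlgHom.id ℝ A) ((Algebra.ofId ℝ A).comp ε)

theorem tensorEval_tmul (ε : R →ₐ[ℝ] ℝ) (b : A) (g : R) :
    tensorEval A ε (b ⊗ₜ g) = ε g • b := by
  rw [tensorEval, Algebra.TensorProduct.productMap_apply_tmul, Algebra.smul_def, mul_comm]
  rfl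

/-- Coordinates have no derivatives of order at least two where `χ ≠ 0`. As `D i (f j) = δᵢⱼ` holds
only after multiplication by `χ`, each further derivation costs one more power of `χ`, which is
invertible under evaluation at `ε`. -/
theorem LocalCoordinates.tensorEval_tensorDer_pow {ε : R →ₐ[ℝ] ℝ} (hε : ε c.χ ≠ 0) (j : Fin n)
    (k : ℕ) : tensorEval A ε ((c.tensorDer a ^ (k + 2)) (1 ⊗ₜ c.f j)) = 0 := by
  set X : A ⊗[ℝ] R := 1 ⊗ₜ c.χ with hX
  have hpow : ∀ r : ℕ, X * c.tensorDer a (X ^ r) = r * (X ^ r * c.tensorDer a X) := by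
    intro r
    induction r with
    | zero =>
      have : c.tensorDer a (1 ⊗ₜ algebraMap ℝ R 1) = 0 := c.tensorDer_tmul_algebraMap a 1 1
      rw [map_one, ← Algebra.TensorProduct.one_def] at this
      simp [this]
    | succ r ih =>
      rw [pow_succ', tensorDer_mul, mul_add, ih]
      push_cast
      ring
  have hstep : ∀ p : A ⊗[ℝ] R, ∀ r : ℕ, X ^ r * p = 0 → X ^ (r + 1) * c.tensorDer a p = 0 := by
    intro p r h
    have h1 := congrArg (fun q => X * c.tensorDer a q) h
    simp only [tensorDer_mul, map_zero, mul_zero, mul_add] at h1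
    have h2 : X * (c.tensorDer a (X ^ r) * p) = r * (c.tensorDer a X * (X ^ r * p)) := by
      rw [← mul_assoc, hpow]; ring
    rw [h2, h, mul_zero, mul_zero, add_zero] at h1
    rw [pow_succ', mul_assoc, h1]
  have hk : ∀ k, ∃ r : ℕ, X ^ r * (c.tensorDer a ^ (k + 2)) (1 ⊗ₜ[ℝ] c.f j) = 0 := by
    intro k
    induction k with
    | zero =>
      refine ⟨2, ?_⟩
      -- The second application kills the constants `δᵢⱼ`, so they may be subtracted to reach
      -- expressions annihilated by `χ`.
      have e : c.tensorDer a (∑ i, (a i * 1) ⊗ₜ[ℝ] c.D i (c.f j)) =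
          c.tensorDer a (∑ i, a i ⊗ₜ[ℝ] (c.D i (c.f j) - if i = j then 1 else 0)) := by
        rw [map_sum, map_sum]
        refine Finset.sum_congr rfl fun i _ => ?_
        have : (if i = j then 1 else 0 : R) = algebraMap ℝ R (if i = j then 1 else 0) := by
          split_ifs <;> simp
        rw [mul_one, tmul_sub, map_sub, this, tensorDer_tmul_algebraMap, sub_zero]
      rw [zero_add, pow_two (c.tensorDer a), Module.End.mul_apply, tensorDer_tmul, e]
      refine hstep _ 1 ?_
      rw [pow_one, Finset.mul_sum]
      refine Finset.sum_eq_zero fun i _ => ?_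
      rw [hX, Algebra.TensorProduct.tmul_mul_tmul, c.mul_sub_eq_zero, tmul_zero]
    | succ k ih =>
      obtain ⟨r, hr⟩ := ih
      refine ⟨r + 1, ?_⟩
      rw [show k + 1 + 2 = (k + 2) + 1 from rfl, pow_succ' (c.tensorDer a), Module.End.mul_apply]
      exact hstep _ _ hr
  obtain ⟨r, hr⟩ := hk k
  have h := congrArg (tensorEval A ε) hr
  rw [map_mul, map_pow, map_zero, hX, tensorEval_tmul, smul_pow, one_pow, smul_mul_assoc,
    one_mul] at h
  exact (smul_eq_zero.1 h).resolve_left (pow_ne_zero _ hε)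

/-- The Taylor expansion at `ε` with increment `a`: the nilpotent derivation `∑ aᵢ ⊗ Dᵢ` has an
exponential, which is an algebra morphism, and evaluation at `ε` follows it. On the coordinates only
the terms of order zero and one survive. -/
theorem LocalCoordinates.exists_taylor (c : LocalCoordinates n R) {N : ℕ}
    (hN : IsLocalRing.maximalIdeal A ^ N = ⊥) {ε : R →ₐ[ℝ] ℝ} (hε : ε c.χ ≠ 0) {a : Fin n → A}
    (ha : ∀ j, a j ∈ IsLocalRing.maximalIdeal A) :
    ∃ x : R →ₐ[ℝ] A, (∀ j, x (c.f j) = algebraMap ℝ A (ε (c.f j)) + a j) ∧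
      (∀ g, aug A (x g) = ε g) ∧
      ∀ g, x g = ∑ i ∈ Finset.range (N + 2),
        (i.factorial : ℝ)⁻¹ • tensorEval A ε ((c.tensorDer a ^ i) (1 ⊗ₜ g)) := by
  let _ : Module ℚ (A ⊗[ℝ] R) := Module.compHom _ (algebraMap ℚ ℝ)
  -- The exponent `N + 2` lets the terms of order zero and one be split off whatever `N` is.
  have hN' : c.tensorDer a ^ (N + 2) = 0 := by
    rw [pow_add, c.tensorDer_pow_eq_zero a ha hN, zero_mul]
  have hsum : ∀ p, IsNilpotent.exp (c.tensorDer a) p =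
      ∑ i ∈ Finset.range (N + 2), (i.factorial : ℝ)⁻¹ • (c.tensorDer a ^ i) p := by
    intro p
    rw [IsNilpotent.exp_eq_sum hN', LinearMap.sum_apply]
    refine Finset.sum_congr rfl fun i _ => ?_
    change (algebraMap ℚ ℝ (i.factorial : ℚ)⁻¹) • (c.tensorDer a ^ i) p = _
    simp
  have hmul := Module.End.exp_mul_of_derivation ℝ (A ⊗[ℝ] R) (c.tensorDer a) (c.tensorDer_mul a)
    ⟨_, hN'⟩
  have hone : IsNilpotent.exp (c.tensorDer a) 1 = 1 := by
    rw [hsum, Finset.sum_range_succ', Finset.sum_eq_zero]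
    · simp
    · intro i _
      have : c.tensorDer a (1 ⊗ₜ algebraMap ℝ R 1) = 0 := c.tensorDer_tmul_algebraMap a 1 1
      rw [map_one, ← Algebra.TensorProduct.one_def] at this
      rw [pow_succ, Module.End.mul_apply, this, map_zero, smul_zero]
  let x : R →ₐ[ℝ] A := (tensorEval A ε).comp ((AlgHom.ofLinearMap _ hone hmul).comp
    Algebra.TensorProduct.includeRight)
  have hx : ∀ g, x g = ∑ i ∈ Finset.range (N + 2),
      (i.factorial : ℝ)⁻¹ • tensorEval A ε ((c.tensorDer a ^ i) (1 ⊗ₜ g)) := fun g => by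
    change tensorEval A ε (IsNilpotent.exp (c.tensorDer a) (1 ⊗ₜ g)) = _
    rw [hsum, map_sum]
    simp only [map_smul]
  have h1 : ∀ g, tensorEval A ε (c.tensorDer a (1 ⊗ₜ g)) = ∑ i, ε (c.D i g) • a i := fun g => by
    rw [tensorDer_tmul, map_sum]
    simp only [tensorEval_tmul, mul_one]
  refine ⟨x, fun j => ?_, fun g => ?_, hx⟩
  · rw [hx, Finset.sum_range_succ', Finset.sum_range_succ', Finset.sum_eq_zero]
    · simp only [zero_add, pow_one, pow_zero, Nat.factorial, Nat.cast_one, inv_one, one_smul,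
        mul_one, Module.End.one_apply, tensorEval_tmul, h1]
      have : ∀ i, ε (c.D i (c.f j)) = if i = j then 1 else 0 := fun i => by
        have h := congrArg ε (c.mul_sub_eq_zero i j)
        rw [map_mul, map_zero, map_sub] at h
        have h' := sub_eq_zero.1 ((mul_eq_zero.1 h).resolve_left hε)
        rw [h']
        split_ifs <;> simp
      simp only [this, ite_smul, one_smul, zero_smul, Finset.sum_ite_eq', Finset.mem_univ, if_true]
      rw [Algebra.algebraMap_eq_smul_one, add_comm]
    · intro i _
      rw [c.tensorEval_tensorDer_pow a hε, smul_zero]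
  · have hp : ∀ p, aug A (tensorEval A ε (c.tensorDer a p)) = 0 := fun p => by
      induction p with
      | zero => simp
      | add p q hp hq => rw [map_add, map_add, map_add, hp, hq, add_zero]
      | tmul b g =>
        rw [tensorDer_tmul, map_sum, map_sum]
        refine Finset.sum_eq_zero fun i _ => ?_
        rw [tensorEval_tmul, map_smul, map_mul, aug_eq_zero_iff.2 (ha i), zero_mul, smul_zero]
    rw [hx, Finset.sum_range_succ', map_add, map_sum, Finset.sum_eq_zero]
    · simp [tensorEval_tmul]
    · intro i _
      rw [map_smul, pow_succ', Module.End.mul_apply, hp, smul_zero]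

/-- The family `b` is free in the claim because the induction removes the innermost derivation,
which multiplies it by `a t i`. -/
theorem LocalCoordinates.smoothFamilyOn_tensorEval {T : Type*} [NormedAddCommGroup T]
    [NormedSpace ℝ T] {u : Set T} {ε : T → R →ₐ[ℝ] ℝ} {a : T → Fin n → A}
    (hε : ∀ g, ContDiffOn ℝ ∞ (fun t => ε t g) u) (ha : ∀ j, SmoothFamilyOn u fun t => a t j)
    (k : ℕ) : ∀ (b : T → A) (_ : SmoothFamilyOn u b) (g : R),
      SmoothFamilyOn u fun t => tensorEval A (ε t) ((c.tensorDer (a t) ^ k) (b t ⊗ₜ g)) := by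
  induction k with
  | zero =>
    intro b hb g
    simp only [pow_zero, Module.End.one_apply, tensorEval_tmul]
    exact SmoothFamilyOn.smul (hε g) hb
  | succ k ih =>
    intro b hb g
    simp only [pow_succ, Module.End.mul_apply, tensorDer_tmul, map_sum]
    exact SmoothFamilyOn.sum fun i _ => ih _ ((ha i).mul hb) _

/-- The `A`-points given by their coordinates, which depend smoothly on them. -/
theorem LocalCoordinates.exists_point (c : LocalCoordinates n R) (A : Type*) [CommRing A]
    [Algebra ℝ A] [IsWeilAlgebra A] :
    ∃ x : (R →ₐ[ℝ] ℝ) → (Fin n → A) → (R →ₐ[ℝ] A),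
      (∀ ε a, ε c.χ ≠ 0 → (∀ j, a j ∈ IsLocalRing.maximalIdeal A) →
        (∀ j, x ε a (c.f j) = algebraMap ℝ A (ε (c.f j)) + a j) ∧ ∀ g, aug A (x ε a g) = ε g) ∧
      ∀ (T : Type) [NormedAddCommGroup T] [NormedSpace ℝ T] (u : Set T) (ε : T → R →ₐ[ℝ] ℝ)
        (a : T → Fin n → A), (∀ t ∈ u, ε t c.χ ≠ 0) →
        (∀ t ∈ u, ∀ j, a t j ∈ IsLocalRing.maximalIdeal A) →
        (∀ g, ContDiffOn ℝ ∞ (fun t => ε t g) u) → (∀ j, SmoothFamilyOn u fun t => a t j) →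
        ∀ g, SmoothFamilyOn u fun t => x (ε t) (a t) g := by
  classical
  obtain ⟨N, hN⟩ := exists_maximalIdeal_pow_eq_bot A
  let P := fun (ε : R →ₐ[ℝ] ℝ) (a : Fin n → A) =>
    ε c.χ ≠ 0 ∧ ∀ j, a j ∈ IsLocalRing.maximalIdeal A
  choose x hx using fun (ε : R →ₐ[ℝ] ℝ) (a : Fin n → A) (h : P ε a) =>
    c.exists_taylor hN h.1 h.2
  let x' : (R →ₐ[ℝ] ℝ) → (Fin n → A) → (R →ₐ[ℝ] A) := fun ε a =>
    if h : P ε a then x ε a h else (Algebra.ofId ℝ A).comp ε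
  have hx' : ∀ ε a (h : P ε a), x' ε a = x ε a h := fun ε a h => dif_pos h
  refine ⟨x', fun ε a h1 h2 => ?_, fun T _ _ u ε a h1 h2 hε ha g => ?_⟩
  · rw [hx' ε a ⟨h1, h2⟩]
    exact ⟨(hx ε a ⟨h1, h2⟩).1, (hx ε a ⟨h1, h2⟩).2.1⟩
  · refine SmoothFamilyOn.congr (g := fun t => ∑ i ∈ Finset.range (N + 2),
        (i.factorial : ℝ)⁻¹ • tensorEval A (ε t) ((c.tensorDer (a t) ^ i) (1 ⊗ₜ g)))
      (SmoothFamilyOn.sum fun i _ => SmoothFamilyOn.smul contDiffOn_const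
        (c.smoothFamilyOn_tensorEval hε ha i _ (SmoothFamilyOn.const 1) g)) fun t ht => ?_
    rw [hx' _ _ ⟨h1 t ht, h2 t ht⟩]
    exact (hx _ _ ⟨h1 t ht, h2 t ht⟩).2.2 g

end Coordinates

/-! ### Local coordinates on the algebra of smooth functions of a manifold -/

section Hadamard

open MeasureTheory

/-- Differentiation under the integral sign. The target `F` varies in the induction because the
derivative has values in `E →L[ℝ] F`. -/
theorem contDiff_nat_intervalIntegral {E : Type} [NormedAddCommGroup E] [NormedSpace ℝ E]
    [FiniteDimensional ℝ E] (m : ℕ) : ∀ (F : Type) [NormedAddCommGroup F] [NormedSpace ℝ F]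
      (f : E × ℝ → F), ContDiff ℝ m f → ContDiff ℝ m fun x => ∫ t in (0 : ℝ)..1, f (x, t) := by
  induction m with
  | zero =>
    intro F _ _ f hf
    have hc : Continuous f := contDiff_zero.1 hf
    exact contDiff_zero.2 (intervalIntegral.continuous_parametric_intervalIntegral_of_continuous'
      (f := fun x t => f (x, t)) hc 0 1)
  | succ m ih =>
    intro F _ _ f hf
    push_cast at hf ⊢
    have hc : Continuous f := hf.continuous
    obtain ⟨hd, -, hf'⟩ := contDiff_succ_iff_fderiv.1 hf
    let g : E × ℝ → E →L[ℝ] F := fun z => (fderiv ℝ f z).comp (ContinuousLinearMap.inl ℝ E ℝ)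
    have hg : ContDiff ℝ m g := hf'.clm_comp contDiff_const
    have hgc : Continuous g := hg.continuous
    have hder : ∀ x, HasFDerivAt (fun x => ∫ t in (0 : ℝ)..1, f (x, t))
        (∫ t in (0 : ℝ)..1, g (x, t)) x := by
      intro x
      obtain ⟨C, hC⟩ := ((isCompact_closedBall x 1).prod (isCompact_Icc (a := (0 : ℝ))
        (b := 1))).exists_bound_of_continuousOn hgc.continuousOn
      refine intervalIntegral.hasFDerivAt_integral_of_dominated_of_fderiv_le
        (F := fun x t => f (x, t)) (F' := fun x t => g (x, t)) (bound := fun _ => C)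
        (Metric.closedBall_mem_nhds x one_pos) ?_ ?_ ?_ ?_ ?_ ?_
      · exact Filter.Eventually.of_forall fun y =>
          (show Continuous fun t => f (y, t) by fun_prop).aestronglyMeasurable
      · exact (show Continuous fun t => f (x, t) by fun_prop).intervalIntegrable _ _
      · exact (show Continuous fun t => g (x, t) by fun_prop).aestronglyMeasurable
      · refine Filter.Eventually.of_forall fun t ht y hy => hC (y, t) ⟨hy, ?_⟩
        rw [Set.uIoc_of_le zero_le_one] at ht
        exact ⟨ht.1.le, ht.2⟩
      · exact intervalIntegrable_const
      · refine Filter.Eventually.of_forall fun t _ y _ => ?_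
        exact (hd (y, t)).hasFDerivAt.comp y (hasFDerivAt_prodMk_left y t)
    refine contDiff_succ_iff_fderiv.2 ⟨fun x => (hder x).differentiableAt, by simp, ?_⟩
    rw [show fderiv ℝ (fun x => ∫ t in (0 : ℝ)..1, f (x, t)) =
      fun x => ∫ t in (0 : ℝ)..1, g (x, t) from funext fun x => (hder x).fderiv]
    exact ih _ g hg

/-- Hadamard's lemma. -/
theorem exists_hadamard {E : Type} [NormedAddCommGroup E] [NormedSpace ℝ E]
    [FiniteDimensional ℝ E] {G : E → ℝ} (hG : ContDiff ℝ ∞ G) (v : E) :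
    ∃ L : E → E →L[ℝ] ℝ, ContDiff ℝ ∞ L ∧ ∀ x, G x = G v + L x (x - v) := by
  let g : E × ℝ → E →L[ℝ] ℝ := fun z => fderiv ℝ G (v + z.2 • (z.1 - v))
  have hg : ContDiff ℝ ∞ g :=
    (hG.fderiv_right (m := ∞) le_rfl).comp (by fun_prop)
  refine ⟨fun x => ∫ t in (0 : ℝ)..1, g (x, t), contDiff_infty.2 fun m =>
    contDiff_nat_intervalIntegral m _ g (contDiff_infty.1 hg m), fun x => ?_⟩
  have hgc : Continuous g := hg.continuous
  have hi : IntervalIntegrable (fun t => g (x, t)) volume 0 1 :=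
    (show Continuous fun t => g (x, t) by fun_prop).intervalIntegrable _ _
  have h1 : ∀ t : ℝ, HasDerivAt (fun t : ℝ => G (v + t • (x - v))) (g (x, t) (x - v)) t := by
    intro t
    have hl : HasDerivAt (fun t : ℝ => v + t • (x - v)) (x - v) t := by
      simpa using ((hasDerivAt_id t).smul_const (x - v)).const_add v
    exact ((hG.differentiable (by simp)) _).hasFDerivAt.comp_hasDerivAt t hl
  have h2 := intervalIntegral.integral_eq_sub_of_hasDerivAt (a := 0) (b := 1) (fun t _ => h1 t)
    ((show Continuous fun t => g (x, t) (x - v) by fun_prop).intervalIntegrable _ _)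
  rw [ContinuousLinearMap.intervalIntegral_apply hi, h2]
  simp

end Hadamard

/-! ### Characters of the algebra of smooth functions and coordinates from charts -/

section Manifold

variable {n : ℕ} {M : Type u} [TopologicalSpace M] [ChartedSpace (EuclideanSpace ℝ (Fin n)) M]
  [IsManifold (𝓡 n) ∞ M] [T2Space M]

/-- A smooth function on a chart, multiplied by a bump function. -/
def SmoothBumpFunction.mulFn {p : M} (b : SmoothBumpFunction (𝓡 n) p) (h : M → ℝ)
    (hh : ContMDiffOn (𝓡 n) 𝓘(ℝ, ℝ) ∞ h (chartAt (EuclideanSpace ℝ (Fin n)) p).source) :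
    SmoothFn n M :=
  ⟨fun q => b q • h q, b.contMDiff_smul hh⟩

theorem contMDiffOn_comp_extChartAt {p : M} {h : EuclideanSpace ℝ (Fin n) → ℝ}
    (hh : ContDiffOn ℝ ∞ h (extChartAt (𝓡 n) p).target) :
    ContMDiffOn (𝓡 n) 𝓘(ℝ, ℝ) ∞ (fun q => h (extChartAt (𝓡 n) p q))
      (chartAt (EuclideanSpace ℝ (Fin n)) p).source := by
  refine hh.contMDiffOn.comp (contMDiffOn_extChartAt) fun q hq => ?_
  exact (extChartAt (𝓡 n) p).map_source (by rwa [extChartAt_source])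

theorem contDiffOn_comp_extChartAt_symm (p : M) (g : SmoothFn n M) :
    ContDiffOn ℝ ∞ (fun x => g ((extChartAt (𝓡 n) p).symm x)) (extChartAt (𝓡 n) p).target :=
  (g.contMDiff.comp_contMDiffOn (contMDiffOn_extChartAt_symm p)).contDiffOn

variable (M) in
-- If `ε` is no evaluation, each point `q` has a function of `ker ε` that is nonzero at `q`. Take a
-- function `h` dominating a compact exhaustion. Finitely many such functions suffice on a compact
-- set outside of which `h > ε h`; their squares and that of `h - ε h` add up to a nowhere
-- vanishing, hence invertible, element of `ker ε`.
theorem smoothFn_algHom_eq_eval [SecondCountableTopology M] (ε : SmoothFn n M →ₐ[ℝ] ℝ) :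
    ∃ q, ∀ g, ε g = g q := by
  have : LocallyCompactSpace M := ChartedSpace.locallyCompactSpace (EuclideanSpace ℝ (Fin n)) M
  let K := CompactExhaustion.choice M
  obtain ⟨h, hh⟩ := exists_contMDiffMap_forall_mem_convex_of_local_const (n := (⊤ : ℕ∞)) (𝓡 n)
    (t := fun x : M => Set.Ici (K.find x : ℝ)) (fun x => convex_Ici _) (fun x => by
      refine ⟨(K.find x + 1 : ℕ), ?_⟩
      filter_upwards [mem_interior_iff_mem_nhds.1 (K.subset_interior_succ _ (K.mem_find x))]
        with y hy
      exact Set.mem_Ici.2 (Nat.cast_le.2 (K.mem_iff_find_le.1 hy)))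
  by_contra! hc
  choose f hf using hc
  let F : M → SmoothFn n M := fun q => f q - algebraMap ℝ _ (ε (f q))
  have hF : ∀ q, ε (F q) = 0 := fun q => by simp [F]
  have hFq : ∀ q, F q q ≠ 0 := fun q h0 => hf q (by
    have : f q q - ε (f q) = 0 := h0
    linarith)
  obtain ⟨N, hN⟩ := exists_nat_gt (ε h)
  obtain ⟨s, -, hs⟩ := (K.isCompact N).elim_nhds_subcover (fun q => {q' | F q q' ≠ 0})
    fun q _ => (F q).contMDiff.continuous.continuousAt.eventually_ne (hFq q)
  let H : SmoothFn n M := (h - algebraMap ℝ _ (ε h)) ^ 2 + ∑ q ∈ s, F q ^ 2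
  have hH : ε H = 0 := by simp [H, hF]
  have hHq : ∀ q', H q' = (h q' - ε h) ^ 2 + ∑ q ∈ s, F q q' ^ 2 := fun q' => by
    have e : ∀ g : SmoothFn n M, g q' = ContMDiffMap.evalRingHom (I := 𝓡 n) (n := ∞) q' g :=
      fun g => rfl
    rw [e H, e h]
    simp only [H, map_add, map_pow, map_sum, map_sub]
    rfl
  have hpos : ∀ q', H q' ≠ 0 := by
    intro q'
    rw [hHq]
    have h2 : 0 ≤ ∑ q ∈ s, F q q' ^ 2 := Finset.sum_nonneg fun q _ => sq_nonneg _
    by_cases hq : q' ∈ K N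
    · obtain ⟨q, hqs, hq0⟩ := Set.mem_iUnion₂.1 (hs hq)
      have h3 : 0 < F q q' ^ 2 := by
        have : F q q' ≠ 0 := hq0
        positivity
      have := Finset.single_le_sum (f := fun q => F q q' ^ 2) (fun q _ => sq_nonneg _) hqs
      have := sq_nonneg (h q' - ε h)
      linarith
    · have h4 : N < K.find q' := not_le.1 fun hle => hq (K.mem_iff_find_le.2 hle)
      have h5 : (K.find q' : ℝ) ≤ h q' := hh q'
      have h6 : (N : ℝ) < K.find q' := Nat.cast_lt.2 h4
      have : 0 < (h q' - ε h) ^ 2 := by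
        have : 0 < h q' - ε h := by linarith
        positivity
      linarith
  let Hi : SmoothFn n M := ⟨fun q => (H q)⁻¹, H.contMDiff.inv₀ hpos⟩
  have hmul : H * Hi = 1 := by
    ext q
    exact mul_inv_cancel₀ (hpos q)
  have := congrArg ε hmul
  rw [map_mul, hH, zero_mul, map_one] at this
  exact zero_ne_one this

/-- The partial derivatives in a chart, multiplied by a bump function. -/
def SmoothBumpFunction.partialDeriv {p : M} (b : SmoothBumpFunction (𝓡 n) p) (i : Fin n) :
    Derivation ℝ (SmoothFn n M) (SmoothFn n M) :=
  have hd : ∀ (g : SmoothFn n M) {q : M}, q ∈ (chartAt (EuclideanSpace ℝ (Fin n)) p).source →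
      DifferentiableAt ℝ (fun x => g ((extChartAt (𝓡 n) p).symm x)) (extChartAt (𝓡 n) p q) :=
    fun g q hq => ((contDiffOn_comp_extChartAt_symm p g).differentiableOn (by simp)).differentiableAt
      ((isOpen_extChartAt_target p).mem_nhds
        ((extChartAt (𝓡 n) p).map_source (by rwa [extChartAt_source])))
  have hb : ∀ {q}, q ∉ (chartAt (EuclideanSpace ℝ (Fin n)) p).source → b q = 0 := fun {q} hq => by
    by_contra h
    exact hq (b.support_subset_source h)
  Derivation.mk'
    { toFun := fun g => b.mulFn (fun q => fderiv ℝ (fun x => g ((extChartAt (𝓡 n) p).symm x))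
        (extChartAt (𝓡 n) p q) (EuclideanSpace.single i 1)) (contMDiffOn_comp_extChartAt
          (((contDiffOn_comp_extChartAt_symm p g).fderiv_of_isOpen
            (isOpen_extChartAt_target p) le_rfl).clm_apply contDiffOn_const))
      map_add' := fun g g' => by
        ext q
        by_cases hq : q ∈ (chartAt (EuclideanSpace ℝ (Fin n)) p).source
        · have := fderiv_fun_add (hd g hq) (hd g' hq)
          change b q * _ = b q * _ + b q * _
          simp only [ContMDiffMap.coe_add, Pi.add_apply]
          rw [this, add_apply, mul_add]
        · change b q * _ = b q * _ + b q * _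
          simp only [hb hq, zero_mul, add_zero]
      map_smul' := fun r g => by
        ext q
        by_cases hq : q ∈ (chartAt (EuclideanSpace ℝ (Fin n)) p).source
        · have := fderiv_fun_const_smul (hd g hq) r
          change b q * _ = r • (b q * _)
          simp only [ContMDiffMap.coe_smul, Pi.smul_apply]
          rw [this, smul_apply, smul_eq_mul, smul_eq_mul]
          ring
        · change b q * _ = r • (b q * _)
          simp only [hb hq, zero_mul, smul_zero] }
    fun g g' => by
      ext q
      change b q * _ = g q * (b q * _) + g' q * (b q * _)
      by_cases hq : q ∈ (chartAt (EuclideanSpace ℝ (Fin n)) p).source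
      · have h := fderiv_fun_mul (hd g hq) (hd g' hq)
        simp only [ContMDiffMap.coe_mul, Pi.mul_apply]
        rw [h, add_apply, smul_apply, smul_apply, smul_eq_mul, smul_eq_mul,
          (extChartAt (𝓡 n) p).left_inv (by rwa [extChartAt_source])]
        ring
      · simp only [hb hq, zero_mul, mul_zero, add_zero]

theorem SmoothBumpFunction.partialDeriv_apply {p : M} (b : SmoothBumpFunction (𝓡 n) p) (i : Fin n)
    (g : SmoothFn n M) (q : M) : b.partialDeriv i g q =
      b q * fderiv ℝ (fun x => g ((extChartAt (𝓡 n) p).symm x)) (extChartAt (𝓡 n) p q)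
        (EuclideanSpace.single i 1) := rfl

/-- Chart coordinates and partial derivatives are made global by a bump function `b`. A second bump
`χ`, supported where `b = 1`, marks the region in which they are unaltered. Hadamard's lemma gives
the generation of the cotangent spaces. -/
theorem exists_localCoordinates [SecondCountableTopology M] (ε₀ : SmoothFn n M →ₐ[ℝ] ℝ) :
    ∃ c : LocalCoordinates n (SmoothFn n M), ε₀ c.χ ≠ 0 := by
  obtain ⟨p, hp⟩ := smoothFn_algHom_eq_eval M ε₀
  set e := extChartAt (𝓡 n) p with he
  obtain ⟨b⟩ : Nonempty (SmoothBumpFunction (𝓡 n) p) := inferInstance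
  have hbt : Metric.closedBall (e p) b.rOut ⊆ e.target := fun x hx =>
    b.closedBall_subset ⟨hx, by simp⟩
  have hbt' : Metric.ball (e p) b.rIn ⊆ e.target := fun x hx =>
    hbt (Metric.closedBall_subset_closedBall b.rIn_lt_rOut.le (Metric.ball_subset_closedBall hx))
  have hsrc : e.source = (chartAt (EuclideanSpace ℝ (Fin n)) p).source := extChartAt_source _ _
  -- The outer radius of `χ` is the inner radius of `b`, so `b = 1` on the support of `χ`.
  let χ : SmoothBumpFunction (𝓡 n) p :=
    { rIn := b.rIn / 2
      rOut := b.rIn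
      rIn_pos := half_pos b.rIn_pos
      rIn_lt_rOut := half_lt_self b.rIn_pos
      closedBall_subset := (Set.inter_subset_inter_left _
        (Metric.closedBall_subset_closedBall b.rIn_lt_rOut.le)).trans b.closedBall_subset }
  have hχ : ∀ q, χ q ≠ 0 → q ∈ e.source ∧ e q ∈ Metric.ball (e p) b.rIn := by
    intro q hq
    have : q ∈ Function.support χ := hq
    rw [χ.support_eq_inter_preimage, ← hsrc] at this
    exact this
  have hb1 : ∀ q, q ∈ e.source → e q ∈ Metric.ball (e p) b.rIn → b q = 1 := fun q h1 h2 =>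
    b.one_of_dist_le (hsrc ▸ h1) (Metric.mem_ball.1 h2).le
  let f : Fin n → SmoothFn n M := fun j => b.mulFn (fun q => e q j)
    (contMDiffOn_comp_extChartAt (h := fun x => x j) (by fun_prop))
  have hf : ∀ j q, f j q = b q * e q j := fun j q => rfl
  let χ' : SmoothFn n M := ⟨χ, χ.contMDiff⟩
  have hχ' : ∀ q, χ' q = χ q := fun _ => rfl
  refine ⟨⟨χ', f, b.partialDeriv, fun i j => ?_, fun ε hε g hg => ?_⟩, ?_⟩
  · ext q
    change χ q * (b.partialDeriv i (f j) q - (if i = j then (1 : SmoothFn n M) else 0) q) = 0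
    by_cases hq : χ q = 0
    · rw [hq, zero_mul]
    obtain ⟨h1, h2⟩ := hχ q hq
    have h3 : (fun x => f j (e.symm x)) =ᶠ[𝓝 (e q)] fun x => EuclideanSpace.proj (𝕜 := ℝ) j x := by
      filter_upwards [Metric.isOpen_ball.mem_nhds h2] with x hx
      have hx' := hbt' hx
      rw [hf, e.right_inv hx', hb1 _ (e.map_target hx') (by rwa [e.right_inv hx']), one_mul]
      rfl
    rw [SmoothBumpFunction.partialDeriv_apply, h3.fderiv_eq, ContinuousLinearMap.fderiv,
      hb1 q h1 h2, one_mul]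
    by_cases hij : i = j
    · subst hij
      simp
    · have : (0 : SmoothFn n M) q = 0 := rfl
      simp [hij, Ne.symm hij, this]
  · obtain ⟨q, hεq⟩ := smoothFn_algHom_eq_eval M ε
    obtain ⟨h1, h2⟩ := hχ q (by rwa [hεq] at hε)
    have hgq : g q = 0 := (hεq g).symm.trans hg
    obtain ⟨k, hk, -, hkd, -, hk1⟩ := exists_contDiff_tsupport_subset (n := (⊤ : ℕ∞))
      (Metric.isOpen_ball.mem_nhds h2)
    have hkb : ∀ x, k x ≠ 0 → x ∈ Metric.ball (e p) b.rIn := fun x hx => hk (subset_tsupport _ hx)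
    have hG : ContDiff ℝ ∞ fun x => k x * g (e.symm x) := by
      rw [contDiff_iff_contDiffAt]
      intro x
      by_cases hx : x ∈ tsupport k
      · exact hkd.contDiffAt.mul ((contDiffOn_comp_extChartAt_symm p g).contDiffAt
          ((isOpen_extChartAt_target p).mem_nhds (hbt' (hk hx))))
      · have : (fun x => k x * g (e.symm x)) =ᶠ[𝓝 x] fun _ => 0 := by
          filter_upwards [(isClosed_tsupport k).isOpen_compl.mem_nhds hx] with y hy
          rw [image_eq_zero_of_notMem_tsupport hy, zero_mul]
        exact contDiffAt_const.congr_of_eventuallyEq this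
    obtain ⟨L, hL, hLG⟩ := exists_hadamard hG (e q)
    have hL' : ∀ q' ∈ e.source, k (e q') * g q' =
        ∑ j, L (e q') (EuclideanSpace.single j 1) * (e q' j - e q j) := by
      intro q' hq'
      have h := hLG (e q')
      rw [e.left_inv hq', e.left_inv h1, hgq, mul_zero, zero_add] at h
      rw [h]
      conv_lhs => rw [← (EuclideanSpace.basisFun (Fin n) ℝ).sum_repr (e q' - e q)]
      rw [map_sum]
      refine Finset.sum_congr rfl fun j _ => ?_
      rw [map_smul, smul_eq_mul, mul_comm]
      simp
    let θ : SmoothFn n M := b.mulFn (fun q => k (e q))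
      (contMDiffOn_comp_extChartAt (h := k) hkd.contDiffOn)
    have hθ : ∀ q', θ q' = b q' * k (e q') := fun _ => rfl
    let H : Fin n → SmoothFn n M := fun j => b.mulFn
      (fun q => L (e q) (EuclideanSpace.single j 1))
      (contMDiffOn_comp_extChartAt (h := fun x => L x (EuclideanSpace.single j 1))
        (hL.clm_apply contDiff_const).contDiffOn)
    have hH : ∀ j q', H j q' = b q' * L (e q') (EuclideanSpace.single j 1) := fun _ _ => rfl
    -- The cutoff `θ` is `1` at `q`. One factor `θ` extends `g` to a function on the model space, to
    -- which Hadamard's lemma applies; the other confines the identity to the region where `b = 1`.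
    -- The remainder `g * (1 - θ ^ 2)` lies in the square of `ker ε`.
    have key : g * θ ^ 2 = ∑ j, (θ * H j) * (f j - algebraMap ℝ _ (ε (f j))) := by
      ext q'
      have ev : ∀ g : SmoothFn n M, g q' = ContMDiffMap.evalRingHom (I := 𝓡 n) (n := ∞) q' g :=
        fun g => rfl
      have ec : ∀ r : ℝ, (algebraMap ℝ (SmoothFn n M) r) q' = r := fun r => rfl
      have hsum : (∑ j, (θ * H j) * (f j - algebraMap ℝ _ (ε (f j)))) q' =
          ∑ j, (θ q' * H j q') * (f j q' - ε (f j)) := by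
        rw [ev, map_sum]
        rfl
      rw [hsum]
      change g q' * (θ q') ^ 2 = _
      by_cases h0 : θ q' = 0
      · simp [h0]
      have hs : q' ∈ e.source := by
        rw [hsrc]
        refine b.support_subset_source fun hb0 => h0 ?_
        rw [hθ, hb0, zero_mul]
      have hk0 : k (e q') ≠ 0 := fun hk0 => h0 (by rw [hθ, hk0, mul_zero])
      have hbq := hb1 q' hs (hkb _ hk0)
      have hθk : θ q' = k (e q') := by rw [hθ, hbq, one_mul]
      calc g q' * (θ q') ^ 2 = θ q' * (k (e q') * g q') := by rw [hθk]; ring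
        _ = _ := by
          rw [hL' q' hs, Finset.mul_sum]
          refine Finset.sum_congr rfl fun j _ => ?_
          rw [hH, hf, hεq, hf, hbq, hb1 q h1 h2]
          ring
    have hθq : ε θ = 1 := by rw [hεq, hθ, hb1 q h1 h2, one_mul, hk1]
    rw [show g = g * θ ^ 2 + g * (1 - θ ^ 2) by ring]
    refine Submodule.add_mem_sup ?_ ?_
    · rw [key]
      exact Ideal.sum_mem _ fun j _ => Ideal.mul_mem_left _ _ (Ideal.subset_span ⟨j, rfl⟩)
    · rw [pow_two]
      exact Ideal.mul_mem_mul hg (by rw [RingHom.mem_ker, map_sub, map_pow, hθq]; simp)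
  · rw [hp, hχ', χ.eq_one]
    exact one_ne_zero

end Manifold

/-! ### Local lifts of plots -/

section Plots

variable {X : Type*} {Y : Type*} {Z : Type*}

/-- A small ball, reparametrised by the whole space. -/
theorem exists_ball_reparam {k : ℕ} {u : Set (EuclideanSpace ℝ (Fin k))} (hu : IsOpen u)
    {t₀ : EuclideanSpace ℝ (Fin k)} (ht₀ : t₀ ∈ u) :
    ∃ c : EuclideanSpace ℝ (Fin k) → EuclideanSpace ℝ (Fin k), ContDiff ℝ ∞ c ∧ c 0 = t₀ ∧
      (∀ s, c s ∈ u) ∧ ∀ s : Set (EuclideanSpace ℝ (Fin k)), IsOpen s → 0 ∈ s →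
        ∃ v ⊆ u, IsOpen v ∧ t₀ ∈ v ∧ ∀ {m : ℕ} (f : EuclideanSpace ℝ (Fin m) → _),
          ContDiff ℝ ∞ f → (∀ x, f x ∈ v) →
          ∃ g, ContDiff ℝ ∞ g ∧ (∀ x, g x ∈ s) ∧ c ∘ g = f := by
  obtain ⟨ε, hε, hεu⟩ := Metric.isOpen_iff.1 hu t₀ ht₀
  let h := OpenPartialHomeomorph.univBall t₀ ε
  have htgt : h.target = Metric.ball t₀ ε := OpenPartialHomeomorph.univBall_target t₀ hε
  have hsrc : h.source = Set.univ := OpenPartialHomeomorph.univBall_source t₀ ε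
  have h0 : h 0 = t₀ := OpenPartialHomeomorph.univBall_apply_zero t₀ ε
  refine ⟨h, OpenPartialHomeomorph.contDiff_univBall, h0, fun s => hεu (htgt ▸ h.map_source
    (hsrc ▸ Set.mem_univ s)), fun s hs hs0 => ⟨h '' s, ?_, ?_, ⟨0, hs0, h0⟩, fun f hf hfv => ?_⟩⟩
  · rintro _ ⟨x, -, rfl⟩
    exact hεu (htgt ▸ h.map_source (hsrc ▸ Set.mem_univ x))
  · exact h.isOpen_image_of_subset_source hs (hsrc ▸ Set.subset_univ s)
  · have hmem : ∀ x, f x ∈ Metric.ball t₀ ε := fun x => by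
      obtain ⟨z, -, hz⟩ := hfv x
      rw [← hz, ← htgt]
      exact h.map_source (hsrc ▸ Set.mem_univ z)
    refine ⟨fun x => h.symm (f x), ?_, fun x => ?_, ?_⟩
    · exact (OpenPartialHomeomorph.contDiffOn_univBall_symm (c := t₀) (r := ε)).comp_contDiff hf hmem
    · obtain ⟨z, hz, hzx⟩ := hfv x
      change h.symm (f x) ∈ s
      rw [← hzx, h.left_inv (hsrc ▸ Set.mem_univ z)]
      exact hz
    · funext x
      exact h.right_inv (htgt ▸ hmem x)

/-- The plots of the diffeology generated by a set of plots that contains the constant ones and is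
closed under reparametrisation are locally in this set. -/
theorem Diffeology.exists_local_mem_of_isPlot_generateFrom
    {g : Set ((n : ℕ) × (EuclideanSpace ℝ (Fin n) → X))}
    (hconst : ∀ n x, ⟨n, fun _ => x⟩ ∈ g)
    (hrep : ∀ {n m p} {f : EuclideanSpace ℝ (Fin m) → EuclideanSpace ℝ (Fin n)}, ⟨n, p⟩ ∈ g →
      ContDiff ℝ ∞ f → ⟨m, p ∘ f⟩ ∈ g)
    {k : ℕ} {p : EuclideanSpace ℝ (Fin k) → X}
    (hp : @IsPlot _ (DiffeologicalSpace.generateFrom g) k p) (t₀ : EuclideanSpace ℝ (Fin k)) :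
    ∃ u, IsOpen u ∧ t₀ ∈ u ∧ ∀ {m : ℕ} (f : EuclideanSpace ℝ (Fin m) → _), ContDiff ℝ ∞ f →
      (∀ x, f x ∈ u) → ⟨m, p ∘ f⟩ ∈ g := by
  -- The maps that are locally in `g` already form a diffeology, so all plots of the generated one
  -- are among them.
  let d : DiffeologicalSpace X :=
    { plots := fun n => {p | ∀ t₀, ∃ u, IsOpen u ∧ t₀ ∈ u ∧ ∀ {m : ℕ}
        (f : EuclideanSpace ℝ (Fin m) → EuclideanSpace ℝ (Fin n)), ContDiff ℝ ∞ f →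
          (∀ x, f x ∈ u) → ⟨m, p ∘ f⟩ ∈ g}
      constant_plots := fun x t₀ => ⟨Set.univ, isOpen_univ, Set.mem_univ _,
        fun {m} _ _ _ => hconst m x⟩
      plot_reparam := by
        intro n m p f hp hf t₀
        obtain ⟨u, hu, htu, h⟩ := hp (f t₀)
        exact ⟨f ⁻¹' u, hu.preimage hf.continuous, htu, fun f' hf' hfu => h (f ∘ f')
          (hf.comp hf') hfu⟩
      locality := by
        intro n p hp t₀
        obtain ⟨u, hu, htu, h⟩ := hp t₀
        obtain ⟨c, hc, hc0, hcu, hcv⟩ := exists_ball_reparam hu htu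
        obtain ⟨s, hs, hs0, h'⟩ := h hcu hc 0
        obtain ⟨v, -, hv, htv, hf⟩ := hcv s hs hs0
        refine ⟨v, hv, htv, fun f hfc hfv => ?_⟩
        obtain ⟨g', hg', hgs, rfl⟩ := hf f hfc hfv
        exact h' g' hg' hgs }
  exact hp d (fun q hq t₀ => ⟨Set.univ, isOpen_univ, Set.mem_univ _, fun f hf _ => hrep hq hf⟩) t₀

theorem Diffeology.isPlot_of_local [DiffeologicalSpace Z] {k : ℕ} {q : EuclideanSpace ℝ (Fin k) → Z}
    (h : ∀ t₀, ∃ u, IsOpen u ∧ t₀ ∈ u ∧ ∀ {m : ℕ} (f : EuclideanSpace ℝ (Fin m) → _),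
      ContDiff ℝ ∞ f → (∀ x, f x ∈ u) → IsPlot (q ∘ f)) : IsPlot q :=
  DiffeologicalSpace.locality fun t₀ => by
    obtain ⟨u, hu, htu, h⟩ := h t₀
    exact ⟨u, hu, htu, fun {m f} hfu hf => h f hf hfu⟩

variable [dY : DiffeologicalSpace Y] {π : Y → X}

theorem Diffeology.isPlot_coinduced {k : ℕ} {p : EuclideanSpace ℝ (Fin k) → Y} (hp : IsPlot p) :
    @IsPlot _ (coinduced π dY) k (π ∘ p) :=
  DiffeologicalSpace.isPlot_generatedFrom_of_mem ⟨p, hp, rfl⟩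

/-- Plots of a quotient space lift locally, with values in `N` if they have values in the image of
the open set `N`, if every point over a point in this image can be moved into `N`. -/
theorem Diffeology.exists_local_lift (hπ : Function.Surjective π) {N : Set Y}
    (hN : ∀ {k} (y : EuclideanSpace ℝ (Fin k) → Y), IsPlot y → IsOpen (y ⁻¹' N))
    (hτ : ∀ y, ∀ y' ∈ N, π y = π y' → ∃ τ : Y → Y, DSmooth τ ∧ (∀ z, π (τ z) = π z) ∧ τ y ∈ N)
    {k : ℕ} {p : EuclideanSpace ℝ (Fin k) → X} (hp : @IsPlot _ (coinduced π dY) k p)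
    {t₀ : EuclideanSpace ℝ (Fin k)} (ht₀ : p t₀ ∈ π '' N) :
    ∃ u, IsOpen u ∧ t₀ ∈ u ∧ ∀ {m : ℕ} (f : EuclideanSpace ℝ (Fin m) → _), ContDiff ℝ ∞ f →
      (∀ x, f x ∈ u) → ∃ y : EuclideanSpace ℝ (Fin m) → Y, IsPlot y ∧ (∀ t, y t ∈ N) ∧
        ∀ t, π (y t) = p (f t) := by
  obtain ⟨u, hu, htu, h⟩ := Diffeology.exists_local_mem_of_isPlot_generateFrom
    (fun n x => by
      obtain ⟨y, rfl⟩ := hπ x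
      exact ⟨fun _ => y, isPlot_const, rfl⟩)
    (fun {n m p f} hp hf => by
      obtain ⟨y, hy, hyp⟩ := hp
      exact ⟨y ∘ f, isPlot_reparam hy hf, congrArg (· ∘ f) hyp⟩) hp t₀
  obtain ⟨c, hc, hc0, hcu, hcv⟩ := exists_ball_reparam hu htu
  obtain ⟨y, hy, hyp⟩ := h c hc hcu
  have hyp' : ∀ t, p (c t) = π (y t) := fun t => congrFun hyp t
  obtain ⟨y', hy'N, hy'⟩ := ht₀
  -- Only the central value has to be moved into `N`; openness along plots keeps the moved lift in
  -- `N` nearby.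
  obtain ⟨τ, hτs, hτπ, hτN⟩ := hτ (y 0) y' hy'N (by rw [← hyp', hc0, hy'])
  have hy2 : IsPlot (τ ∘ y) := hτs _ _ hy
  obtain ⟨v, -, hv, htv, hf⟩ := hcv _ (hN _ hy2) hτN
  refine ⟨v, hv, htv, fun f hfc hfv => ?_⟩
  obtain ⟨g', hg', hgs, rfl⟩ := hf f hfc hfv
  exact ⟨(τ ∘ y) ∘ g', isPlot_reparam hy2 hg', hgs, fun t =>
    (hτπ _).trans (hyp' (g' t)).symm⟩

theorem Diffeology.isOpen_image_coinduced (hπ : Function.Surjective π) {N : Set Y}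
    (hN : ∀ {k} (y : EuclideanSpace ℝ (Fin k) → Y), IsPlot y → IsOpen (y ⁻¹' N))
    (hτ : ∀ y, ∀ y' ∈ N, π y = π y' → ∃ τ : Y → Y, DSmooth τ ∧ (∀ z, π (τ z) = π z) ∧ τ y ∈ N) :
    IsOpen[(coinduced π dY).dTopology] (π '' N) := by
  refine (coinduced π dY).isOpen_iff_preimages_plots.2 fun {k} p hp => ?_
  refine isOpen_iff_mem_nhds.2 fun t₀ ht₀ => ?_
  obtain ⟨u, hu, htu, h⟩ := Diffeology.exists_local_lift hπ hN hτ hp ht₀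
  refine Filter.mem_of_superset (hu.mem_nhds htu) fun t ht => ?_
  obtain ⟨y, -, hyN, hyp⟩ := h (m := 0) (fun _ => t) contDiff_const fun _ => ht
  exact ⟨y 0, hyN 0, hyp 0⟩

theorem Diffeology.isPlot_of_lift [DiffeologicalSpace Z] (hπ : Function.Surjective π) {N : Set Y}
    (hN : ∀ {k} (y : EuclideanSpace ℝ (Fin k) → Y), IsPlot y → IsOpen (y ⁻¹' N))
    (hτ : ∀ y, ∀ y' ∈ N, π y = π y' → ∃ τ : Y → Y, DSmooth τ ∧ (∀ z, π (τ z) = π z) ∧ τ y ∈ N)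
    {k : ℕ} {p : EuclideanSpace ℝ (Fin k) → X} (hp : @IsPlot _ (coinduced π dY) k p)
    (hpN : ∀ t, p t ∈ π '' N) (q : EuclideanSpace ℝ (Fin k) → Z)
    (h : ∀ {m : ℕ} (f : EuclideanSpace ℝ (Fin m) → EuclideanSpace ℝ (Fin k)), ContDiff ℝ ∞ f →
      ∀ y : EuclideanSpace ℝ (Fin m) → Y, IsPlot y → (∀ t, y t ∈ N) → (∀ t, π (y t) = p (f t)) →
      IsPlot (q ∘ f)) : IsPlot q :=
  Diffeology.isPlot_of_local fun t₀ => by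
    obtain ⟨u, hu, htu, h'⟩ := Diffeology.exists_local_lift hπ hN hτ hp (hpN t₀)
    refine ⟨u, hu, htu, fun {m} f hf hfu => ?_⟩
    obtain ⟨y, hy, hyN, hyp⟩ := h' f hf hfu
    exact h f hf y hy hyN hyp

end Plots

/-! ### Derivations with values in the ideal -/

section IdealDerivations

variable {R : Type*} [CommRing R] [Algebra ℝ R] {A : Type*} [CommRing A] [Algebra ℝ A]
  {I : Ideal A}

theorem mkₐ_eq_zero_iff {a : A} : Ideal.Quotient.mkₐ ℝ I a = 0 ↔ a ∈ I :=
  Ideal.Quotient.eq_zero_iff_mem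

theorem mkₐ_eq_iff {a b : A} :
    Ideal.Quotient.mkₐ ℝ I a = Ideal.Quotient.mkₐ ℝ I b ↔ a - b ∈ I :=
  Ideal.Quotient.eq

variable (I) in
/-- The derivations along a point `y` of `A ⧸ I` with values in the ideal `I` of square zero. -/
def idealDer (y : R →ₐ[ℝ] A ⧸ I) : Submodule ℝ (R →ₗ[ℝ] A) where
  carrier := {E | (∀ f, E f ∈ I) ∧ ∀ f g a b, Ideal.Quotient.mkₐ ℝ I a = y f →
    Ideal.Quotient.mkₐ ℝ I b = y g → E (f * g) = a * E g + b * E f}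
  add_mem' := by
    rintro E E' ⟨h1, h2⟩ ⟨h3, h4⟩
    refine ⟨fun f => I.add_mem (h1 f) (h3 f), fun f g a b ha hb => ?_⟩
    rw [LinearMap.add_apply, LinearMap.add_apply, LinearMap.add_apply, h2 f g a b ha hb,
      h4 f g a b ha hb]
    ring
  zero_mem' := ⟨fun _ => I.zero_mem, by simp⟩
  smul_mem' := by
    rintro c E ⟨h1, h2⟩
    refine ⟨fun f => (I.restrictScalars ℝ).smul_mem c (h1 f), fun f g a b ha hb => ?_⟩
    rw [LinearMap.smul_apply, LinearMap.smul_apply, LinearMap.smul_apply, h2 f g a b ha hb,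
      smul_add, mul_smul_comm, mul_smul_comm]

/-- Two lifts of the same element of `A ⧸ I` differ by an element of `I`, which kills the values of
`E`. The Leibniz rule along one lift therefore holds for all. -/
theorem mem_idealDer_of_leibniz (hsq : ∀ a ∈ I, ∀ b ∈ I, a * b = 0) {y : R →ₐ[ℝ] A ⧸ I}
    {x : R →ₐ[ℝ] A} (hx : (Ideal.Quotient.mkₐ ℝ I).comp x = y) {E : R →ₗ[ℝ] A}
    (h1 : ∀ f, E f ∈ I) (h2 : ∀ f g, E (f * g) = x f * E g + x g * E f) : E ∈ idealDer I y := by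
  refine ⟨h1, fun f g a b ha hb => ?_⟩
  rw [← hx] at ha hb
  have e1 := hsq _ (mkₐ_eq_iff.1 ha) _ (h1 g)
  have e2 := hsq _ (mkₐ_eq_iff.1 hb) _ (h1 f)
  rw [sub_mul, sub_eq_zero] at e1 e2
  rw [h2, e1, e2]
  rfl

theorem idealDer_leibniz {y : R →ₐ[ℝ] A ⧸ I} {x : R →ₐ[ℝ] A}
    (hx : (Ideal.Quotient.mkₐ ℝ I).comp x = y) {E : R →ₗ[ℝ] A} (hE : E ∈ idealDer I y) (f g : R) :
    E (f * g) = x f * E g + x g * E f :=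
  hE.2 f g _ _ (DFunLike.congr_fun hx f) (DFunLike.congr_fun hx g)

/-- The obstruction to multiplicativity of `x + E` is `E f * E g`, which vanishes as `I ^ 2 = 0`. -/
theorem exists_point_add (hsq : ∀ a ∈ I, ∀ b ∈ I, a * b = 0) {y : R →ₐ[ℝ] A ⧸ I} {x : R →ₐ[ℝ] A}
    (hx : (Ideal.Quotient.mkₐ ℝ I).comp x = y) {E : R →ₗ[ℝ] A} (hE : E ∈ idealDer I y) :
    ∃ x' : R →ₐ[ℝ] A, (Ideal.Quotient.mkₐ ℝ I).comp x' = y ∧ ∀ f, x' f = x f + E f := by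
  have h1 : E 1 = 0 := by
    have := idealDer_leibniz hx hE 1 1
    simpa using this
  refine ⟨AlgHom.ofLinearMap (x.toLinearMap + E) (by simp [h1]) fun f g => ?_, ?_, fun f => rfl⟩
  · have h := hsq _ (hE.1 f) _ (hE.1 g)
    rw [LinearMap.add_apply, LinearMap.add_apply, LinearMap.add_apply, idealDer_leibniz hx hE,
      AlgHom.toLinearMap_apply, AlgHom.toLinearMap_apply, AlgHom.toLinearMap_apply, map_mul]
    linear_combination -h
  · ext f
    exact (mkₐ_eq_iff.2 (by simpa using hE.1 f)).trans (DFunLike.congr_fun hx f)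

theorem sub_mem_idealDer (hsq : ∀ a ∈ I, ∀ b ∈ I, a * b = 0) {y : R →ₐ[ℝ] A ⧸ I}
    {x x' : R →ₐ[ℝ] A} (hx : (Ideal.Quotient.mkₐ ℝ I).comp x = y)
    (hx' : (Ideal.Quotient.mkₐ ℝ I).comp x' = y) :
    x'.toLinearMap - x.toLinearMap ∈ idealDer I y := by
  have h1 : ∀ f, x' f - x f ∈ I := fun f =>
    mkₐ_eq_iff.1 ((DFunLike.congr_fun hx' f).trans (DFunLike.congr_fun hx f).symm)
  refine mem_idealDer_of_leibniz hsq hx h1 fun f g => ?_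
  have h := hsq _ (h1 f) _ (h1 g)
  simp only [LinearMap.sub_apply, AlgHom.toLinearMap_apply, map_mul]
  linear_combination h

theorem comp_mem_idealDer (hI : IsInvariantIdeal I) {y y' : R →ₐ[ℝ] A ⧸ I} (σ : A ≃ₐ[ℝ] A)
    (hy : ∀ f, autMap I hI σ (y f) = y' f) {E : R →ₗ[ℝ] A} (hE : E ∈ idealDer I y) :
    σ.toLinearMap ∘ₗ E ∈ idealDer I y' := by
  refine ⟨fun f => hI.apply_mem σ (hE.1 f), fun f g a b ha hb => ?_⟩
  have hσ : ∀ a f, Ideal.Quotient.mkₐ ℝ I a = y' f →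
      Ideal.Quotient.mkₐ ℝ I (σ.symm a) = y f := fun a f ha => by
    apply (autMap I hI σ).injective
    rw [autMap_mk, σ.apply_symm_apply, ha, hy]
  have h := congrArg σ (hE.2 f g _ _ (hσ a f ha) (hσ b g hb))
  rw [map_add, map_mul σ, map_mul σ, σ.apply_symm_apply, σ.apply_symm_apply] at h
  exact h

/-- A derivation along a surjective morphism which vanishes on its kernel comes from a derivation
of the target. -/
theorem exists_derivation_of_vanish {x : R →ₐ[ℝ] A} (hx : Function.Surjective x) (E : R →ₗ[ℝ] A)
    (h : ∀ f g, E (f * g) = x f * E g + x g * E f) (h0 : ∀ f, x f = 0 → E f = 0) :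
    ∃ δ : Derivation ℝ A A, ∀ f, δ (x f) = E f := by
  obtain ⟨μ, hμ⟩ := x.toLinearMap.exists_rightInverse_of_surjective (LinearMap.range_eq_top.2 hx)
  have hμ' : ∀ a, x (μ a) = a := LinearMap.congr_fun hμ
  have key : ∀ f g, x f = x g → E f = E g := fun f g hfg => by
    rw [← sub_eq_zero, ← map_sub]
    exact h0 _ (by rw [map_sub, hfg, sub_self])
  refine ⟨Derivation.mk' (E ∘ₗ μ) fun a b => ?_, fun f => key _ _ (hμ' _)⟩
  have := h (μ a) (μ b)
  rw [hμ', hμ'] at this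
  rw [LinearMap.comp_apply, key (μ (a * b)) (μ a * μ b) (by rw [map_mul x, hμ', hμ', hμ']), this]
  rfl

theorem exists_algEquiv_of_ker_eq {x x' : R →ₐ[ℝ] A} (hx : Function.Surjective x)
    (hx' : Function.Surjective x') (h : RingHom.ker x = RingHom.ker x') :
    ∃ σ : A ≃ₐ[ℝ] A, ∀ f, x' f = σ (x f) := by
  refine ⟨(Ideal.quotientKerAlgEquivOfSurjective hx).symm.trans
    ((Ideal.quotientEquivAlgOfEq ℝ h).trans (Ideal.quotientKerAlgEquivOfSurjective hx')),
    fun f => ?_⟩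
  have h : (Ideal.quotientKerAlgEquivOfSurjective hx).symm (x f) = Ideal.Quotient.mk _ f := by
    rw [AlgEquiv.symm_apply_eq]; rfl
  simp only [AlgEquiv.trans_apply, h]
  rfl

/-- The direct implication uses left exactness only through this statement. -/
theorem AffineSequenceExact.apply_eq {hI : IsInvariantIdeal I} (hex : AffineSequenceExact I hI)
    {σ : A ≃ₐ[ℝ] A} (hσ : ∀ a, σ a - a ∈ I) {b : A} (hb : b ∈ I) : σ b = b := by
  have h : σ ∈ (autMap I hI).ker := by
    rw [MonoidHom.mem_ker]
    ext z
    obtain ⟨a, rfl⟩ := Ideal.Quotient.mkₐ_surjective ℝ I z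
    rw [autMap_mk]
    exact mkₐ_eq_iff.2 (hσ a)
  rw [← hex.1] at h
  exact h.2 b hb

/-- Two surjective points over the same point of `A ⧸ I` have the same kernel if and only if they
agree on the kernel of the latter. -/
theorem AffineSequenceExact.ker_eq_iff {hI : IsInvariantIdeal I} (hex : AffineSequenceExact I hI)
    {x x' : R →ₐ[ℝ] A} (hx : Function.Surjective x) (hx' : Function.Surjective x')
    (h : ∀ f, x' f - x f ∈ I) :
    RingHom.ker x = RingHom.ker x' ↔ ∀ f, x f ∈ I → x' f = x f := by
  constructor
  · intro hk f hf
    -- Since `x` is surjective and `x' - x` has values in `I`, this `σ` is congruent to the identity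
    -- modulo `I`.
    obtain ⟨σ, hσ⟩ := exists_algEquiv_of_ker_eq hx hx' hk
    rw [hσ]
    refine hex.apply_eq (fun a => ?_) hf
    obtain ⟨g, rfl⟩ := hx a
    rw [← hσ]
    exact h g
  · intro h'
    ext f
    rw [RingHom.mem_ker, RingHom.mem_ker]
    constructor
    · intro hf
      rw [h' f (hf ▸ I.zero_mem), hf]
    · intro hf
      rw [← h' f, hf]
      have := I.neg_mem (h f)
      rwa [hf, zero_sub, neg_neg] at this

/-- The automorphisms `exp (r δ)` induce the identity on `A ⧸ I`, hence fix `I` pointwise;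
differentiate in `r`. -/
theorem AffineSequenceExact.derivation_apply_eq_zero {hI : IsInvariantIdeal I}
    (hex : AffineSequenceExact I hI) [Module.Finite ℝ A] {δ : Derivation ℝ A A}
    (hδ : ∀ a, δ a ∈ I) {b : A} (hb : b ∈ I) : δ b = 0 := by
  have hfix : ∀ r : ℝ, linExp (r • δ.toLinearMap) b = b := by
    intro r
    refine hex.apply_eq (σ := expAut (r • δ)) (fun a => mkₐ_eq_iff.1 ?_) hb
    rw [expAut_comm (Ideal.Quotient.mkₐ ℝ I) (D' := 0) fun a =>
      mkₐ_eq_zero_iff.2 ((I.restrictScalars ℝ).smul_mem r (hδ a))]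
    change linExp (0 : Module.End ℝ (A ⧸ I)) _ = _
    rw [linExp, map_zero, NormedSpace.exp_zero, map_one]
    rfl
  refine (Module.forall_dual_apply_eq_zero_iff ℝ _).1 fun l => ?_
  have hd := hasDerivAt_linExp_smul l δ.toLinearMap b
  simp only [hfix] at hd
  exact hd.unique (hasDerivAt_const 0 (l b))

end IdealDerivations

/-! ### The affine structure of the fibres -/

section GenericEquivs

theorem exists_equiv_of_surjective {X Y Z : Type*} {f : X → Y} {g : X → Z}
    (hf : Function.Surjective f) (hg : Function.Surjective g)
    (h : ∀ x x', f x = f x' ↔ g x = g x') : ∃ e : Y ≃ Z, ∀ x, e (f x) = g x := by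
  have key : ∀ x, g (Function.surjInv hf (f x)) = g x := fun x =>
    (h _ _).1 (Function.surjInv_eq hf _)
  refine ⟨Equiv.ofBijective (fun y => g (Function.surjInv hf y)) ⟨fun y y' hy => ?_, fun z => ?_⟩,
    key⟩
  · have := (h _ _).2 hy
    rwa [Function.surjInv_eq hf, Function.surjInv_eq hf] at this
  · obtain ⟨x, rfl⟩ := hg z
    exact ⟨f x, key x⟩

theorem exists_linearEquiv_of_surjective {X Y Z : Type*} [AddCommGroup X] [Module ℝ X]
    [AddCommGroup Y] [Module ℝ Y] [AddCommGroup Z] [Module ℝ Z] {f : X →ₗ[ℝ] Y} {g : X →ₗ[ℝ] Z}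
    (hf : Function.Surjective f) (hg : Function.Surjective g) (h : ∀ x, f x = 0 ↔ g x = 0) :
    ∃ e : Y ≃ₗ[ℝ] Z, ∀ x, e (f x) = g x := by
  have hk : LinearMap.ker f = LinearMap.ker g := Submodule.ext h
  refine ⟨(f.quotKerEquivOfSurjective hf).symm.trans ((Submodule.quotEquivOfEq _ _ hk).trans
    (g.quotKerEquivOfSurjective hg)), fun x => ?_⟩
  have : (f.quotKerEquivOfSurjective hf).symm (f x) = Submodule.Quotient.mk x := by
    rw [LinearEquiv.symm_apply_eq]; rfl
  simp only [LinearEquiv.trans_apply, this]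
  rfl

/-- The torsor structure transported along a bijection with the group. -/
@[reducible] def addTorsorOfEquiv {V P : Type*} [AddCommGroup V] (e : V ≃ P) : AddTorsor V P where
  vadd v p := e (v + e.symm p)
  zero_vadd p := by
    change e (0 + e.symm p) = p
    simp
  add_vadd v w p := by
    change e (v + w + e.symm p) = e (v + e.symm (e (w + e.symm p)))
    rw [Equiv.symm_apply_apply, add_assoc]
  vsub p q := e.symm p - e.symm q
  nonempty := ⟨e 0⟩
  vsub_vadd' p q := by
    change e (e.symm p - e.symm q + e.symm q) = p
    simp
  vadd_vsub' v p := by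
    change e.symm (e (v + e.symm p)) - e.symm p = v
    simp

end GenericEquivs

/-! ### Derivations and tangent vectors at a jet, read through a regular point -/

section JetFibres

variable {n : ℕ} {M : Type u} [TopologicalSpace M] [ChartedSpace (EuclideanSpace ℝ (Fin n)) M]
variable {A : Type v} [CommRing A] [Algebra ℝ A] {I : Ideal A}

theorem JetSpace.exists_jet_eq (𝔭 : JetSpace n M A) : ∃ x : RegularPoint n M A, x.jet = 𝔭 :=
  ⟨𝔭.rep, 𝔭.jet_rep⟩

theorem RegularPoint.jet_eq_iff {x x' : RegularPoint n M A} :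
    x.jet = x'.jet ↔ ∃ σ : A ≃ₐ[ℝ] A, ∀ f, x'.1 f = σ (x.1 f) := by
  constructor
  · intro h
    exact exists_algEquiv_of_ker_eq x.2 x'.2 (congrArg Subtype.val h)
  · rintro ⟨σ, hσ⟩
    apply Subtype.ext
    ext f
    change x.1 f = 0 ↔ x'.1 f = 0
    rw [hσ, map_eq_zero_iff σ σ.injective]

/-- The regular point `σ ∘ x`. -/
def RegularPoint.map (σ : A ≃ₐ[ℝ] A) (x : RegularPoint n M A) : RegularPoint n M A :=
  ⟨(σ : A →ₐ[ℝ] A).comp x.1, σ.surjective.comp x.2⟩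

theorem RegularPoint.map_apply (σ : A ≃ₐ[ℝ] A) (x : RegularPoint n M A) (f : SmoothFn n M) :
    (x.map σ).1 f = σ (x.1 f) := rfl

theorem RegularPoint.jet_map (σ : A ≃ₐ[ℝ] A) (x : RegularPoint n M A) : (x.map σ).jet = x.jet :=
  (RegularPoint.jet_eq_iff.2 ⟨σ, fun _ => rfl⟩).symm

theorem RegularPoint.proj_eq_iff {x : RegularPoint n M A} {y : RegularPoint n M (A ⧸ I)} :
    x.proj I = y ↔ (Ideal.Quotient.mkₐ ℝ I).comp x.1 = y.1 :=
  Subtype.ext_iff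

/-- A point in the fibre over `y.jet` is the kernel of a regular point over `y`. -/
theorem AffineSequenceExact.exists_proj_eq {hI : IsInvariantIdeal I}
    (hex : AffineSequenceExact I hI) {𝔭 : JetSpace n M A} {y : RegularPoint n M (A ⧸ I)}
    (h : jetMap I 𝔭 = y.jet) : ∃ x : RegularPoint n M A, x.jet = 𝔭 ∧ x.proj I = y := by
  obtain ⟨x, rfl⟩ := 𝔭.exists_jet_eq
  rw [jetMap_jet I hI] at h
  obtain ⟨τ, hτ⟩ := RegularPoint.jet_eq_iff.1 h
  obtain ⟨σ, rfl⟩ := hex.2 τ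
  refine ⟨x.map σ, x.jet_map σ, RegularPoint.proj_eq_iff.2 ?_⟩
  ext f
  exact (hτ f).symm

/-- The map induced by `x` on the quotient by its kernel. -/
def RegularPoint.coord (x : RegularPoint n M A) : (SmoothFn n M ⧸ x.jet.1) ≃ₐ[ℝ] A :=
  Ideal.quotientKerAlgEquivOfSurjective x.2

theorem RegularPoint.coord_mk (x : RegularPoint n M A) (f : SmoothFn n M) :
    x.coord (Ideal.Quotient.mk _ f) = x.1 f := rfl

theorem RegularPoint.coord_smul (x : RegularPoint n M A) (f : SmoothFn n M)
    (q : SmoothFn n M ⧸ x.jet.1) : x.coord (f • q) = x.1 f * x.coord q := by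
  obtain ⟨g, rfl⟩ := Ideal.Quotient.mk_surjective q
  exact map_mul x.1 f g

theorem RegularPoint.coord_der_mul (x : RegularPoint n M A) (D : x.jet.Der) (f g : SmoothFn n M) :
    x.coord (D (f * g)) = x.1 f * x.coord (D g) + x.1 g * x.coord (D f) := by
  rw [Derivation.leibniz, map_add, coord_smul, coord_smul]

/-- The derivation into `C^∞(M) ⧸ ker x` defined by a derivation along `x`. -/
def RegularPoint.toDer (x : RegularPoint n M A) (E : SmoothFn n M →ₗ[ℝ] A)
    (hE : ∀ f g, E (f * g) = x.1 f * E g + x.1 g * E f) : x.jet.Der :=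
  Derivation.mk' (x.coord.symm.toLinearMap ∘ₗ E) fun f g => x.coord.injective (by
    rw [map_add, coord_smul, coord_smul]
    simp [hE])

theorem RegularPoint.coord_toDer (x : RegularPoint n M A) (E : SmoothFn n M →ₗ[ℝ] A)
    (hE : ∀ f g, E (f * g) = x.1 f * E g + x.1 g * E f) (f : SmoothFn n M) :
    x.coord (x.toDer E hE f) = E f :=
  x.coord.apply_symm_apply _

theorem RegularPoint.mem_nullDer_iff (x : RegularPoint n M A) (D : x.jet.Der) :
    D ∈ x.jet.nullDer ↔ ∀ f, x.1 f = 0 → x.coord (D f) = 0 :=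
  forall₂_congr fun _ _ => (map_eq_zero_iff x.coord x.coord.injective).symm

theorem RegularPoint.mem_relDer_iff (hI : IsInvariantIdeal I) (x : RegularPoint n M A)
    (D : x.jet.Der) : D ∈ x.jet.relDer I ↔ ∀ f, x.coord (D f) ∈ I := by
  refine forall_congr' fun f => ?_
  rw [jetMap_jet I hI, Ideal.mem_map_iff_of_surjective _ Ideal.Quotient.mk_surjective]
  constructor
  · rintro ⟨g, hg, h⟩
    rw [← h, coord_mk]
    exact mkₐ_eq_zero_iff.1 hg
  · intro h
    obtain ⟨g, hg⟩ := Ideal.Quotient.mk_surjective (D f)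
    rw [← hg, coord_mk] at h
    exact ⟨g, mkₐ_eq_zero_iff.2 h, hg⟩

theorem RegularPoint.pushDer_mem_nullDer_iff (hI : IsInvariantIdeal I) (x : RegularPoint n M A)
    (D : x.jet.Der) : x.jet.pushDer I D ∈ (jetMap I x.jet).nullDer ↔
      ∀ f, x.1 f ∈ I → x.coord (D f) ∈ I := by
  have hk : ∀ g, g ∈ (jetMap I x.jet).1 ↔ x.1 g ∈ I := fun g => by
    rw [jetMap_jet I hI]
    exact mkₐ_eq_zero_iff
  refine forall_congr' fun f => ?_
  rw [hk]
  refine imp_congr_right fun _ => ?_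
  obtain ⟨g, hg⟩ := Ideal.Quotient.mk_surjective (D f)
  change Submodule.factor (le_jetMap I x.jet) (D f) = 0 ↔ _
  rw [← hg, coord_mk, ← hk]
  exact Ideal.Quotient.eq_zero_iff_mem

theorem RegularPoint.mem_addKer_iff (x : RegularPoint n M A) (D : x.jet.Der) (f : SmoothFn n M) :
    f ∈ x.jet.addKer D ↔ x.1 f + x.coord (D f) = 0 := by
  rw [← x.coord_mk, ← map_add, map_eq_zero_iff x.coord x.coord.injective]
  rfl

/-- The derivations with values in `I` along the projection of `x`, as derivations into
`C^∞(M) ⧸ ker x`. -/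
def RegularPoint.toRelDer (hI : IsInvariantIdeal I) (x : RegularPoint n M A)
    {y : RegularPoint n M (A ⧸ I)} (hx : x.proj I = y) : idealDer I y.1 →ₗ[ℝ] x.jet.relDer I where
  toFun E := ⟨x.toDer E.1 (idealDer_leibniz (RegularPoint.proj_eq_iff.1 hx) E.2),
    (x.mem_relDer_iff hI _).2 fun f => by rw [coord_toDer]; exact E.2.1 f⟩
  map_add' E E' := by
    apply Subtype.ext
    ext f
    exact map_add x.coord.symm _ _
  map_smul' c E := by
    apply Subtype.ext
    ext f
    exact map_smul x.coord.symm _ _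

theorem RegularPoint.coord_toRelDer (hI : IsInvariantIdeal I) (x : RegularPoint n M A)
    {y : RegularPoint n M (A ⧸ I)} (hx : x.proj I = y) (E : idealDer I y.1) (f : SmoothFn n M) :
    x.coord ((x.toRelDer hI hx E).1 f) = E.1 f :=
  x.coord.apply_symm_apply _

theorem RegularPoint.toRelDer_surjective (hI : IsInvariantIdeal I)
    (hsq : ∀ a ∈ I, ∀ b ∈ I, a * b = 0) (x : RegularPoint n M A)
    {y : RegularPoint n M (A ⧸ I)} (hx : x.proj I = y) :
    Function.Surjective (x.toRelDer hI hx) := by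
  intro D
  refine ⟨⟨x.coord.toLinearMap ∘ₗ D.1.toLinearMap, mem_idealDer_of_leibniz hsq
    (RegularPoint.proj_eq_iff.1 hx) ((x.mem_relDer_iff hI _).1 D.2) (x.coord_der_mul D.1)⟩, ?_⟩
  apply Subtype.ext
  ext f
  exact x.coord.symm_apply_apply _

theorem RegularPoint.verticalClass_eq_zero_iff (x : RegularPoint n M A) (D : x.jet.relDer I) :
    x.jet.verticalClass I D = 0 ↔ D.1 ∈ x.jet.nullDer := by
  rw [← Submodule.Quotient.mk_eq_zero]
  exact Subtype.ext_iff

variable [Module.Finite ℝ A] {hI : IsInvariantIdeal I}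

/-- A null class only says that `E` vanishes on `ker x`. Then `E = δ ∘ x` with `δ` a derivation of
`A` into `I`, and such a `δ` kills `I`, so `E` vanishes on the larger ideal `ker y`. The criterion
no longer depends on `x`, which makes one model space serve a whole fibre. -/
theorem AffineSequenceExact.verticalClass_toRelDer_eq_zero_iff (hex : AffineSequenceExact I hI)
    (x : RegularPoint n M A) {y : RegularPoint n M (A ⧸ I)} (hx : x.proj I = y)
    (E : idealDer I y.1) :
    x.jet.verticalClass I (x.toRelDer hI hx E) = 0 ↔ ∀ f, y.1 f = 0 → E.1 f = 0 := by
  rw [x.verticalClass_eq_zero_iff, x.mem_nullDer_iff]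
  have hxy : ∀ f, y.1 f = Ideal.Quotient.mkₐ ℝ I (x.1 f) := fun f => by rw [← hx]; rfl
  constructor
  · intro h f hf
    obtain ⟨δ, hδ⟩ := exists_derivation_of_vanish x.2 E.1
      (idealDer_leibniz (RegularPoint.proj_eq_iff.1 hx) E.2)
      fun g hg => (x.coord_toRelDer hI hx E g).symm.trans (h g hg)
    rw [← hδ]
    refine hex.derivation_apply_eq_zero (fun a => ?_) (mkₐ_eq_zero_iff.1 ((hxy f).symm.trans hf))
    obtain ⟨g, rfl⟩ := x.2 a
    rw [hδ]
    exact E.2.1 g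
  · intro h f hf
    exact (x.coord_toRelDer hI hx E f).trans (h f (by rw [hxy, hf, map_zero]))

/-- The vector of the tangent space defined by a derivation along `x` which maps to a null vector
of `J^B M` has a representative with values in `I`. -/
theorem AffineSequenceExact.verticalClass_surjective (hex : AffineSequenceExact I hI)
    (𝔭 : JetSpace n M A) : Function.Surjective (𝔭.verticalClass I) := by
  obtain ⟨x, rfl⟩ := 𝔭.exists_jet_eq
  rintro ⟨_, D, hD, rfl⟩
  have hD' : x.jet.pushDer I D ∈ (jetMap I x.jet).nullDer := (Submodule.Quotient.mk_eq_zero _).1 hD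
  rw [x.pushDer_mem_nullDer_iff hI] at hD'
  obtain ⟨δ', hδ'⟩ := exists_derivation_of_vanish (x.proj I).2
    ((Ideal.Quotient.mkₐ ℝ I).toLinearMap ∘ₗ x.coord.toLinearMap ∘ₗ D.toLinearMap)
    (fun f g => by
      have := congrArg (Ideal.Quotient.mkₐ ℝ I) (x.coord_der_mul D f g)
      rw [map_add, map_mul (Ideal.Quotient.mkₐ ℝ I), map_mul (Ideal.Quotient.mkₐ ℝ I)] at this
      exact this)
    (fun f hf => mkₐ_eq_zero_iff.2 (hD' f (mkₐ_eq_zero_iff.1 hf)))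
  -- Subtracting `δ ∘ x`, for a lift `δ` of the derivation induced on `A ⧸ I`, brings the values
  -- into `I` and changes nothing on `ker x`.
  obtain ⟨δ, hδ⟩ := exists_derivation_lift hI hex.2 δ'
  let E : SmoothFn n M →ₗ[ℝ] A :=
    x.coord.toLinearMap ∘ₗ D.toLinearMap - δ.toLinearMap ∘ₗ x.1.toLinearMap
  have hE : ∀ f, E f = x.coord (D f) - δ (x.1 f) := fun f => rfl
  have hEl : ∀ f g, E (f * g) = x.1 f * E g + x.1 g * E f := fun f g => by
    rw [hE, hE, hE, x.coord_der_mul, map_mul x.1, Derivation.leibniz, smul_eq_mul, smul_eq_mul]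
    ring
  refine ⟨⟨x.toDer E hEl, (x.mem_relDer_iff hI _).2 fun f => ?_⟩, Subtype.ext ?_⟩
  · rw [x.coord_toDer, hE, ← mkₐ_eq_iff, hδ]
    exact (hδ' f).symm
  · refine (Submodule.Quotient.eq _).2 ((x.mem_nullDer_iff _).2 fun f hf => ?_)
    change x.coord (x.toDer E hEl f - D f) = 0
    rw [map_sub, x.coord_toDer, hE, hf, map_zero, sub_zero, sub_self]

end JetFibres

/-! ### Torsor structure of the fibres and the vertical tangent spaces -/

section AffineFibres

/-- A point of the fibre over `b`. -/
def AffineFibres.mkPoint {E : Type u} {X : Type v} {π : E → X} (S : AffineFibres.{u, v, w} π)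
    {b : X} (e : E) (h : π e = b) : S.Point b := ⟨e, h⟩

variable {n : ℕ} {M : Type u} [TopologicalSpace M] [ChartedSpace (EuclideanSpace ℝ (Fin n)) M]
variable {A : Type v} [CommRing A] [Algebra ℝ A] [IsWeilAlgebra A] {I : Ideal A}

theorem RegularPoint.exists_add (hsq : ∀ a ∈ I, ∀ b ∈ I, a * b = 0)
    (hm : I ≤ IsLocalRing.maximalIdeal A ^ 2) (x : RegularPoint n M A)
    {y : RegularPoint n M (A ⧸ I)} (hx : x.proj I = y) (E : idealDer I y.1) :
    ∃ x' : RegularPoint n M A, x'.proj I = y ∧ ∀ f, x'.1 f = x.1 f + E.1 f := by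
  obtain ⟨x', h1, h2⟩ := exists_point_add hsq (RegularPoint.proj_eq_iff.1 hx) E.2
  exact ⟨⟨x', surjective_of_mk_comp hm (h1 ▸ y.2)⟩, RegularPoint.proj_eq_iff.2 h1, h2⟩

theorem RegularPoint.exists_eq_add (hsq : ∀ a ∈ I, ∀ b ∈ I, a * b = 0) {x x' : RegularPoint n M A}
    {y : RegularPoint n M (A ⧸ I)} (hx : x.proj I = y) (hx' : x'.proj I = y) :
    ∃ E : idealDer I y.1, ∀ f, x'.1 f = x.1 f + E.1 f :=
  ⟨⟨_, sub_mem_idealDer hsq (RegularPoint.proj_eq_iff.1 hx) (RegularPoint.proj_eq_iff.1 hx')⟩,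
    fun f => by simp⟩

/-- Passing from points to jets loses exactly the derivations that vanish on `ker y`; hence the
quotient by them acts freely on the fibre. -/
theorem AffineSequenceExact.jet_eq_iff_of_add {hI : IsInvariantIdeal I}
    (hex : AffineSequenceExact I hI) {x x₁ x₂ : RegularPoint n M A}
    {y : RegularPoint n M (A ⧸ I)} (hx : x.proj I = y) {E₁ E₂ : idealDer I y.1}
    (h₁ : ∀ f, x₁.1 f = x.1 f + E₁.1 f) (h₂ : ∀ f, x₂.1 f = x.1 f + E₂.1 f) :
    x₁.jet = x₂.jet ↔ ∀ f, y.1 f = 0 → (E₁ - E₂).1 f = 0 := by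
  have hxy : ∀ f, y.1 f = Ideal.Quotient.mkₐ ℝ I (x.1 f) := fun f => by rw [← hx]; rfl
  have hd : ∀ f, (E₁ - E₂).1 f = E₁.1 f - E₂.1 f := fun f => rfl
  have hmem : ∀ f, x₁.1 f ∈ I ↔ y.1 f = 0 := fun f => by
    rw [hxy, mkₐ_eq_zero_iff, h₁]
    exact ⟨fun h => by simpa using I.sub_mem h (E₁.2.1 f), fun h => I.add_mem h (E₁.2.1 f)⟩
  have h := hex.ker_eq_iff x₁.2 x₂.2 fun f => by
    rw [h₁, h₂, add_sub_add_left_eq_sub]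
    exact I.sub_mem (E₂.2.1 f) (E₁.2.1 f)
  refine (Subtype.ext_iff.trans h).trans (forall_congr' fun f => ?_)
  rw [hmem, hd, h₁, h₂, sub_eq_zero, add_right_inj]
  exact imp_congr_right fun _ => eq_comm

/-- The affine structures on the fibres of `φ^J`: there are vector spaces `V b`, quotients of the
spaces of derivations with values in `I` along the points `y` with kernel `b`, acting on the fibre
by the addition law. -/
theorem AffineSequenceExact.exists_affineFibres {hI : IsInvariantIdeal I}
    (hex : AffineSequenceExact I hI) (hsq : ∀ a ∈ I, ∀ b ∈ I, a * b = 0)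
    (hm : I ≤ IsLocalRing.maximalIdeal A ^ 2)
    (hL : ∀ y : RegularPoint n M (A ⧸ I), ∃ x : RegularPoint n M A, x.proj I = y) :
    ∃ (S : AffineFibres.{u, u, u} (jetMap I : JetSpace n M A → JetSpace n M (A ⧸ I)))
      (m : ∀ (b : JetSpace n M (A ⧸ I)) (y : RegularPoint n M (A ⧸ I)), y.jet = b →
        (idealDer I y.1 →ₗ[ℝ] S.V b)),
      (∀ b y hy, Function.Surjective (m b y hy)) ∧
      (∀ b y hy E, m b y hy E = 0 ↔ ∀ f, y.1 f = 0 → E.1 f = 0) ∧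
      ∀ b y hy (E : idealDer I y.1) (x x' : RegularPoint n M A) (_ : x.proj I = y)
        (_ : ∀ f, x'.1 f = x.1 f + E.1 f) (hb : jetMap I x.jet = b),
        (m b y hy E +ᵥ S.mkPoint x.jet hb).1 = x'.jet := by
  choose lift hlift using fun b : JetSpace n M (A ⧸ I) => hL b.rep
  let m₀ : ∀ b : JetSpace n M (A ⧸ I), idealDer I b.rep.1 →ₗ[ℝ] (lift b).jet.vertical I :=
    fun b => (lift b).jet.verticalClass I ∘ₗ (lift b).toRelDer hI (hlift b)
  have hm₀ : ∀ b, Function.Surjective (m₀ b) := fun b =>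
    (hex.verticalClass_surjective _).comp ((lift b).toRelDer_surjective hI hsq (hlift b))
  have hm₀' : ∀ b E, m₀ b E = 0 ↔ ∀ f, b.rep.1 f = 0 → E.1 f = 0 := fun b E =>
    hex.verticalClass_toRelDer_eq_zero_iff (lift b) (hlift b) E
  choose add hadd hadd' using fun b (E : idealDer I b.rep.1) =>
    (lift b).exists_add hsq hm (hlift b) E
  have hjm : ∀ b (x : RegularPoint n M A), x.proj I = b.rep → jetMap I x.jet = b :=
    fun b x hx => by rw [jetMap_jet I hI, hx, b.jet_rep]
  let Φ : ∀ b, idealDer I b.rep.1 → Fibre (jetMap I : JetSpace n M A → _) b := fun b E =>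
    ⟨(add b E).jet, hjm b _ (hadd b E)⟩
  have hΦ : ∀ b, Function.Surjective (Φ b) := by
    rintro b ⟨𝔭, h𝔭⟩
    obtain ⟨x, rfl, hx⟩ := hex.exists_proj_eq (h𝔭.trans b.jet_rep.symm)
    obtain ⟨E, hE⟩ := RegularPoint.exists_eq_add hsq (hlift b) hx
    refine ⟨E, Subtype.ext (congrArg RegularPoint.jet (Subtype.ext (AlgHom.ext fun f => ?_)))⟩
    rw [hE, hadd']
  choose e he using fun b => exists_equiv_of_surjective (hm₀ b) (hΦ b) fun E E' => by
    rw [← sub_eq_zero, ← map_sub, hm₀']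
    refine Iff.trans ?_ Subtype.ext_iff.symm
    exact (hex.jet_eq_iff_of_add (hlift b) (hadd' b E) (hadd' b E')).symm
  -- The model space is the vertical space at a reference jet rather than a quotient of derivations
  -- into `A`, which keeps it in universe `u`.
  let S : AffineFibres.{u, u, u} (jetMap I : JetSpace n M A → JetSpace n M (A ⧸ I)) :=
    { V := fun b => (lift b).jet.vertical I
      addCommGroup := fun b => inferInstance
      module := fun b => inferInstance
      torsor := fun b => addTorsorOfEquiv (e b) }
  -- An arbitrary `y` with kernel `b` differs from the representative by an automorphism of `A ⧸ I`;
  -- a lift of it to `A` transports derivations.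
  have hσ : ∀ (b : JetSpace n M (A ⧸ I)) (y : RegularPoint n M (A ⧸ I)), y.jet = b →
      ∃ σ : A ≃ₐ[ℝ] A, ∀ f, autMap I hI σ (y.1 f) = b.rep.1 f := by
    intro b y hy
    obtain ⟨τ, hτ⟩ := RegularPoint.jet_eq_iff.1 (hy.trans b.jet_rep.symm)
    obtain ⟨σ, rfl⟩ := hex.2 τ
    exact ⟨σ, fun f => (hτ f).symm⟩
  choose σ hσ using hσ
  let tr : ∀ (b : JetSpace n M (A ⧸ I)) (y : RegularPoint n M (A ⧸ I)), y.jet = b →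
      (idealDer I y.1 →ₗ[ℝ] idealDer I b.rep.1) := fun b y hy =>
    { toFun := fun E => ⟨(σ b y hy).toLinearMap ∘ₗ E.1, comp_mem_idealDer hI _ (hσ b y hy) E.2⟩
      map_add' := fun E E' => Subtype.ext (LinearMap.ext fun f => map_add (σ b y hy) _ _)
      map_smul' := fun c E => Subtype.ext (LinearMap.ext fun f => map_smul (σ b y hy) _ _) }
  have htr : ∀ b y hy E f, (tr b y hy E).1 f = σ b y hy (E.1 f) := fun _ _ _ _ _ => rfl
  have htrs : ∀ b y hy, Function.Surjective (tr b y hy) := by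
    intro b y hy E
    refine ⟨⟨(σ b y hy).symm.toLinearMap ∘ₗ E.1, comp_mem_idealDer hI _ (fun f => ?_) E.2⟩,
      Subtype.ext (LinearMap.ext fun f => (σ b y hy).apply_symm_apply _)⟩
    rw [← hσ b y hy]
    change (autMap I hI (σ b y hy)⁻¹ * autMap I hI (σ b y hy)) (y.1 f) = _
    rw [map_inv, inv_mul_cancel]
    rfl
  refine ⟨S, fun b y hy => m₀ b ∘ₗ tr b y hy, fun b y hy => (hm₀ b).comp (htrs b y hy),
    fun b y hy E => ?_, fun b y hy E x x' hx hx' hb => ?_⟩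
  · refine (hm₀' b _).trans (forall_congr' fun f => ?_)
    rw [htr, ← hσ b y hy, map_eq_zero_iff _ (σ b y hy).injective,
      map_eq_zero_iff _ (autMap I hI (σ b y hy)).injective]
  -- Moving `x` by `σ` does not change its jet and places it over the representative, where
  -- translation is addition of derivations.
  · have hxσ : (x.map (σ b y hy)).proj I = b.rep := by
      rw [RegularPoint.proj_eq_iff]
      ext f
      rw [← hσ b y hy, ← DFunLike.congr_fun (RegularPoint.proj_eq_iff.1 hx) f]
      rfl
    obtain ⟨E₀, hE₀⟩ := RegularPoint.exists_eq_add hsq (hlift b) hxσ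
    have h1 : e b (m₀ b E₀) = S.mkPoint x.jet hb := by
      rw [he]
      refine Subtype.ext (Eq.trans ?_ (x.jet_map (σ b y hy)))
      refine congrArg RegularPoint.jet (Subtype.ext (AlgHom.ext fun f => ?_))
      rw [hE₀, hadd']
    change (e b (m₀ b (tr b y hy E) + (e b).symm (S.mkPoint x.jet hb))).1 = x'.jet
    rw [← h1, Equiv.symm_apply_apply, ← map_add, he]
    refine Eq.trans ?_ (x'.jet_map (σ b y hy))
    refine congrArg RegularPoint.jet (Subtype.ext (AlgHom.ext fun f => ?_))
    rw [hadd', RegularPoint.map_apply, hx', map_add, ← x.map_apply, hE₀]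
    change _ + ((tr b y hy E).1 f + E₀.1 f) = _
    rw [htr]
    ring

theorem RegularPoint.restrictScalars_jet_eq_addKer (hI : IsInvariantIdeal I)
    {x x' : RegularPoint n M A} {y : RegularPoint n M (A ⧸ I)} (hx : x.proj I = y)
    (E : idealDer I y.1) (hx' : ∀ f, x'.1 f = x.1 f + E.1 f) :
    x'.jet.1.restrictScalars ℝ = x.jet.addKer (x.toRelDer hI hx E).1 := by
  ext f
  rw [x.mem_addKer_iff, x.coord_toRelDer, ← hx']
  rfl

/-- The vertical space at `ker x` and the model space are quotients of the same space of derivations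
by the same kernel, which defines `θ`. -/
theorem AffineSequenceExact.exists_theta {hI : IsInvariantIdeal I}
    (hex : AffineSequenceExact I hI) (hsq : ∀ a ∈ I, ∀ b ∈ I, a * b = 0)
    (hm : I ≤ IsLocalRing.maximalIdeal A ^ 2)
    {S : AffineFibres.{u, u, u} (jetMap I : JetSpace n M A → JetSpace n M (A ⧸ I))}
    {m : ∀ (b : JetSpace n M (A ⧸ I)) (y : RegularPoint n M (A ⧸ I)), y.jet = b →
      (idealDer I y.1 →ₗ[ℝ] S.V b)}
    (hms : ∀ b y hy, Function.Surjective (m b y hy))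
    (hm0 : ∀ b y hy E, m b y hy E = 0 ↔ ∀ f, y.1 f = 0 → E.1 f = 0)
    (hmadd : ∀ b y hy (E : idealDer I y.1) (x x' : RegularPoint n M A) (_ : x.proj I = y)
        (_ : ∀ f, x'.1 f = x.1 f + E.1 f) (hb : jetMap I x.jet = b),
        (m b y hy E +ᵥ S.mkPoint x.jet hb).1 = x'.jet) :
    ∃ θ : ∀ 𝔭 : JetSpace n M A, 𝔭.vertical I ≃ₗ[ℝ] S.V (jetMap I 𝔭),
      (∀ (𝔭 : JetSpace n M A) (D : 𝔭.relDer I),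
        (θ 𝔭 (𝔭.verticalClass I D) +ᵥ S.pt 𝔭).1.1.restrictScalars ℝ = 𝔭.addKer D.1) ∧
      ∀ (x : RegularPoint n M A) (y : RegularPoint n M (A ⧸ I)) (hx : x.proj I = y)
        (hy : y.jet = jetMap I x.jet) (E : idealDer I y.1),
        θ x.jet (x.jet.verticalClass I (x.toRelDer hI hx E)) = m _ y hy E := by
  have h1 : ∀ 𝔭 : JetSpace n M A, ∃ θ : 𝔭.vertical I ≃ₗ[ℝ] S.V (jetMap I 𝔭),
      ∀ D : 𝔭.relDer I,
        (θ (𝔭.verticalClass I D) +ᵥ S.pt 𝔭).1.1.restrictScalars ℝ = 𝔭.addKer D.1 := by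
    intro 𝔭
    obtain ⟨x, rfl⟩ := 𝔭.exists_jet_eq
    have hy : (x.proj I).jet = jetMap I x.jet := (jetMap_jet I hI x).symm
    have hx : x.proj I = x.proj I := rfl
    let F : idealDer I (x.proj I).1 →ₗ[ℝ] x.jet.vertical I :=
      x.jet.verticalClass I ∘ₗ x.toRelDer hI hx
    have hF : Function.Surjective F :=
      (hex.verticalClass_surjective _).comp (x.toRelDer_surjective hI hsq hx)
    have hF0 : ∀ E, F E = 0 ↔ m _ (x.proj I) hy E = 0 := fun E =>
      (hex.verticalClass_toRelDer_eq_zero_iff x hx E).trans (hm0 _ _ _ _).symm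
    obtain ⟨θ, hθ⟩ := exists_linearEquiv_of_surjective
      (X := idealDer I (x.proj I).1) (Y := x.jet.vertical I) (Z := S.V (jetMap I x.jet))
      (f := F) (g := m _ (x.proj I) hy) hF (hms _ (x.proj I) hy) hF0
    refine ⟨θ, fun D => ?_⟩
    obtain ⟨E, rfl⟩ := x.toRelDer_surjective hI hsq hx D
    obtain ⟨x', -, hx'⟩ := x.exists_add hsq hm hx E
    have h1 : (θ (F E) +ᵥ S.pt x.jet).1 = (m _ (x.proj I) hy E +ᵥ S.pt x.jet).1 :=
      congrArg (fun v => (v +ᵥ S.pt x.jet).1) (hθ E)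
    have h2 : (m _ (x.proj I) hy E +ᵥ S.pt x.jet).1 = x'.jet :=
      hmadd _ (x.proj I) hy E x x' hx hx' rfl
    exact (congrArg (fun 𝔭 : JetSpace n M A => 𝔭.1.restrictScalars ℝ) (h1.trans h2)).trans
      (RegularPoint.restrictScalars_jet_eq_addKer hI hx E hx')
  choose θ hθ using h1
  refine ⟨θ, hθ, fun x y hx hy E => ?_⟩
  obtain ⟨x', -, hx'⟩ := x.exists_add hsq hm hx E
  -- The action on the fibre is free, so `θ` is determined by the translates and the formula holds
  -- for every `y` and `x`.
  refine vadd_right_cancel (S.pt x.jet) (Subtype.ext (Subtype.ext ?_))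
  apply Submodule.restrictScalars_injective ℝ
  refine (hθ _ _).trans
    ((RegularPoint.restrictScalars_jet_eq_addKer hI hx E hx').symm.trans ?_)
  exact congrArg (fun 𝔭 : JetSpace n M A => 𝔭.1.restrictScalars ℝ)
    (hmadd _ _ hy E x x' hx hx' rfl).symm

end AffineFibres

/-! ### Derivations with values in the ideal, in local coordinates -/

section CoordinateDerivations

theorem LinearMap.injective_of_forall (V W : Type*) [AddCommGroup V] [Module ℝ V] [AddCommGroup W]
    [Module ℝ W] {f : V →ₗ[ℝ] W} (h : ∀ v, f v = 0 → v = 0) : Function.Injective f :=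
  (injective_iff_map_eq_zero f).2 h

theorem SmoothFamilyOn.of_injective {T V W : Type*} [NormedAddCommGroup T] [NormedSpace ℝ T]
    [AddCommGroup V] [Module ℝ V] [AddCommGroup W] [Module ℝ W] {u : Set T} {L : V →ₗ[ℝ] W}
    (hL : Function.Injective L) {g : T → V} (h : SmoothFamilyOn u fun t => L (g t)) :
    SmoothFamilyOn u g := by
  obtain ⟨K, hK⟩ := L.exists_leftInverse_of_injective (LinearMap.ker_eq_bot.2 hL)
  have hK' : ∀ v, K (L v) = v := LinearMap.congr_fun hK
  simpa only [hK'] using h.map K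

variable {n : ℕ} {R : Type*} [CommRing R] [Algebra ℝ R]
variable {A : Type*} [CommRing A] [Algebra ℝ A] [IsWeilAlgebra A] {I : Ideal A}

theorem aug_mk [IsWeilAlgebra (A ⧸ I)] (a : A) :
    aug (A ⧸ I) (Ideal.Quotient.mkₐ ℝ I a) = aug A a :=
  DFunLike.congr_fun (algHom_eq_aug ((aug (A ⧸ I)).comp (Ideal.Quotient.mkₐ ℝ I))) a

theorem aug_algEquiv (σ : A ≃ₐ[ℝ] A) (a : A) : aug A (σ a) = aug A a :=
  DFunLike.congr_fun (algHom_eq_aug ((aug A).comp (σ : A →ₐ[ℝ] A))) a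

/-- Points of `A ⧸ I` lift smoothly to points of `A`. -/
theorem LocalCoordinates.exists_lift [IsWeilAlgebra (A ⧸ I)] (c : LocalCoordinates n R) :
    ∃ X : (R →ₐ[ℝ] A ⧸ I) → (R →ₐ[ℝ] A),
      (∀ y, aug (A ⧸ I) (y c.χ) ≠ 0 → (Ideal.Quotient.mkₐ ℝ I).comp (X y) = y) ∧
      ∀ (T : Type) [NormedAddCommGroup T] [NormedSpace ℝ T] (u : Set T) (y : T → R →ₐ[ℝ] A ⧸ I),
        (∀ t ∈ u, aug (A ⧸ I) (y t c.χ) ≠ 0) → (∀ f, SmoothFamilyOn u fun t => y t f) →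
        ∀ f, SmoothFamilyOn u fun t => X (y t) f := by
  obtain ⟨x, hx, hxs⟩ := c.exists_point A
  obtain ⟨lam, hlam⟩ := (Ideal.Quotient.mkₐ ℝ I).toLinearMap.exists_rightInverse_of_surjective
    (LinearMap.range_eq_top.2 (Ideal.Quotient.mkₐ_surjective ℝ I))
  have hlam' : ∀ b, Ideal.Quotient.mkₐ ℝ I (lam b) = b := LinearMap.congr_fun hlam
  have haug : ∀ b, aug A (lam b) = aug (A ⧸ I) b := fun b => by rw [← aug_mk (I := I), hlam']
  -- Coordinates of a point of `A` can be prescribed freely, so a merely linear section of `A → A ⧸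
  -- I` is enough; `a` is the nilpotent part of the lifted coordinates.
  let a : (R →ₐ[ℝ] A ⧸ I) → Fin n → A := fun y j =>
    lam (y (c.f j)) - algebraMap ℝ A (aug (A ⧸ I) (y (c.f j)))
  have ha : ∀ y j, a y j ∈ IsLocalRing.maximalIdeal A := fun y j => by
    rw [← aug_eq_zero_iff, map_sub, haug]
    simp
  refine ⟨fun y => x ((aug (A ⧸ I)).comp y) (a y), fun y hy => ?_,
    fun T _ _ u y hy hys f => ?_⟩
  · obtain ⟨h1, h2⟩ := hx ((aug (A ⧸ I)).comp y) (a y) hy (ha y)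
    refine c.algHom_ext (fun f => ?_) ?_ fun j => ?_
    · rw [AlgHom.comp_apply, aug_mk, h2]
      rfl
    · rw [AlgHom.comp_apply, aug_mk, h2]
      exact hy
    · rw [AlgHom.comp_apply, h1, AlgHom.comp_apply, add_sub_cancel, hlam']
  · refine hxs T u (fun t => (aug (A ⧸ I)).comp (y t)) (fun t => a (y t)) hy (fun t _ => ha (y t))
      (fun g => (hys g) (aug (A ⧸ I)).toLinearMap) (fun j => ?_) f
    exact ((hys _).map lam).sub ((hys _).map
      ((Algebra.linearMap ℝ A) ∘ₗ (aug (A ⧸ I)).toLinearMap))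

variable (I) in
/-- The derivation along `x` with given values at the coordinates. -/
def LocalCoordinates.coordDer (c : LocalCoordinates n R) (x : R →ₐ[ℝ] A) :
    (Fin n → I) →ₗ[ℝ] (R →ₗ[ℝ] A) where
  toFun w := ∑ j, LinearMap.mulLeft ℝ (w j : A) ∘ₗ x.toLinearMap ∘ₗ (c.D j).toLinearMap
  map_add' w w' := by
    ext f
    simp [LinearMap.sum_apply, add_mul, Finset.sum_add_distrib]
  map_smul' r w := by
    ext f
    simp [LinearMap.sum_apply, Finset.smul_sum]

theorem LocalCoordinates.coordDer_apply (c : LocalCoordinates n R) (x : R →ₐ[ℝ] A)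
    (w : Fin n → I) (f : R) : c.coordDer I x w f = ∑ j, (w j : A) * x (c.D j f) := by
  simp [LocalCoordinates.coordDer, LinearMap.sum_apply]

theorem LocalCoordinates.coordDer_mem (c : LocalCoordinates n R)
    (hsq : ∀ a ∈ I, ∀ b ∈ I, a * b = 0) {y : R →ₐ[ℝ] A ⧸ I} {x : R →ₐ[ℝ] A}
    (hx : (Ideal.Quotient.mkₐ ℝ I).comp x = y) (w : Fin n → I) :
    c.coordDer I x w ∈ idealDer I y := by
  refine mem_idealDer_of_leibniz hsq hx (fun f => ?_) fun f g => ?_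
  · rw [coordDer_apply]
    exact I.sum_mem fun j _ => I.mul_mem_right _ (w j).2
  · simp only [coordDer_apply, Finset.mul_sum, ← Finset.sum_add_distrib]
    refine Finset.sum_congr rfl fun j _ => ?_
    rw [Derivation.leibniz, map_add, smul_eq_mul, smul_eq_mul, map_mul, map_mul]
    ring

theorem LocalCoordinates.coordDer_apply_f (c : LocalCoordinates n R) {x : R →ₐ[ℝ] A}
    (hx : aug A (x c.χ) ≠ 0) (w : Fin n → I) (i : Fin n) : c.coordDer I x w (c.f i) = w i := by
  have hu : IsUnit (x c.χ) := by
    by_contra h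
    exact hx (aug_eq_zero_iff.2 ((IsLocalRing.mem_maximalIdeal _).2 h))
  have h : ∀ j, x (c.D j (c.f i)) = if j = i then 1 else 0 := fun j => by
    have := congrArg x (c.mul_sub_eq_zero j i)
    rw [map_mul, map_zero, hu.mul_right_eq_zero, map_sub, sub_eq_zero] at this
    rw [this]
    split_ifs <;> simp
  rw [coordDer_apply]
  simp [h]

/-- Apply the uniqueness of points with given coordinates to `x + E` and `x + E'`. -/
theorem LocalCoordinates.idealDer_ext [IsWeilAlgebra (A ⧸ I)] (c : LocalCoordinates n R)
    (hsq : ∀ a ∈ I, ∀ b ∈ I, a * b = 0) {y : R →ₐ[ℝ] A ⧸ I} (hy : aug (A ⧸ I) (y c.χ) ≠ 0)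
    {x : R →ₐ[ℝ] A} (hx : (Ideal.Quotient.mkₐ ℝ I).comp x = y) {E E' : R →ₗ[ℝ] A}
    (hE : E ∈ idealDer I y) (hE' : E' ∈ idealDer I y) (h : ∀ j, E (c.f j) = E' (c.f j)) :
    E = E' := by
  obtain ⟨x₁, hx₁, h₁⟩ := exists_point_add hsq hx hE
  obtain ⟨x₂, hx₂, h₂⟩ := exists_point_add hsq hx hE'
  have haug : ∀ f, aug A (x₁ f) = aug (A ⧸ I) (y f) := fun f => by
    rw [← hx₁, AlgHom.comp_apply, aug_mk]
  have haug' : ∀ f, aug A (x₂ f) = aug (A ⧸ I) (y f) := fun f => by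
    rw [← hx₂, AlgHom.comp_apply, aug_mk]
  have := c.algHom_ext (x := x₁) (x' := x₂) (fun f => by rw [haug, haug'])
    (by rwa [haug]) fun j => by rw [h₁, h₂, h]
  ext f
  have := DFunLike.congr_fun this f
  rw [h₁, h₂] at this
  exact add_left_cancel this

/-- The derivations of `A` with values in `I`, together with `r` parameters, as derivations along
`x`, in coordinates. -/
def LocalCoordinates.coordMap {r : ℕ} (c : LocalCoordinates n R)
    (ι : EuclideanSpace ℝ (Fin r) →ₗ[ℝ] (Fin n → I)) (x : R →ₐ[ℝ] A) :
    idealDer I (Ideal.Quotient.mkₐ ℝ I) × EuclideanSpace ℝ (Fin r) →ₗ[ℝ] (Fin n → I) :=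
  LinearMap.coprod
    (LinearMap.pi fun j => (LinearMap.applyₗ (x (c.f j)) ∘ₗ Submodule.subtype _).codRestrict
      (I.restrictScalars ℝ) fun X => X.2.1 _) ι

theorem LocalCoordinates.coordMap_apply {r : ℕ} (c : LocalCoordinates n R)
    (ι : EuclideanSpace ℝ (Fin r) →ₗ[ℝ] (Fin n → I)) (x : R →ₐ[ℝ] A)
    (X : idealDer I (Ideal.Quotient.mkₐ ℝ I)) (w : EuclideanSpace ℝ (Fin r)) (j : Fin n) :
    (c.coordMap ι x (X, w) j : A) = X.1 (x (c.f j)) + ι w j := rfl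

theorem LocalCoordinates.smoothFamilyOn_coordMap {r : ℕ} (c : LocalCoordinates n R)
    (ι : EuclideanSpace ℝ (Fin r) →ₗ[ℝ] (Fin n → I)) {T : Type*} [NormedAddCommGroup T]
    [NormedSpace ℝ T] {u : Set T} {x : T → R →ₐ[ℝ] A}
    (hx : ∀ f, SmoothFamilyOn u fun t => x t f) :
    SmoothFamilyOn u fun t => c.coordMap ι (x t) := by
  refine SmoothFamilyOn.of_apply
    (V := idealDer I (Ideal.Quotient.mkₐ ℝ I) × EuclideanSpace ℝ (Fin r)) (W := Fin n → I)
    fun v => SmoothFamilyOn.pi (ι := Fin n) (V := I) fun j => ?_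
  refine SmoothFamilyOn.of_injective (L := (I.restrictScalars ℝ).subtype)
    (Subtype.val_injective) ?_
  exact ((hx (c.f j)).map v.1.1).add (SmoothFamilyOn.const _)

/-- For surjective `x` the map `X ↦ X ∘ x` is injective on derivations of `A` into `I`, also when
read on coordinates. The map `ι` parametrises a complement of its image in `Iⁿ`, chosen at this one
point. -/
theorem LocalCoordinates.exists_coordMap_bijective (c : LocalCoordinates n R) {x : R →ₐ[ℝ] A}
    (h : Function.Surjective x) [IsWeilAlgebra (A ⧸ I)] (hsq : ∀ a ∈ I, ∀ b ∈ I, a * b = 0)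
    (hχ : aug A (x c.χ) ≠ 0) :
    ∃ (r : ℕ) (ι : EuclideanSpace ℝ (Fin r) →ₗ[ℝ] (Fin n → I)),
      Function.Bijective (c.coordMap ι x) := by
  let C₀ : idealDer I (Ideal.Quotient.mkₐ ℝ I) →ₗ[ℝ] (Fin n → I) :=
    LinearMap.pi fun j => (LinearMap.applyₗ (x (c.f j)) ∘ₗ Submodule.subtype _).codRestrict
      (I.restrictScalars ℝ) fun X => X.2.1 _
  have hC₀ : ∀ X j, (C₀ X j : A) = X.1 (x (c.f j)) := fun X j => rfl
  have hinj : Function.Injective C₀ := by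
    refine LinearMap.injective_of_forall (idealDer I (Ideal.Quotient.mkₐ ℝ I)) (Fin n → I)
      fun X hX => ?_
    have h0 : X.1 ∘ₗ x.toLinearMap = 0 := by
      refine c.idealDer_ext hsq (y := (Ideal.Quotient.mkₐ ℝ I).comp x)
        (by rwa [AlgHom.comp_apply, aug_mk]) rfl ⟨fun f => X.2.1 _, fun f g a b ha hb => ?_⟩
        (zero_mem _) fun j => ?_
      · have := X.2.2 (x f) (x g) a b ha hb
        rw [← map_mul x] at this
        exact this
      · have := congrArg Subtype.val (congrFun hX j)
        exact this
    apply Subtype.ext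
    ext a
    obtain ⟨f, rfl⟩ := h a
    exact LinearMap.congr_fun h0 f
  obtain ⟨W, hW⟩ := (LinearMap.range C₀).exists_isCompl
  let e : EuclideanSpace ℝ (Fin (Module.finrank ℝ W)) ≃ₗ[ℝ] W :=
    LinearEquiv.ofFinrankEq _ _ (by simp)
  refine ⟨_, W.subtype ∘ₗ e.toLinearMap, ?_, ?_⟩
  · refine LinearMap.injective_of_forall (idealDer I (Ideal.Quotient.mkₐ ℝ I) ×
      EuclideanSpace ℝ (Fin (Module.finrank ℝ W))) (Fin n → I) ?_
    rintro ⟨X, w⟩ hXw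
    have h1 : C₀ X + (e w : Fin n → I) = 0 := hXw
    have h2 : C₀ X = 0 := by
      have : C₀ X ∈ W := by
        rw [eq_neg_of_add_eq_zero_left h1]
        exact W.neg_mem (e w).2
      have := hW.disjoint.le_bot ⟨⟨X, rfl⟩, this⟩
      exact this
    rw [h2, zero_add] at h1
    have h3 : w = 0 := e.injective (by rw [map_zero]; exact Subtype.ext h1)
    have h4 : X = 0 := hinj (by rw [h2, map_zero])
    rw [h3, h4]
    rfl
  · intro v
    obtain ⟨_, ⟨X, rfl⟩, w, hw, hv⟩ := Submodule.mem_sup.1 (hW.sup_eq_top ▸ Submodule.mem_top : v ∈ _)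
    refine ⟨(X, e.symm ⟨w, hw⟩), ?_⟩
    rw [← hv]
    change C₀ X + (e (e.symm ⟨w, hw⟩) : Fin n → I) = _
    rw [LinearEquiv.apply_symm_apply]

/-- The inverse of `coordMap`. -/
def LocalCoordinates.coordInv {r : ℕ} (c : LocalCoordinates n R)
    (ι : EuclideanSpace ℝ (Fin r) →ₗ[ℝ] (Fin n → I)) (x : R →ₐ[ℝ] A) :
    (Fin n → I) →ₗ[ℝ] idealDer I (Ideal.Quotient.mkₐ ℝ I) × EuclideanSpace ℝ (Fin r) :=
  linInv (V := idealDer I (Ideal.Quotient.mkₐ ℝ I) × EuclideanSpace ℝ (Fin r)) (W := Fin n → I)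
    (c.coordMap ι x)

/-- The coordinates of a derivation with values in `I`. -/
def LocalCoordinates.values (c : LocalCoordinates n R) {y : R →ₐ[ℝ] A ⧸ I} (F : idealDer I y) :
    Fin n → I := fun j => ⟨F.1 (c.f j), F.2.1 _⟩

variable [IsWeilAlgebra (A ⧸ I)] {hI : IsInvariantIdeal I} {r : ℕ} {c : LocalCoordinates n R}
  {ι : EuclideanSpace ℝ (Fin r) →ₗ[ℝ] (Fin n → I)} {y : R →ₐ[ℝ] A ⧸ I} {x : R →ₐ[ℝ] A}

/-- A derivation that vanishes on `ker y` has the form `δ ∘ x` with `δ` valued in `I`; its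
coordinates then lie in both summands. -/
theorem LocalCoordinates.eq_zero_of_coordDer_vanish
    (hsq : ∀ a ∈ I, ∀ b ∈ I, a * b = 0) (hχ : aug (A ⧸ I) (y c.χ) ≠ 0)
    (hx : (Ideal.Quotient.mkₐ ℝ I).comp x = y) (hxs : Function.Surjective x)
    (h : Function.Bijective (c.coordMap ι x)) {w : EuclideanSpace ℝ (Fin r)}
    (hw : ∀ f, y f = 0 → c.coordDer I x (ι w) f = 0) : w = 0 := by
  have hχ' : aug A (x c.χ) ≠ 0 := by
    rw [← hx, AlgHom.comp_apply, aug_mk] at hχ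
    exact hχ
  have hE := c.coordDer_mem hsq hx (ι w)
  obtain ⟨δ, hδ⟩ := exists_derivation_of_vanish hxs _ (idealDer_leibniz hx hE) fun f hf =>
    hw f (by rw [← hx, AlgHom.comp_apply, hf, map_zero])
  have hδI : ∀ a, δ a ∈ I := fun a => by
    obtain ⟨f, rfl⟩ := hxs a
    rw [hδ]
    exact hE.1 f
  let X : idealDer I (Ideal.Quotient.mkₐ ℝ I) := ⟨δ.toLinearMap,
    mem_idealDer_of_leibniz hsq (x := AlgHom.id ℝ A) (AlgHom.comp_id _) hδI δ.leibniz⟩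
  have h0 : c.coordMap ι x (-X, w) = c.coordMap ι x 0 := by
    rw [map_zero]
    funext j
    apply Subtype.ext
    rw [coordMap_apply]
    change - δ (x (c.f j)) + _ = 0
    rw [hδ, c.coordDer_apply_f hχ', neg_add_cancel]
  exact congrArg Prod.snd (h.1 h0)

/-- Split `F` as `X ∘ x` plus a derivation in the complement. By exactness `X` kills `I`, so on `ker
y` only the second part is left. -/
theorem AffineSequenceExact.eq_coordDer_of_bijective (hex : AffineSequenceExact I hI)
    (hsq : ∀ a ∈ I, ∀ b ∈ I, a * b = 0) (hχ : aug (A ⧸ I) (y c.χ) ≠ 0)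
    (hx : (Ideal.Quotient.mkₐ ℝ I).comp x = y) (h : Function.Bijective (c.coordMap ι x))
    (F : idealDer I y) {f : R} (hf : y f = 0) :
    F.1 f = c.coordDer I x (ι (c.coordInv ι x (c.values F)).2) f := by
  have hχ' : aug A (x c.χ) ≠ 0 := by
    rw [← hx, AlgHom.comp_apply, aug_mk] at hχ
    exact hχ
  obtain ⟨X, w, hXw⟩ : ∃ X w, c.coordInv ι x (c.values F) = (X, w) := ⟨_, _, rfl⟩
  have hv : c.coordMap ι x (X, w) = c.values F := by
    rw [← hXw]
    exact apply_linInv (V := idealDer I (Ideal.Quotient.mkₐ ℝ I) × EuclideanSpace ℝ (Fin r))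
      (W := Fin n → I) h _
  have hl : ∀ a b, X.1 (a * b) = a * X.1 b + b * X.1 a := fun a b => X.2.2 a b a b rfl rfl
  rw [hXw]
  have hXE : X.1 ∘ₗ x.toLinearMap ∈ idealDer I y :=
    mem_idealDer_of_leibniz hsq hx (fun f => X.2.1 _) fun f g => by
      have := hl (x f) (x g)
      rw [← map_mul x] at this
      exact this
  have key : F.1 = X.1 ∘ₗ x.toLinearMap + c.coordDer I x (ι w) :=
    c.idealDer_ext hsq hχ hx F.2 (add_mem hXE (c.coordDer_mem hsq hx (ι w))) fun j => by
      rw [LinearMap.add_apply, c.coordDer_apply_f hχ']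
      exact (congrArg Subtype.val (congrFun hv j)).symm
  have h0 : X.1 (x f) = 0 :=
    hex.derivation_apply_eq_zero (δ := Derivation.mk' X.1 hl) (fun a => X.2.1 a)
      (mkₐ_eq_zero_iff.1 (by rw [← AlgHom.comp_apply, hx, hf]))
  rw [key, LinearMap.add_apply, LinearMap.comp_apply, AlgHom.toLinearMap_apply, h0, zero_add]

end CoordinateDerivations

/-! ### Local sections of the quotient by automorphisms -/

section LocalSections

/-- A derivation of an algebra as a linear endomorphism. -/
def derToEnd (A : Type*) [CommRing A] [Algebra ℝ A] : Derivation ℝ A A →ₗ[ℝ] Module.End ℝ A where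
  toFun D := D.toLinearMap
  map_add' _ _ := rfl
  map_smul' _ _ := rfl

theorem derToEnd_injective (A : Type*) [CommRing A] [Algebra ℝ A] :
    Function.Injective (derToEnd A) :=
  fun _ _ h => Derivation.ext fun a => LinearMap.congr_fun h a

instance Derivation.finite_of_finite {A : Type*} [CommRing A] [Algebra ℝ A] [Module.Finite ℝ A] :
    Module.Finite ℝ (Derivation ℝ A A) :=
  Module.Finite.of_injective (derToEnd A) (derToEnd_injective A)

/-- Choosing lifts on a basis makes the lift linear, so that it preserves smooth families. -/
theorem exists_linear_derivation_lift {A : Type*} [CommRing A] [Algebra ℝ A] [Module.Finite ℝ A]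
    {I : Ideal A} (hI : IsInvariantIdeal I) (hs : Function.Surjective (autMap I hI)) :
    ∃ κ : Derivation ℝ (A ⧸ I) (A ⧸ I) →ₗ[ℝ] Derivation ℝ A A,
      ∀ δ a, Ideal.Quotient.mkₐ ℝ I (κ δ a) = δ (Ideal.Quotient.mkₐ ℝ I a) := by
  let e := Module.finBasis ℝ (Derivation ℝ (A ⧸ I) (A ⧸ I))
  choose D hD using exists_derivation_lift hI hs
  refine ⟨e.constr ℝ fun i => D (e i), fun δ a => ?_⟩
  let L₁ : Derivation ℝ (A ⧸ I) (A ⧸ I) →ₗ[ℝ] A ⧸ I :=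
    (Ideal.Quotient.mkₐ ℝ I).toLinearMap ∘ₗ LinearMap.applyₗ a ∘ₗ derToEnd A ∘ₗ
      e.constr ℝ fun i => D (e i)
  let L₂ : Derivation ℝ (A ⧸ I) (A ⧸ I) →ₗ[ℝ] A ⧸ I :=
    LinearMap.applyₗ (Ideal.Quotient.mkₐ ℝ I a) ∘ₗ derToEnd (A ⧸ I)
  have h : L₁ = L₂ := e.ext fun i => by
    change Ideal.Quotient.mkₐ ℝ I (e.constr ℝ (fun i => D (e i)) (e i) a) = _
    rw [e.constr_basis, hD]
    rfl
  exact LinearMap.congr_fun h δ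

variable {n : ℕ} {M : Type u} [TopologicalSpace M] [ChartedSpace (EuclideanSpace ℝ (Fin n)) M]

theorem RegularPoint.isPlot_iff {A : Type v} [CommRing A] [Algebra ℝ A] {k : ℕ}
    {x : EuclideanSpace ℝ (Fin k) → RegularPoint n M A} :
    IsPlot x ↔ ∀ f, SmoothFamilyOn Set.univ fun t => (x t).1 f := by
  refine Iff.trans DiffeologicalSpace.isPlot_iInf_iff (forall_congr' fun f => ?_)
  refine Iff.trans DiffeologicalSpace.isPlot_iInf_iff (forall_congr' fun l => ?_)
  exact Iff.trans (isPlot_iff_contDiff (p := fun t => l ((x t).1 f))) contDiffOn_univ.symm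

theorem smoothFamily_iff {A : Type v} [CommRing A] [Algebra ℝ A] {k : ℕ}
    {g : EuclideanSpace ℝ (Fin k) → A} : SmoothFamily g ↔ SmoothFamilyOn Set.univ g :=
  forall_congr' fun _ => contDiffOn_univ.symm

theorem RegularPoint.dSmooth_map {A : Type v} [CommRing A] [Algebra ℝ A] (σ : A ≃ₐ[ℝ] A) :
    DSmooth (RegularPoint.map σ : RegularPoint n M A → RegularPoint n M A) := fun _ _ hp =>
  RegularPoint.isPlot_iff.2 fun f => (RegularPoint.isPlot_iff.1 hp f).map σ.toLinearMap

theorem RegularPoint.dSmooth_proj {A : Type v} [CommRing A] [Algebra ℝ A] (I : Ideal A) :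
    DSmooth (RegularPoint.proj I : RegularPoint n M A → RegularPoint n M (A ⧸ I)) := fun _ _ hp =>
  RegularPoint.isPlot_iff.2 fun f =>
    (RegularPoint.isPlot_iff.1 hp f).map (Ideal.Quotient.mkₐ ℝ I).toLinearMap

/-- Near a regular point `y₀`, the quotient by automorphisms has a smooth section. -/
theorem RegularPoint.exists_local_section {B : Type v} [CommRing B] [Algebra ℝ B]
    [IsWeilAlgebra B] (y₀ : RegularPoint n M B) {χ : SmoothFn n M} (hχ : aug B (y₀.1 χ) ≠ 0) :
    ∃ (N : Set (RegularPoint n M B)) (X : RegularPoint n M B → Derivation ℝ B B)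
      (lam : B →ₗ[ℝ] SmoothFn n M), y₀ ∈ N ∧
      (∀ y ∈ N, aug B (y.1 χ) ≠ 0 ∧ Function.Bijective (y.1.toLinearMap ∘ₗ lam)) ∧
      (∀ y ∈ N, ∀ y' ∈ N, y.jet = y'.jet → y.map (expAut (X y)) = y'.map (expAut (X y'))) ∧
      ∀ {k : ℕ} (y : EuclideanSpace ℝ (Fin k) → RegularPoint n M B), IsPlot y →
        IsOpen (y ⁻¹' N) ∧ SmoothFamilyOn (y ⁻¹' N) fun t => X (y t) := by
  obtain ⟨P, X, hP, hX, hτ⟩ := exists_automorphism_slice B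
  obtain ⟨lam, hlam⟩ := y₀.1.toLinearMap.exists_rightInverse_of_surjective
    (LinearMap.range_eq_top.2 y₀.2)
  -- As `lam` is a section of `y₀`, `G y₀ = 1`; moreover `G (τ ∘ y) = τ ∘ G y`, so the slice for
  -- left multiplication yields the normal form.
  let G : RegularPoint n M B → Module.End ℝ B := fun y => y.1.toLinearMap ∘ₗ lam
  have hG₀ : G y₀ = 1 := hlam
  refine ⟨{y | (aug B (y.1 χ) ≠ 0 ∧ Function.Bijective (G y)) ∧ G y ∈ P}, fun y => -X (G y), lam,
    ⟨⟨hχ, by rw [hG₀]; exact Function.bijective_id⟩, by rwa [hG₀]⟩, fun y hy => hy.1,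
    fun y hy y' hy' h => ?_, fun {k} y hy => ?_⟩
  · obtain ⟨τ, hτy⟩ := RegularPoint.jet_eq_iff.1 h
    have hG : G y' = τ.toLinearMap ∘ₗ G y := LinearMap.ext fun b => hτy _
    apply Subtype.ext
    ext f
    change expAut (-X (G y)) (y.1 f) = expAut (-X (G y')) (y'.1 f)
    rw [hτy, hG, hτ τ (G y) hy.2 (hG ▸ hy'.2)]
  · have hys := RegularPoint.isPlot_iff.1 hy
    have hGs : SmoothFamilyOn Set.univ fun t => G (y t) :=
      SmoothFamilyOn.of_apply fun b => hys (lam b)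
    have h1 : IsOpen {t | aug B ((y t).1 χ) ≠ 0} :=
      isOpen_ne.preimage (contDiffOn_univ.1 (hys χ (aug B).toLinearMap)).continuous
    have h2 : IsOpen {t | Function.Bijective (G (y t))} := by
      refine isOpen_iff_mem_nhds.2 fun t ht => ?_
      obtain ⟨s, hs, hts, -, hb, -⟩ := hGs.bijective_and_linInv isOpen_univ (Set.mem_univ t) ht
      exact Filter.mem_of_superset (hs.mem_nhds hts) hb
    obtain ⟨h3, h4⟩ := hX _ _ _ hGs isOpen_univ
    rw [Set.univ_inter] at h3 h4
    refine ⟨(h1.inter h2).inter h3, ?_⟩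
    exact SmoothFamilyOn.neg (SmoothFamilyOn.of_injective (derToEnd_injective B)
      (h4.mono fun t ht => ht.2))

variable {A : Type v} [CommRing A] [Algebra ℝ A] [IsWeilAlgebra A] {I : Ideal A}

/-- A smooth family of null vectors along a smooth family of points of `A ⧸ I` lifts to a smooth
family of derivations of `A`. -/
theorem exists_smooth_derivation_lift
    {κ : Derivation ℝ (A ⧸ I) (A ⧸ I) →ₗ[ℝ] Derivation ℝ A A}
    (hκ : ∀ δ a, Ideal.Quotient.mkₐ ℝ I (κ δ a) = δ (Ideal.Quotient.mkₐ ℝ I a))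
    {lam : A ⧸ I →ₗ[ℝ] SmoothFn n M} {k : ℕ}
    {y : EuclideanSpace ℝ (Fin k) → RegularPoint n M (A ⧸ I)} (hy : IsPlot y)
    (hlam : ∀ t, Function.Bijective ((y t).1.toLinearMap ∘ₗ lam))
    {E : EuclideanSpace ℝ (Fin k) → SmoothFn n M →ₗ[ℝ] A ⧸ I}
    (hE : ∀ f, SmoothFamilyOn Set.univ fun t => E t f)
    (hEl : ∀ t f g, E t (f * g) = (y t).1 f * E t g + (y t).1 g * E t f)
    (hE0 : ∀ t f, (y t).1 f = 0 → E t f = 0) :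
    ∃ δ : EuclideanSpace ℝ (Fin k) → Derivation ℝ A A,
      (SmoothFamilyOn Set.univ fun t => (δ t).toLinearMap) ∧
      ∀ t f a, Ideal.Quotient.mkₐ ℝ I a = (y t).1 f → Ideal.Quotient.mkₐ ℝ I (δ t a) = E t f := by
  choose δ hδ using fun t => exists_derivation_of_vanish (y t).2 (E t) (hEl t) (hE0 t)
  let G : EuclideanSpace ℝ (Fin k) → Module.End ℝ (A ⧸ I) := fun t => (y t).1.toLinearMap ∘ₗ lam
  have hGs : SmoothFamilyOn Set.univ G :=
    SmoothFamilyOn.of_apply fun b => RegularPoint.isPlot_iff.1 hy (lam b)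
  have hJ : SmoothFamilyOn Set.univ fun t => linInv (G t) := SmoothFamilyOn.of_local fun t _ => by
    obtain ⟨s, hs, hts, -, -, h⟩ := hGs.bijective_and_linInv isOpen_univ (Set.mem_univ t) (hlam t)
    exact ⟨s, hs, hts, h⟩
  have hEs : SmoothFamilyOn Set.univ fun t => E t ∘ₗ lam :=
    SmoothFamilyOn.of_apply fun b => hE (lam b)
  -- Explicitly `δ t = E t ∘ lam ∘ (G t)⁻¹`.
  have hδs : SmoothFamilyOn Set.univ δ := by
    refine SmoothFamilyOn.of_injective (derToEnd_injective (A ⧸ I))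
      ((hJ.comp hEs).congr fun t _ => LinearMap.ext fun b => ?_)
    have h1 : (y t).1 (lam (linInv (G t) b)) = b := apply_linInv (hlam t) b
    change δ t b = E t (lam (linInv (G t) b))
    rw [← hδ, h1]
  refine ⟨fun t => κ (δ t), (hδs.map κ).map (derToEnd A), fun t f a ha => ?_⟩
  rw [hκ, ha, hδ]

end LocalSections

section PointLifts

/-- Regular points of `A ⧸ I` lift to regular points of `A`. -/
theorem exists_regularPoint_lift {n : ℕ} {A : Type v} [CommRing A] [Algebra ℝ A]
    [IsWeilAlgebra A] {I : Ideal A}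
    {M : Type u} [TopologicalSpace M] [ChartedSpace (EuclideanSpace ℝ (Fin n)) M]
    [IsManifold (𝓡 n) ∞ M] [T2Space M] [SecondCountableTopology M]
    (hm : I ≤ IsLocalRing.maximalIdeal A ^ 2)
    (y : RegularPoint n M (A ⧸ I)) : ∃ x : RegularPoint n M A, x.proj I = y := by
  have : IsWeilAlgebra (A ⧸ I) := isWeilAlgebra_quotient (hm.trans (Ideal.pow_le_self two_ne_zero))
  obtain ⟨c, hc⟩ := exists_localCoordinates ((aug (A ⧸ I)).comp y.1)
  obtain ⟨X, hX, -⟩ := c.exists_lift (I := I)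
  have h := hX y.1 hc
  exact ⟨⟨X y.1, surjective_of_mk_comp hm (by rw [h]; exact y.2)⟩, RegularPoint.proj_eq_iff.2 h⟩

end PointLifts

/-! ### Charts of the affine bundle -/

section BundleCharts

variable (n : ℕ) (M : Type u) [TopologicalSpace M] [ChartedSpace (EuclideanSpace ℝ (Fin n)) M]
variable {A : Type v} [CommRing A] [Algebra ℝ A] (I : Ideal A)

/-- The data of a local trivialisation of `φ^J`, on the level of regular points: an open set `N` of
regular points of `A ⧸ I`, a normal form `s y` of `y` under automorphisms, a point `x (s y)` of `A`
over it, and a linear parametrisation `E (s y)` of a complement of the null derivations along `s y`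
in the derivations with values in `I`. -/
structure BundleChart where
  N : Set (RegularPoint n M (A ⧸ I))
  r : ℕ
  s : RegularPoint n M (A ⧸ I) → RegularPoint n M (A ⧸ I)
  x : RegularPoint n M (A ⧸ I) → RegularPoint n M A
  E : RegularPoint n M (A ⧸ I) → EuclideanSpace ℝ (Fin r) →ₗ[ℝ] (SmoothFn n M →ₗ[ℝ] A)
  isOpen : ∀ {k : ℕ} (y : EuclideanSpace ℝ (Fin k) → RegularPoint n M (A ⧸ I)), IsPlot y →
    IsOpen (y ⁻¹' N)
  s_eq : ∀ y ∈ N, ∀ y' ∈ N, y.jet = y'.jet → s y = s y'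
  jet_s : ∀ y ∈ N, (s y).jet = y.jet
  proj_x : ∀ y ∈ N, (x (s y)).proj I = s y
  E_mem : ∀ y ∈ N, ∀ w, E (s y) w ∈ idealDer I (s y).1
  E_injective : ∀ y ∈ N, ∀ w, (∀ f, (s y).1 f = 0 → E (s y) w f = 0) → w = 0
  isPlot_x : ∀ {k : ℕ} (y : EuclideanSpace ℝ (Fin k) → RegularPoint n M (A ⧸ I)), IsPlot y →
    (∀ t, y t ∈ N) → IsPlot fun t => x (s (y t))
  smooth_E : ∀ {k : ℕ} (y : EuclideanSpace ℝ (Fin k) → RegularPoint n M (A ⧸ I)), IsPlot y →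
    (∀ t, y t ∈ N) → ∀ w : EuclideanSpace ℝ (Fin k) → EuclideanSpace ℝ (Fin r), ContDiff ℝ ∞ w →
    ∀ f, SmoothFamilyOn Set.univ fun t => E (s (y t)) (w t) f
  exists_coordinates : ∀ {k : ℕ} (y : EuclideanSpace ℝ (Fin k) → RegularPoint n M (A ⧸ I)),
    IsPlot y → (∀ t, y t ∈ N) → ∀ F : ∀ t, idealDer I (s (y t)).1,
    (∀ f, SmoothFamilyOn Set.univ fun t => (F t).1 f) →
    ∃ w : EuclideanSpace ℝ (Fin k) → EuclideanSpace ℝ (Fin r), ContDiff ℝ ∞ w ∧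
      ∀ t f, (s (y t)).1 f = 0 → (F t).1 f = E (s (y t)) (w t) f
  exists_normalise : ∀ {k : ℕ} (y : EuclideanSpace ℝ (Fin k) → RegularPoint n M (A ⧸ I)),
    IsPlot y → (∀ t, y t ∈ N) → ∃ ψ : EuclideanSpace ℝ (Fin k) → A ≃ₐ[ℝ] A,
      (∀ t f a, Ideal.Quotient.mkₐ ℝ I a = (y t).1 f →
        Ideal.Quotient.mkₐ ℝ I (ψ t a) = (s (y t)).1 f) ∧
      ∀ g, SmoothFamilyOn Set.univ g → SmoothFamilyOn Set.univ fun t => ψ t (g t)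
  exists_derivation : ∀ {k : ℕ} (y : EuclideanSpace ℝ (Fin k) → RegularPoint n M (A ⧸ I)),
    IsPlot y → (∀ t, y t ∈ N) → ∀ F : EuclideanSpace ℝ (Fin k) → SmoothFn n M →ₗ[ℝ] A ⧸ I,
    (∀ f, SmoothFamilyOn Set.univ fun t => F t f) →
    (∀ t f g, F t (f * g) = (y t).1 f * F t g + (y t).1 g * F t f) →
    (∀ t f, (y t).1 f = 0 → F t f = 0) →
    ∃ δ : EuclideanSpace ℝ (Fin k) → Derivation ℝ A A,
      (SmoothFamilyOn Set.univ fun t => (δ t).toLinearMap) ∧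
      ∀ t f a, Ideal.Quotient.mkₐ ℝ I a = (y t).1 f → Ideal.Quotient.mkₐ ℝ I (δ t a) = F t f

variable {n M I} [IsManifold (𝓡 n) ∞ M] [T2Space M] [SecondCountableTopology M]
  [IsWeilAlgebra A] [IsWeilAlgebra (A ⧸ I)]

/-- The slice at `y₀` provides the normal form `s`, the coordinate lift provides `x`, and the
complement chosen at the normal form of `y₀` provides `E`. -/
theorem AffineSequenceExact.exists_bundleChart {hI : IsInvariantIdeal I}
    (hex : AffineSequenceExact I hI) (hsq : ∀ a ∈ I, ∀ b ∈ I, a * b = 0)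
    (hm : I ≤ IsLocalRing.maximalIdeal A ^ 2) (y₀ : RegularPoint n M (A ⧸ I)) :
    ∃ C : BundleChart n M I, y₀ ∈ C.N := by
  obtain ⟨c, hc⟩ := exists_localCoordinates ((aug (A ⧸ I)).comp y₀.1)
  obtain ⟨X, hX, hXs⟩ := c.exists_lift (I := I)
  obtain ⟨N, Y, lam, hy₀, hN, hNs, hNo⟩ := y₀.exists_local_section hc
  obtain ⟨κ, hκ⟩ := exists_linear_derivation_lift hI hex.2
  let s : RegularPoint n M (A ⧸ I) → RegularPoint n M (A ⧸ I) := fun y => y.map (expAut (Y y))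
  have hs : ∀ y f, (s y).1 f = expAut (Y y) (y.1 f) := fun _ _ => rfl
  have hsχ : ∀ y ∈ N, aug (A ⧸ I) ((s y).1 c.χ) ≠ 0 := fun y hy => by
    rw [hs, aug_algEquiv]
    exact (hN y hy).1
  have hXp : ∀ y ∈ N, (Ideal.Quotient.mkₐ ℝ I).comp (X (s y).1) = (s y).1 := fun y hy =>
    hX _ (hsχ y hy)
  have hXsurj : ∀ z : RegularPoint n M (A ⧸ I), (Ideal.Quotient.mkₐ ℝ I).comp (X z.1) = z.1 →
      Function.Surjective (X z.1) := fun z hz => surjective_of_mk_comp hm (by rw [hz]; exact z.2)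
  -- Where `X z` fails to lift `z`, the lift at `y₀` serves as a default regular point.
  have hx : ∀ z : RegularPoint n M (A ⧸ I), ∃ x : RegularPoint n M A,
      (Ideal.Quotient.mkₐ ℝ I).comp (X z.1) = z.1 → x.1 = X z.1 := fun z => by
    by_cases hz : (Ideal.Quotient.mkₐ ℝ I).comp (X z.1) = z.1
    · exact ⟨⟨X z.1, hXsurj z hz⟩, fun _ => rfl⟩
    · exact ⟨⟨X (s y₀).1, hXsurj _ (hXp y₀ hy₀)⟩, fun h => absurd h hz⟩
  choose x hx using hx
  have hxs : ∀ y ∈ N, (x (s y)).1 = X (s y).1 := fun y hy => hx _ (hXp y hy)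
  obtain ⟨r, ι, hι⟩ := c.exists_coordMap_bijective (hXsurj _ (hXp y₀ hy₀)) hsq (by
    have := hsχ y₀ hy₀
    rw [← hXp y₀ hy₀, AlgHom.comp_apply, aug_mk] at this
    exact this)
  have hss : ∀ {k : ℕ} (y : EuclideanSpace ℝ (Fin k) → RegularPoint n M (A ⧸ I)), IsPlot y →
      ∀ f, SmoothFamilyOn (y ⁻¹' N) fun t => (s (y t)).1 f := fun y hy f =>
    SmoothFamilyOn.expAut ((hNo y hy).2.map (derToEnd (A ⧸ I)))
      ((RegularPoint.isPlot_iff.1 hy f).mono (Set.subset_univ _))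
  have hXss : ∀ {k : ℕ} (y : EuclideanSpace ℝ (Fin k) → RegularPoint n M (A ⧸ I)), IsPlot y →
      ∀ f, SmoothFamilyOn (y ⁻¹' N) fun t => X (s (y t)).1 f := fun y hy f =>
    hXs _ _ (fun t => (s (y t)).1) (fun t ht => hsχ _ ht) (hss y hy) f
  have huniv : ∀ {k : ℕ} {N' : Set (RegularPoint n M (A ⧸ I))}
      {y : EuclideanSpace ℝ (Fin k) → RegularPoint n M (A ⧸ I)},
      (∀ t, y t ∈ N') → y ⁻¹' N' = Set.univ := fun h => Set.eq_univ_of_forall h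
  have hCs : ∀ {k : ℕ} (y : EuclideanSpace ℝ (Fin k) → RegularPoint n M (A ⧸ I)), IsPlot y →
      SmoothFamilyOn (y ⁻¹' N) fun t => c.coordMap ι (X (s (y t)).1) := fun y hy =>
    c.smoothFamilyOn_coordMap ι (hXss y hy)
  refine ⟨{
    -- The domain is restricted to points where the complement chosen at `y₀` is still one, an open
    -- condition.
    N := {y | y ∈ N ∧ Function.Bijective (c.coordMap ι (X (s y).1))}
    r := r
    s := s
    x := x
    E := fun z => c.coordDer I (X z.1) ∘ₗ ι
    isOpen := fun {k} y hy => ?_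
    s_eq := fun y hy y' hy' h => hNs y hy.1 y' hy'.1 h
    jet_s := fun y _ => y.jet_map _
    proj_x := fun y hy => by rw [RegularPoint.proj_eq_iff, hxs y hy.1, hXp y hy.1]
    E_mem := fun y hy w => c.coordDer_mem hsq (hXp y hy.1) _
    E_injective := fun y hy w hw => LocalCoordinates.eq_zero_of_coordDer_vanish hsq (hsχ y hy.1)
      (hXp y hy.1) (hXsurj _ (hXp y hy.1)) hy.2 hw
    isPlot_x := fun y hy hyN => RegularPoint.isPlot_iff.2 fun f => ?_
    smooth_E := fun y hy hyN w hw f => ?_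
    exists_coordinates := fun {k} y hy hyN F hF => ?_
    exists_normalise := fun y hy hyN => ?_
    exists_derivation := fun y hy hyN F hF hFl hF0 =>
      exists_smooth_derivation_lift hκ hy (fun t => (hN _ (hyN t).1).2) hF hFl hF0 }, hy₀, hι⟩
  · refine isOpen_iff_mem_nhds.2 fun t ht => ?_
    obtain ⟨u, hu, htu, huN, hb, -⟩ := SmoothFamilyOn.bijective_and_linInv
      (V := idealDer I (Ideal.Quotient.mkₐ ℝ I) × EuclideanSpace ℝ (Fin r)) (W := Fin n → I)
      (hCs y hy) (hNo y hy).1 ht.1 ht.2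
    exact Filter.mem_of_superset (hu.mem_nhds htu) fun t' ht' => ⟨huN ht', hb t' ht'⟩
  · have h := hXss y hy f
    rw [huniv fun t => (hyN t).1] at h
    exact h.congr fun t _ => by rw [hxs _ (hyN t).1]
  · simp only [LinearMap.comp_apply, LocalCoordinates.coordDer_apply]
    refine SmoothFamilyOn.sum fun j _ => ?_
    have h := hXss y hy (c.D j f)
    rw [huniv fun t => (hyN t).1] at h
    have hw' : SmoothFamilyOn Set.univ w := SmoothFamilyOn.iff_contDiffOn.2 hw.contDiffOn
    let L : EuclideanSpace ℝ (Fin r) →ₗ[ℝ] A :=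
      { toFun := fun v => (ι v j : A)
        map_add' := fun v v' => by rw [map_add]; rfl
        map_smul' := fun a v => by rw [map_smul]; rfl }
    exact SmoothFamilyOn.mul (hw'.map L) h
  · have hv : SmoothFamilyOn Set.univ fun t => c.values (F t) :=
      SmoothFamilyOn.pi (ι := Fin n) (V := I) fun j => SmoothFamilyOn.of_injective
        (L := (I.restrictScalars ℝ).subtype) Subtype.val_injective (hF (c.f j))
    have hw : SmoothFamilyOn Set.univ fun t =>
        (c.coordInv ι (X (s (y t)).1) (c.values (F t))).2 :=
      SmoothFamilyOn.of_local fun t _ => by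
        obtain ⟨u, hu, htu, -, -, h⟩ := SmoothFamilyOn.bijective_and_linInv
          (V := idealDer I (Ideal.Quotient.mkₐ ℝ I) × EuclideanSpace ℝ (Fin r)) (W := Fin n → I)
          (hCs y hy) (hNo y hy).1 (hyN t).1 (hyN t).2
        exact ⟨u, hu, htu, (SmoothFamilyOn.end_apply (V := Fin n → I)
          (W := idealDer I (Ideal.Quotient.mkₐ ℝ I) × EuclideanSpace ℝ (Fin r)) h
          (hv.mono (Set.subset_univ _))).map
          (LinearMap.snd ℝ (idealDer I (Ideal.Quotient.mkₐ ℝ I)) (EuclideanSpace ℝ (Fin r)))⟩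
    exact ⟨_, contDiffOn_univ.1 (SmoothFamilyOn.iff_contDiffOn.1 hw), fun t f hf =>
      hex.eq_coordDer_of_bijective hsq (hsχ _ (hyN t).1) (hXp _ (hyN t).1) (hyN t).2 (F t) hf⟩
  -- Exponentials of lifted derivations lift the normalising automorphisms.
  · refine ⟨fun t => expAut (κ (Y (y t))), fun t f a ha => ?_, fun g hg => ?_⟩
    · rw [expAut_comm (Ideal.Quotient.mkₐ ℝ I) (hκ (Y (y t))), ha, hs]
    · have h := (hNo y hy).2
      rw [huniv fun t => (hyN t).1] at h
      exact SmoothFamilyOn.expAut ((h.map κ).map (derToEnd A)) hg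

end BundleCharts

/-! ### Tangent vectors of jet spaces and lifts of plots -/

section TangentVectors

variable {n : ℕ} {M : Type u} [TopologicalSpace M] [ChartedSpace (EuclideanSpace ℝ (Fin n)) M]
variable {A : Type v} [CommRing A] [Algebra ℝ A]

theorem JetTangent.mk_eq_mk {𝔭 𝔮 : JetSpace n M A} (h : 𝔭 = 𝔮) (D : 𝔭.Der) (D' : 𝔮.Der)
    (hD : ∀ f g, D f = Ideal.Quotient.mk 𝔭.1 g → D' f = Ideal.Quotient.mk 𝔮.1 g) :
    JetTangent.mk 𝔭 (𝔭.nullDer.mkQ D) = JetTangent.mk 𝔮 (𝔮.nullDer.mkQ D') := by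
  subst h
  congr 2
  ext f
  obtain ⟨g, hg⟩ := Ideal.Quotient.mk_surjective (D f)
  rw [← hg, hD f g hg.symm]

/-- The tangent vector of `J^A M` at `ker x` defined by a derivation along `x`. -/
def RegularPoint.tangent (x : RegularPoint n M A) (F : SmoothFn n M →ₗ[ℝ] A)
    (hF : ∀ f g, F (f * g) = x.1 f * F g + x.1 g * F f) : JetTangent n M A :=
  JetTangent.mk x.jet (x.jet.nullDer.mkQ (x.toDer F hF))

/-- Automorphisms do not change jets, so a tangent vector can be represented at any point of an
orbit, in particular over a normal form. -/
theorem RegularPoint.tangent_map (x : RegularPoint n M A) (σ : A ≃ₐ[ℝ] A)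
    (F : SmoothFn n M →ₗ[ℝ] A) (hF : ∀ f g, F (f * g) = x.1 f * F g + x.1 g * F f)
    (F' : SmoothFn n M →ₗ[ℝ] A)
    (hF' : ∀ f g, F' (f * g) = (x.map σ).1 f * F' g + (x.map σ).1 g * F' f)
    (h : ∀ f, F' f = σ (F f)) : (x.map σ).tangent F' hF' = x.tangent F hF := by
  refine (JetTangent.mk_eq_mk (x.jet_map σ).symm _ _ fun f g hfg => ?_).symm
  apply (x.map σ).coord.injective
  rw [coord_toDer, coord_mk, map_apply, h, ← x.coord_mk, ← hfg, coord_toDer]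

theorem RegularPoint.mkQ_eq_iff (x : RegularPoint n M A) (D D' : x.jet.Der) :
    x.jet.nullDer.mkQ D = x.jet.nullDer.mkQ D' ↔
      ∀ f, x.1 f = 0 → x.coord (D f) = x.coord (D' f) := by
  refine (Submodule.Quotient.eq _).trans ((x.mem_nullDer_iff _).trans ?_)
  refine forall₂_congr fun f _ => ?_
  rw [Derivation.sub_apply, map_sub, sub_eq_zero]

theorem RegularPoint.tangent_congr (x : RegularPoint n M A)
    {F F' : SmoothFn n M →ₗ[ℝ] A} (hF : ∀ f g, F (f * g) = x.1 f * F g + x.1 g * F f)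
    (hF' : ∀ f g, F' (f * g) = x.1 f * F' g + x.1 g * F' f) (h : ∀ f, x.1 f = 0 → F f = F' f) :
    x.tangent F hF = x.tangent F' hF' :=
  congrArg (JetTangent.mk x.jet) ((x.mkQ_eq_iff _ _).2 fun f hf => by
    rw [coord_toDer, coord_toDer, h f hf])

theorem RegularPoint.kerLiftAlg_eq_coord (x : RegularPoint n M A) (q : SmoothFn n M ⧸ x.jet.1) :
    Ideal.kerLiftAlg x.1 q = x.coord q := by
  obtain ⟨g, rfl⟩ := Ideal.Quotient.mk_surjective q
  rfl

theorem JetTangent.isPlot_tangent {k : ℕ} {x : EuclideanSpace ℝ (Fin k) → RegularPoint n M A}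
    (hx : IsPlot x) {F : EuclideanSpace ℝ (Fin k) → SmoothFn n M →ₗ[ℝ] A}
    (hFs : ∀ f, SmoothFamilyOn Set.univ fun t => F t f)
    (hF : ∀ t f g, F t (f * g) = (x t).1 f * F t g + (x t).1 g * F t f) :
    IsPlot fun t => (x t).tangent (F t) (hF t) :=
  DiffeologicalSpace.isPlot_generatedFrom_of_mem ⟨x, fun t => (x t).toDer (F t) (hF t), hx,
    fun f => smoothFamily_iff.2 ((hFs f).congr fun t _ =>
      ((x t).kerLiftAlg_eq_coord _).trans ((x t).coord_toDer _ _ f)), rfl⟩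

theorem JetTangent.exists_local_lift {k : ℕ} {p : EuclideanSpace ℝ (Fin k) → JetTangent n M A}
    (hp : IsPlot p) (t₀ : EuclideanSpace ℝ (Fin k)) :
    ∃ u, IsOpen u ∧ t₀ ∈ u ∧ ∀ {m : ℕ} (f : EuclideanSpace ℝ (Fin m) → _), ContDiff ℝ ∞ f →
      (∀ t, f t ∈ u) → ∃ (x : EuclideanSpace ℝ (Fin m) → RegularPoint n M A)
        (F : EuclideanSpace ℝ (Fin m) → SmoothFn n M →ₗ[ℝ] A)
        (hF : ∀ t f g, F t (f * g) = (x t).1 f * F t g + (x t).1 g * F t f),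
        IsPlot x ∧ (∀ f, SmoothFamilyOn Set.univ fun t => F t f) ∧
        ∀ t, (x t).tangent (F t) (hF t) = p (f t) := by
  have key : ∀ (x : RegularPoint n M A) (D : x.jet.Der),
      x.tangent (x.coord.toLinearMap ∘ₗ D.toLinearMap) (x.coord_der_mul D) =
        JetTangent.mk x.jet (x.jet.nullDer.mkQ D) := fun x D =>
    congrArg (JetTangent.mk x.jet) ((x.mkQ_eq_iff _ _).2 fun f _ => x.coord_toDer _ _ f)
  obtain ⟨u, hu, htu, h⟩ := Diffeology.exists_local_mem_of_isPlot_generateFrom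
    (fun k y => by
      obtain ⟨𝔭, y⟩ := y
      obtain ⟨x, rfl⟩ := 𝔭.exists_jet_eq
      obtain ⟨D, rfl⟩ := Submodule.mkQ_surjective _ y
      exact ⟨fun _ => x, fun _ => D, isPlot_const,
        fun f => smoothFamily_iff.2 (SmoothFamilyOn.const _), rfl⟩)
    (fun {k m p f} hp hf => by
      obtain ⟨x, D, hx, hD, hxD⟩ := hp
      exact ⟨x ∘ f, fun t => D (f t), isPlot_reparam hx hf, fun g l => (hD g l).comp hf,
        funext fun t => congrFun hxD (f t)⟩)
    hp t₀
  refine ⟨u, hu, htu, fun {m} f hf hfu => ?_⟩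
  obtain ⟨x, D, hx, hD, hxD⟩ := h f hf hfu
  refine ⟨x, fun t => (x t).coord.toLinearMap ∘ₗ (D t).toLinearMap,
    fun t => (x t).coord_der_mul (D t), hx, fun g => ?_, fun t => ?_⟩
  · exact (smoothFamily_iff.1 (hD g)).congr fun t _ => ((x t).kerLiftAlg_eq_coord _).symm
  · exact (key _ _).trans (congrFun hxD t).symm

theorem RegularPoint.exists_dSmooth_map_mem {N : Set (RegularPoint n M A)}
    (y : RegularPoint n M A) {y' : RegularPoint n M A} (hy' : y' ∈ N) (h : y.jet = y'.jet) :
    ∃ τ : RegularPoint n M A → RegularPoint n M A,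
      DSmooth τ ∧ (∀ z, (τ z).jet = z.jet) ∧ τ y ∈ N := by
  obtain ⟨σ, hσ⟩ := RegularPoint.jet_eq_iff.1 h
  refine ⟨RegularPoint.map σ, RegularPoint.dSmooth_map σ, fun z => z.jet_map σ, ?_⟩
  have : y.map σ = y' := Subtype.ext (AlgHom.ext fun f => (hσ f).symm)
  rwa [this]

theorem JetSpace.isPlot_jet {k : ℕ} {x : EuclideanSpace ℝ (Fin k) → RegularPoint n M A}
    (hx : IsPlot x) : IsPlot fun t => (x t).jet :=
  Diffeology.isPlot_coinduced hx

theorem dSmooth_jetMap {I : Ideal A} (hI : IsInvariantIdeal I) :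
    DSmooth (jetMap I : JetSpace n M A → JetSpace n M (A ⧸ I)) := fun k p hp =>
  Diffeology.isPlot_of_lift (N := Set.univ) JetSpace.exists_jet_eq
    (fun y _ => by simp) (fun y y' hy' h => y.exists_dSmooth_map_mem hy' h) hp
    (fun t => by simpa using (p t).exists_jet_eq) _ fun f hf x hx _ hxp => by
      have : (jetMap I ∘ p) ∘ f = fun t => ((x t).proj I).jet := funext fun t => by
        rw [← jetMap_jet I hI, hxp]
        rfl
      rw [this]
      exact JetSpace.isPlot_jet ((RegularPoint.dSmooth_proj I) _ _ hx)

variable {I : Ideal A} (C : BundleChart n M I)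

/-- The base of a chart. -/
def BundleChart.U : Set (JetSpace n M (A ⧸ I)) := RegularPoint.jet '' C.N

theorem BundleChart.isOpen_U : IsOpen[dTopology] C.U :=
  Diffeology.isOpen_image_coinduced JetSpace.exists_jet_eq C.isOpen
    fun y _ hy' h => y.exists_dSmooth_map_mem hy' h

theorem BundleChart.isPlot_of_lift_base {Z : Type*} [DiffeologicalSpace Z] {k : ℕ}
    {p : EuclideanSpace ℝ (Fin k) → JetSpace n M (A ⧸ I)} (hp : IsPlot p) (hpU : ∀ t, p t ∈ C.U)
    (q : EuclideanSpace ℝ (Fin k) → Z)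
    (h : ∀ {m : ℕ} (f : EuclideanSpace ℝ (Fin m) → EuclideanSpace ℝ (Fin k)), ContDiff ℝ ∞ f →
      ∀ y : EuclideanSpace ℝ (Fin m) → RegularPoint n M (A ⧸ I), IsPlot y → (∀ t, y t ∈ C.N) →
      (∀ t, (y t).jet = p (f t)) → IsPlot (q ∘ f)) : IsPlot q :=
  Diffeology.isPlot_of_lift JetSpace.exists_jet_eq C.isOpen
    (fun y _ hy' h => y.exists_dSmooth_map_mem hy' h) hp hpU q h

/-- Plots of `J^A M` over the base of a chart lift locally to regular points which project to
normal forms. -/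
theorem BundleChart.isPlot_of_lift_total {hI : IsInvariantIdeal I}
    (hex : AffineSequenceExact I hI) {Z : Type*} [DiffeologicalSpace Z] {k : ℕ}
    {p : EuclideanSpace ℝ (Fin k) → JetSpace n M A} (hp : IsPlot p)
    (hpU : ∀ t, jetMap I (p t) ∈ C.U) (q : EuclideanSpace ℝ (Fin k) → Z)
    (h : ∀ {m : ℕ} (f : EuclideanSpace ℝ (Fin m) → EuclideanSpace ℝ (Fin k)), ContDiff ℝ ∞ f →
      ∀ (y : EuclideanSpace ℝ (Fin m) → RegularPoint n M (A ⧸ I))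
        (x : EuclideanSpace ℝ (Fin m) → RegularPoint n M A), IsPlot y → (∀ t, y t ∈ C.N) →
      IsPlot x → (∀ t, (x t).proj I = C.s (y t)) → (∀ t, (x t).jet = p (f t)) →
      IsPlot (q ∘ f)) : IsPlot q := by
  refine Diffeology.isPlot_of_lift (N := {x : RegularPoint n M A | x.proj I ∈ C.N})
    JetSpace.exists_jet_eq (fun x hx => C.isOpen _ ((RegularPoint.dSmooth_proj I) _ _ hx))
    (fun y _ hy' h => y.exists_dSmooth_map_mem hy' h) hp (fun t => ?_) q
    fun {m} f hf x hx hxN hxp => ?_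
  · obtain ⟨y, hy, hyp⟩ := hpU t
    obtain ⟨x, hxp, hxy⟩ := hex.exists_proj_eq hyp.symm
    exact ⟨x, (congrArg (· ∈ C.N) hxy).mpr hy, hxp⟩
  · have hy : IsPlot fun t => (x t).proj I := (RegularPoint.dSmooth_proj I) _ _ hx
    -- The lifted normalising automorphisms bring the projections into normal form without changing
    -- the jets.
    obtain ⟨ψ, hψ, hψs⟩ := C.exists_normalise _ hy hxN
    refine h f hf _ (fun t => (x t).map (ψ t)) hy hxN
      (RegularPoint.isPlot_iff.2 fun g => hψs _ (RegularPoint.isPlot_iff.1 hx g)) (fun t => ?_)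
      fun t => ((x t).jet_map _).trans (hxp t)
    exact Subtype.ext (AlgHom.ext fun g => hψ t g _ rfl)

end TangentVectors

/-! ### Local trivialisations of the affine bundle -/

section LocalTrivialisations

variable {n : ℕ} {M : Type u} [TopologicalSpace M] [ChartedSpace (EuclideanSpace ℝ (Fin n)) M]
variable {A : Type v} [CommRing A] [Algebra ℝ A] [IsWeilAlgebra A] {I : Ideal A}
  {S : AffineFibres.{u, u, u} (jetMap I : JetSpace n M A → JetSpace n M (A ⧸ I))}
  {m : ∀ (b : JetSpace n M (A ⧸ I)) (y : RegularPoint n M (A ⧸ I)), y.jet = b →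
    (idealDer I y.1 →ₗ[ℝ] S.V b)}

/-- The derivation with values in `I` with given coordinates in a chart. -/
def BundleChart.der (C : BundleChart n M I) {y : RegularPoint n M (A ⧸ I)} (hy : y ∈ C.N) :
    EuclideanSpace ℝ (Fin C.r) →ₗ[ℝ] idealDer I (C.s y).1 :=
  (C.E (C.s y)).codRestrict _ (C.E_mem y hy)

theorem BundleChart.exists_apply_eq (C : BundleChart n M I) {y : RegularPoint n M (A ⧸ I)}
    (hy : y ∈ C.N) (F : idealDer I (C.s y).1) :
    ∃ w, ∀ f, (C.s y).1 f = 0 → F.1 f = C.E (C.s y) w f := by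
  obtain ⟨w, -, hw⟩ := C.exists_coordinates (k := 0) (fun _ => y) isPlot_const (fun _ => hy)
    (fun _ => F) fun f => SmoothFamilyOn.const _
  exact ⟨w 0, hw 0⟩

/-- The parametrisations of the fibres defined by a chart. -/
theorem BundleChart.exists_fibreChart (hI : IsInvariantIdeal I)
    (hms : ∀ b y hy, Function.Surjective (m b y hy))
    (hm0 : ∀ b y hy E, m b y hy E = 0 ↔ ∀ f, y.1 f = 0 → E.1 f = 0)
    (hmadd : ∀ b y hy (E : idealDer I y.1) (x x' : RegularPoint n M A) (_ : x.proj I = y)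
        (_ : ∀ f, x'.1 f = x.1 f + E.1 f) (hb : jetMap I x.jet = b),
        (m b y hy E +ᵥ S.mkPoint x.jet hb).1 = x'.jet) (C : BundleChart n M I) :
    ∃ e : ∀ b : C.U, EuclideanSpace ℝ (Fin C.r) ≃ᵃ[ℝ] S.Point (b : JetSpace n M (A ⧸ I)),
      ∀ (b : C.U) (y : RegularPoint n M (A ⧸ I)) (hy : y ∈ C.N) (h : (C.s y).jet = b.1)
        (w : EuclideanSpace ℝ (Fin C.r)),
        (e b).linear w = m b.1 (C.s y) h (C.der hy w) ∧
        ∀ x' : RegularPoint n M A, (∀ f, x'.1 f = (C.x (C.s y)).1 f + C.E (C.s y) w f) →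
          (e b w).1 = x'.jet := by
  have key : ∀ b : C.U, ∃ e : EuclideanSpace ℝ (Fin C.r) ≃ᵃ[ℝ] S.Point (b : JetSpace n M (A ⧸ I)),
      ∀ (y : RegularPoint n M (A ⧸ I)) (hy : y ∈ C.N) (h : (C.s y).jet = b.1)
        (w : EuclideanSpace ℝ (Fin C.r)),
        e.linear w = m b.1 (C.s y) h (C.der hy w) ∧
        ∀ x' : RegularPoint n M A, (∀ f, x'.1 f = (C.x (C.s y)).1 f + C.E (C.s y) w f) →
          (e w).1 = x'.jet := by
    rintro ⟨b, y₀, hy₀, rfl⟩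
    have h₀ : (C.s y₀).jet = y₀.jet := C.jet_s y₀ hy₀
    -- The chart parametrises a complement of the kernel of `m`, so the composite is an isomorphism
    -- onto the model space. The reference jet given by `C.x` is the origin of the affine chart.
    let L : EuclideanSpace ℝ (Fin C.r) →ₗ[ℝ] S.V y₀.jet := m _ (C.s y₀) h₀ ∘ₗ C.der hy₀
    have hL : Function.Bijective L := by
      refine ⟨LinearMap.injective_of_forall _ _ fun w hw => ?_, fun v => ?_⟩
      · exact C.E_injective y₀ hy₀ w ((hm0 _ (C.s y₀) h₀ _).1 hw)
      · obtain ⟨F, rfl⟩ := hms _ (C.s y₀) h₀ v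
        obtain ⟨w, hw⟩ := C.exists_apply_eq hy₀ F
        refine ⟨w, ?_⟩
        rw [← sub_eq_zero]
        refine (map_sub (m _ (C.s y₀) h₀) (C.der hy₀ w) F).symm.trans
          ((hm0 _ (C.s y₀) h₀ _).2 fun f hf => ?_)
        change C.E (C.s y₀) w f - F.1 f = 0
        rw [hw f hf, sub_self]
    have hb : jetMap I (C.x (C.s y₀)).jet = y₀.jet := by
      rw [jetMap_jet I hI, C.proj_x y₀ hy₀, h₀]
    refine ⟨(LinearEquiv.ofBijective L hL).toAffineEquiv.trans
      (AffineEquiv.vaddConst ℝ (S.mkPoint _ hb)), fun y hy h w => ?_⟩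
    have hs : C.s y = C.s y₀ := C.s_eq y hy y₀ hy₀ ((C.jet_s y hy).symm.trans h)
    have h1 : m y₀.jet (C.s y) h (C.der hy w) = L w := by
      -- Stated for a variable `z`, because the type of the derivation depends on the point `C.s y`.
      have : ∀ (z : RegularPoint n M (A ⧸ I)) (hz : C.s y = z) (h' : z.jet = y₀.jet)
          (F : idealDer I z.1), F.1 = C.E z w → m _ (C.s y) h (C.der hy w) = m _ z h' F := by
        rintro z rfl h' F hF
        exact congrArg _ (Subtype.ext hF.symm)
      exact this _ hs h₀ (C.der hy₀ w) rfl
    refine ⟨h1.symm, fun x' hx' => ?_⟩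
    rw [hs] at hx'
    exact hmadd _ (C.s y₀) h₀ (C.der hy₀ w) (C.x (C.s y₀)) x' (C.proj_x y₀ hy₀) hx' hb
  choose e he using key
  exact ⟨e, he⟩

variable {hI : IsInvariantIdeal I} {C : BundleChart n M I}
  {e : ∀ b : C.U, EuclideanSpace ℝ (Fin C.r) ≃ᵃ[ℝ] S.Point (b : JetSpace n M (A ⧸ I))}

/-- The jet of `x` sees `F` only on the kernel of the normal form, so any `w` that matches `F` there
is the coordinate vector. -/
theorem AffineSequenceExact.fibreChart_symm_eq (hex : AffineSequenceExact I hI)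
    (hsq : ∀ a ∈ I, ∀ b ∈ I, a * b = 0) (hm : I ≤ IsLocalRing.maximalIdeal A ^ 2)
    (he : ∀ (b : C.U) (y : RegularPoint n M (A ⧸ I)) (_ : y ∈ C.N) (_ : (C.s y).jet = b.1)
        (w : EuclideanSpace ℝ (Fin C.r)) (x' : RegularPoint n M A),
        (∀ f, x'.1 f = (C.x (C.s y)).1 f + C.E (C.s y) w f) → (e b w).1 = x'.jet)
    {𝔭 : JetSpace n M A} (h𝔭 : jetMap I 𝔭 ∈ C.U) {y : RegularPoint n M (A ⧸ I)} (hy : y ∈ C.N)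
    {x : RegularPoint n M A} (hx : x.proj I = C.s y) (hxp : x.jet = 𝔭) {F : idealDer I (C.s y).1}
    (hF : ∀ f, x.1 f = (C.x (C.s y)).1 f + F.1 f) {w : EuclideanSpace ℝ (Fin C.r)}
    (hw : ∀ f, (C.s y).1 f = 0 → F.1 f = C.E (C.s y) w f) :
    (e ⟨jetMap I 𝔭, h𝔭⟩).symm (S.pt 𝔭) = w := by
  subst hxp
  rw [AffineEquiv.symm_apply_eq]
  obtain ⟨x', -, hx'⟩ := (C.x (C.s y)).exists_add hsq hm (C.proj_x y hy) (C.der hy w)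
  have h := he ⟨jetMap I x.jet, h𝔭⟩ y hy
    ((congrArg RegularPoint.jet hx).symm.trans (jetMap_jet I hI x).symm) w x' hx'
  refine Subtype.ext (Eq.trans ?_ h.symm)
  refine (hex.jet_eq_iff_of_add (C.proj_x y hy) hF hx').2 fun f hf => ?_
  change F.1 f - C.E (C.s y) w f = 0
  rw [hw f hf, sub_self]

end LocalTrivialisations

/-! ### Smoothness of the affine charts and of their linear parts -/

section SmoothTrivialisations

variable {n : ℕ} {M : Type u} [TopologicalSpace M] [ChartedSpace (EuclideanSpace ℝ (Fin n)) M]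
variable {A : Type v} [CommRing A] [Algebra ℝ A] [IsWeilAlgebra A] {I : Ideal A}
  {S : AffineFibres.{u, u, u} (jetMap I : JetSpace n M A → JetSpace n M (A ⧸ I))}
  {m : ∀ (b : JetSpace n M (A ⧸ I)) (y : RegularPoint n M (A ⧸ I)), y.jet = b →
    (idealDer I y.1 →ₗ[ℝ] S.V b)}
  {θ : ∀ 𝔭 : JetSpace n M A, 𝔭.vertical I ≃ₗ[ℝ] S.V (jetMap I 𝔭)}
  {hI : IsInvariantIdeal I} {C : BundleChart n M I}
  {e : ∀ b : C.U, EuclideanSpace ℝ (Fin C.r) ≃ᵃ[ℝ] S.Point (b : JetSpace n M (A ⧸ I))}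

theorem RegularPoint.jet_eq_jetMap (hI : IsInvariantIdeal I) {x : RegularPoint n M A}
    {y : RegularPoint n M (A ⧸ I)} (hx : x.proj I = y) : y.jet = jetMap I x.jet :=
  (congrArg RegularPoint.jet hx).symm.trans (jetMap_jet I hI x).symm

theorem RegularPoint.der_leibniz (C : BundleChart n M I) {y : RegularPoint n M (A ⧸ I)}
    (hy : y ∈ C.N) {x : RegularPoint n M A} (hx : x.proj I = C.s y)
    (w : EuclideanSpace ℝ (Fin C.r)) (f g : SmoothFn n M) :
    C.E (C.s y) w (f * g) = x.1 f * C.E (C.s y) w g + x.1 g * C.E (C.s y) w f :=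
  idealDer_leibniz (RegularPoint.proj_eq_iff.1 hx) (C.E_mem y hy w) f g

theorem BundleChart.mk_theta_symm
    (hθ : ∀ (x : RegularPoint n M A) (y : RegularPoint n M (A ⧸ I)) (hx : x.proj I = y)
        (hy : y.jet = jetMap I x.jet) (E : idealDer I y.1),
        θ x.jet (x.jet.verticalClass I (x.toRelDer hI hx E)) = m _ y hy E)
    (he : ∀ (b : C.U) (y : RegularPoint n M (A ⧸ I)) (hy : y ∈ C.N) (h : (C.s y).jet = b.1)
        (w : EuclideanSpace ℝ (Fin C.r)), (e b).linear w = m b.1 (C.s y) h (C.der hy w))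
    {𝔭 : JetSpace n M A} (h𝔭 : jetMap I 𝔭 ∈ C.U) {y : RegularPoint n M (A ⧸ I)} (hy : y ∈ C.N)
    {x : RegularPoint n M A} (hx : x.proj I = C.s y) (hxp : x.jet = 𝔭)
    (w : EuclideanSpace ℝ (Fin C.r)) :
    JetTangent.mk 𝔭 ((θ 𝔭).symm ((e ⟨jetMap I 𝔭, h𝔭⟩).linear w)).1 =
      x.tangent (C.E (C.s y) w) (RegularPoint.der_leibniz C hy hx w) := by
  subst hxp
  have h : (θ x.jet).symm ((e ⟨jetMap I x.jet, h𝔭⟩).linear w) =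
      x.jet.verticalClass I (x.toRelDer hI hx (C.der hy w)) := by
    rw [LinearEquiv.symm_apply_eq, hθ x _ hx (RegularPoint.jet_eq_jetMap hI hx)]
    exact he ⟨jetMap I x.jet, h𝔭⟩ y hy (RegularPoint.jet_eq_jetMap hI hx) w
  rw [h]
  rfl

theorem BundleChart.linear_symm_theta
    (hm0 : ∀ b y hy E, m b y hy E = 0 ↔ ∀ f, y.1 f = 0 → E.1 f = 0)
    (hθ : ∀ (x : RegularPoint n M A) (y : RegularPoint n M (A ⧸ I)) (hx : x.proj I = y)
        (hy : y.jet = jetMap I x.jet) (E : idealDer I y.1),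
        θ x.jet (x.jet.verticalClass I (x.toRelDer hI hx E)) = m _ y hy E)
    (he : ∀ (b : C.U) (y : RegularPoint n M (A ⧸ I)) (hy : y ∈ C.N) (h : (C.s y).jet = b.1)
        (w : EuclideanSpace ℝ (Fin C.r)), (e b).linear w = m b.1 (C.s y) h (C.der hy w))
    {Y : JetTangent n M A} (hU : jetMap I Y.1 ∈ C.U) (hV : Y.2 ∈ Y.1.vertical I)
    {y : RegularPoint n M (A ⧸ I)} (hy : y ∈ C.N) {x : RegularPoint n M A}
    (hx : x.proj I = C.s y) (F : idealDer I (C.s y).1)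
    (hY : x.tangent F.1 (idealDer_leibniz (RegularPoint.proj_eq_iff.1 hx) F.2) = Y)
    {w : EuclideanSpace ℝ (Fin C.r)} (hw : ∀ f, (C.s y).1 f = 0 → F.1 f = C.E (C.s y) w f) :
    (e ⟨jetMap I Y.1, hU⟩).linear.symm (θ Y.1 ⟨Y.2, hV⟩) = w := by
  subst hY
  rw [LinearEquiv.symm_apply_eq]
  have hj : (C.s y).jet = jetMap I x.jet := RegularPoint.jet_eq_jetMap hI hx
  refine (hθ x _ hx hj F).trans (Eq.trans ?_ (he ⟨jetMap I x.jet, hU⟩ y hy hj w).symm)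
  rw [← sub_eq_zero]
  refine (map_sub (m _ (C.s y) hj) F (C.der hy w)).symm.trans ((hm0 _ (C.s y) hj _).2 fun f hf => ?_)
  change F.1 f - C.E (C.s y) w f = 0
  rw [hw f hf, sub_self]

theorem Diffeology.isPlot_prod_iff {X : Type*} {Y : Type*} [DiffeologicalSpace X]
    [DiffeologicalSpace Y] {k : ℕ} {p : EuclideanSpace ℝ (Fin k) → X × Y} :
    IsPlot p ↔ (IsPlot fun t => (p t).1) ∧ IsPlot fun t => (p t).2 :=
  DiffeologicalSpace.isPlot_inf_iff

theorem Diffeology.isPlot_subtype_iff {X : Type*} [DiffeologicalSpace X] {P : X → Prop} {k : ℕ}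
    {p : EuclideanSpace ℝ (Fin k) → {x // P x}} : IsPlot p ↔ IsPlot fun t => (p t).1 :=
  Iff.rfl

variable (hex : AffineSequenceExact I hI)
  (hsq : ∀ a ∈ I, ∀ b ∈ I, a * b = 0) (hm : I ≤ IsLocalRing.maximalIdeal A ^ 2)
  (hm0 : ∀ b y hy E, m b y hy E = 0 ↔ ∀ f, y.1 f = 0 → E.1 f = 0)
  (hθ : ∀ (x : RegularPoint n M A) (y : RegularPoint n M (A ⧸ I)) (hx : x.proj I = y)
      (hy : y.jet = jetMap I x.jet) (E : idealDer I y.1),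
      θ x.jet (x.jet.verticalClass I (x.toRelDer hI hx E)) = m _ y hy E)
  (he₁ : ∀ (b : C.U) (y : RegularPoint n M (A ⧸ I)) (hy : y ∈ C.N) (h : (C.s y).jet = b.1)
      (w : EuclideanSpace ℝ (Fin C.r)), (e b).linear w = m b.1 (C.s y) h (C.der hy w))
  (he : ∀ (b : C.U) (y : RegularPoint n M (A ⧸ I)) (_ : y ∈ C.N) (_ : (C.s y).jet = b.1)
      (w : EuclideanSpace ℝ (Fin C.r)) (x' : RegularPoint n M A),
      (∀ f, x'.1 f = (C.x (C.s y)).1 f + C.E (C.s y) w f) → (e b w).1 = x'.jet)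

include hsq hm he in
theorem BundleChart.dSmooth_toFibre :
    DSmooth fun z : C.U × EuclideanSpace ℝ (Fin C.r) => (e z.1 z.2).1 := by
  intro k p hp
  obtain ⟨h1, h2⟩ := isPlot_prod_iff.1 hp
  have h2' : ContDiff ℝ ∞ fun t => (p t).2 := isPlot_iff_contDiff.1 h2
  refine C.isPlot_of_lift_base (isPlot_subtype_iff.1 h1) (fun t => (p t).1.2) _
    fun {k'} f hf y hy hyN hyp => ?_
  choose x' hx' hx'' using fun t => (C.x (C.s (y t))).exists_add hsq hm
    (C.proj_x _ (hyN t)) (C.der (hyN t) (p (f t)).2)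
  have hplot : IsPlot x' := RegularPoint.isPlot_iff.2 fun g =>
    ((RegularPoint.isPlot_iff.1 (C.isPlot_x y hy hyN) g).add
      (C.smooth_E y hy hyN _ (h2'.comp hf) g)).congr fun t _ => hx'' t g
  have : ∀ t, (e (p (f t)).1 (p (f t)).2).1 = (x' t).jet := fun t =>
    he (p (f t)).1 (y t) (hyN t) ((C.jet_s _ (hyN t)).trans (hyp t)) _ _ (hx'' t)
  exact (congrArg IsPlot (funext this)).mpr (JetSpace.isPlot_jet hplot)

-- Over normal forms, the inverse chart reads the coordinates of the difference from the reference
-- point `C.x`.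
include hex hsq hm he in
theorem BundleChart.dSmooth_toFibre_symm :
    DSmooth fun 𝔭 : {𝔭 : JetSpace n M A // jetMap I 𝔭 ∈ C.U} =>
      (e ⟨jetMap I 𝔭.1, 𝔭.2⟩).symm (S.pt 𝔭.1) := by
  intro k p hp
  refine C.isPlot_of_lift_total hex (isPlot_subtype_iff.1 hp) (fun t => (p t).2) _
    fun {k'} f hf y x hy hyN hx hxs hxp => ?_
  choose F hF using fun t => RegularPoint.exists_eq_add hsq (C.proj_x _ (hyN t)) (hxs t)
  obtain ⟨w, hw, hwF⟩ := C.exists_coordinates y hy hyN F fun g =>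
    ((RegularPoint.isPlot_iff.1 hx g).sub
      (RegularPoint.isPlot_iff.1 (C.isPlot_x y hy hyN) g)).congr fun t _ => by
        rw [hF, add_sub_cancel_left]
  have : ∀ t, (e ⟨jetMap I (p (f t)).1, (p (f t)).2⟩).symm (S.pt (p (f t)).1) = w t := fun t =>
    hex.fibreChart_symm_eq hsq hm he (p (f t)).2 (hyN t) (hxs t) (hxp t) (hF t) (hwF t)
  exact (congrArg IsPlot (funext this)).mpr (isPlot_iff_contDiff.2 hw)

include hex hθ he₁ in
theorem BundleChart.dSmooth_linear :
    DSmooth fun z : {𝔭 : JetSpace n M A // jetMap I 𝔭 ∈ C.U} × EuclideanSpace ℝ (Fin C.r) =>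
      JetTangent.mk z.1.1
        ((θ z.1.1).symm ((e ⟨jetMap I z.1.1, z.1.2⟩).linear z.2)).1 := by
  intro k p hp
  obtain ⟨h1, h2⟩ := isPlot_prod_iff.1 hp
  have h2' : ContDiff ℝ ∞ fun t => (p t).2 := isPlot_iff_contDiff.1 h2
  refine C.isPlot_of_lift_total hex (isPlot_subtype_iff.1 h1) (fun t => (p t).1.2) _
    fun {k'} f hf y x hy hyN hx hxs hxp => ?_
  have : ∀ t, JetTangent.mk (p (f t)).1.1
      ((θ (p (f t)).1.1).symm ((e ⟨jetMap I (p (f t)).1.1, (p (f t)).1.2⟩).linear (p (f t)).2)).1 =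
      (x t).tangent (C.E (C.s (y t)) (p (f t)).2)
        (RegularPoint.der_leibniz C (hyN t) (hxs t) (p (f t)).2) := fun t =>
    BundleChart.mk_theta_symm hθ he₁ (p (f t)).1.2 (hyN t) (hxs t) (hxp t) (p (f t)).2
  exact (congrArg IsPlot (funext this)).mpr (JetTangent.isPlot_tangent hx
    (C.smooth_E y hy hyN _ (h2'.comp hf))
    fun t => RegularPoint.der_leibniz C (hyN t) (hxs t) (p (f t)).2)

end SmoothTrivialisations

/-! ### Smooth coordinates of vertical vectors -/

section SmoothModelBundle

variable {n : ℕ} {M : Type u} [TopologicalSpace M] [ChartedSpace (EuclideanSpace ℝ (Fin n)) M]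
variable {A : Type v} [CommRing A] [Algebra ℝ A] [IsWeilAlgebra A] {I : Ideal A}
  {S : AffineFibres.{u, u, u} (jetMap I : JetSpace n M A → JetSpace n M (A ⧸ I))}
  {m : ∀ (b : JetSpace n M (A ⧸ I)) (y : RegularPoint n M (A ⧸ I)), y.jet = b →
    (idealDer I y.1 →ₗ[ℝ] S.V b)}
  {θ : ∀ 𝔭 : JetSpace n M A, 𝔭.vertical I ≃ₗ[ℝ] S.V (jetMap I 𝔭)}
  {hI : IsInvariantIdeal I} {C : BundleChart n M I}
  {e : ∀ b : C.U, EuclideanSpace ℝ (Fin C.r) ≃ᵃ[ℝ] S.Point (b : JetSpace n M (A ⧸ I))}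

/-- Modulo `δ ∘ x` with `δ` a derivation of `A`, a vertical `F` has values in `I`; and `δ` preserves
`I` by invariance. -/
theorem AffineSequenceExact.apply_mem_of_vertical (hex : AffineSequenceExact I hI)
    {x : RegularPoint n M A} {F : SmoothFn n M →ₗ[ℝ] A}
    {hF : ∀ f g, F (f * g) = x.1 f * F g + x.1 g * F f}
    (hV : (x.tangent F hF).2 ∈ (x.tangent F hF).1.vertical I) {f : SmoothFn n M}
    (hf : x.1 f ∈ I) : F f ∈ I := by
  obtain ⟨D, hD⟩ := hex.verticalClass_surjective x.jet ⟨_, hV⟩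
  have h0 : ∀ f, x.1 f = 0 → x.coord (D.1 f) = F f := fun f hf =>
    ((x.mkQ_eq_iff _ _).1 (congrArg Subtype.val hD) f hf).trans (x.coord_toDer F hF f)
  have hD' := (x.mem_relDer_iff hI _).1 D.2
  obtain ⟨δ, hδ⟩ := exists_derivation_of_vanish x.2
    (F - x.coord.toLinearMap ∘ₗ D.1.toLinearMap)
    (fun f g => by
      have h1 := hF f g
      have h2 := x.coord_der_mul D.1 f g
      change F (f * g) - x.coord (D.1 (f * g)) =
        x.1 f * (F g - x.coord (D.1 g)) + x.1 g * (F f - x.coord (D.1 f))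
      rw [h1, h2]
      ring)
    fun f hf => sub_eq_zero.2 (h0 f hf).symm
  have h := hI.derivation_mem δ hf
  rw [hδ] at h
  exact (sub_add_cancel (F f) (x.coord (D.1 f))) ▸ I.add_mem h (hD' f)

/-- The pointwise choice of `I`-valued representatives of vertical vectors is replaced by a smooth
one, obtained by lifting the null derivations modulo `I` smoothly to `A`. -/
theorem BundleChart.exists_vertical_coordinates (hex : AffineSequenceExact I hI)
    (hsq : ∀ a ∈ I, ∀ b ∈ I, a * b = 0) (C : BundleChart n M I) {k : ℕ}
    {p : EuclideanSpace ℝ (Fin k) → JetTangent n M A} (hV : ∀ t, (p t).2 ∈ (p t).1.vertical I)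
    {x : EuclideanSpace ℝ (Fin k) → RegularPoint n M A} (hx : IsPlot x)
    (hxN : ∀ t, (x t).proj I ∈ C.N)
    {F : EuclideanSpace ℝ (Fin k) → SmoothFn n M →ₗ[ℝ] A}
    (hF : ∀ t f g, F t (f * g) = (x t).1 f * F t g + (x t).1 g * F t f)
    (hFs : ∀ f, SmoothFamilyOn Set.univ fun t => F t f)
    (hY : ∀ t, (x t).tangent (F t) (hF t) = p t) :
    ∃ w : EuclideanSpace ℝ (Fin k) → EuclideanSpace ℝ (Fin C.r), ContDiff ℝ ∞ w ∧
      ∀ t, ∃ y ∈ C.N, ∃ (x : RegularPoint n M A) (hx : x.proj I = C.s y)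
        (F : idealDer I (C.s y).1),
        x.tangent F.1 (idealDer_leibniz (RegularPoint.proj_eq_iff.1 hx) F.2) = p t ∧
        ∀ f, (C.s y).1 f = 0 → F.1 f = C.E (C.s y) (w t) f := by
  have hV' : ∀ t f, (x t).1 f ∈ I → F t f ∈ I := fun t f hf => by
    have h := hV t
    rw [← hY t] at h
    exact hex.apply_mem_of_vertical h hf
  have hy : IsPlot fun t => (x t).proj I := (RegularPoint.dSmooth_proj I) _ _ hx
  have hys : ∀ t f, Ideal.Quotient.mkₐ ℝ I ((x t).1 f) = ((x t).proj I).1 f := fun _ _ => rfl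
  have hC₁ := C.exists_normalise _ hy hxN
  obtain ⟨ψ, hψ, hψs⟩ := hC₁
  have hC₂ := C.exists_derivation _ hy hxN
    (fun t => (Ideal.Quotient.mkₐ ℝ I).toLinearMap ∘ₗ F t)
    (fun f => (hFs f).map (Ideal.Quotient.mkₐ ℝ I).toLinearMap)
    (fun t f g => by
      have := congrArg (Ideal.Quotient.mkₐ ℝ I) (hF t f g)
      rw [map_add, map_mul (Ideal.Quotient.mkₐ ℝ I), map_mul (Ideal.Quotient.mkₐ ℝ I)] at this
      exact this)
    (fun t f hf => mkₐ_eq_zero_iff.2 (hV' t f (mkₐ_eq_zero_iff.1 hf)))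
  obtain ⟨δ, hδs, hδ⟩ := hC₂
  have hxs := RegularPoint.isPlot_iff.1 hx
  -- `F₁` has values in `I` and agrees with `F` on `ker (x t)`, so it represents the same tangent
  -- vector.
  let F₁ : EuclideanSpace ℝ (Fin k) → SmoothFn n M →ₗ[ℝ] A := fun t =>
    F t - (δ t).toLinearMap ∘ₗ (x t).1.toLinearMap
  have hF₁a : ∀ t f, F₁ t f = F t f - δ t ((x t).1 f) := fun t f => rfl
  have hF₁ : ∀ t f g, F₁ t (f * g) = (x t).1 f * F₁ t g + (x t).1 g * F₁ t f := fun t f g => by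
    rw [hF₁a, hF₁a, hF₁a, hF, map_mul (x t).1, Derivation.leibniz, smul_eq_mul, smul_eq_mul]
    ring
  have hF₁I : ∀ t f, F₁ t f ∈ I := fun t f => by
    rw [hF₁a, ← mkₐ_eq_iff, hδ t f _ (hys t f)]
    rfl
  let x' : EuclideanSpace ℝ (Fin k) → RegularPoint n M A := fun t => (x t).map (ψ t)
  have hx' : ∀ t, (x' t).proj I = C.s ((x t).proj I) := fun t =>
    Subtype.ext (AlgHom.ext fun g => hψ t g _ (hys t g))
  let F₂ : ∀ t, idealDer I (C.s ((x t).proj I)).1 := fun t =>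
    ⟨(ψ t).toLinearMap ∘ₗ F₁ t, mem_idealDer_of_leibniz hsq (RegularPoint.proj_eq_iff.1 (hx' t))
      (fun f => hI.apply_mem (ψ t) (hF₁I t f)) fun f g => by
        have := congrArg (ψ t) (hF₁ t f g)
        rw [map_add, map_mul (ψ t), map_mul (ψ t)] at this
        exact this⟩
  have hδx : ∀ f, SmoothFamilyOn Set.univ fun t => δ t ((x t).1 f) := fun f =>
    SmoothFamilyOn.end_apply hδs (hxs f)
  have hC₃ := C.exists_coordinates _ hy hxN F₂ fun f =>
    hψs _ ((hFs f).sub (hδx f))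
  obtain ⟨w, hw, hwF⟩ := hC₃
  have key : ∀ t, (x' t).tangent (F₂ t).1
      (idealDer_leibniz (RegularPoint.proj_eq_iff.1 (hx' t)) (F₂ t).2) = p t := fun t => by
    refine ((x t).tangent_map (ψ t) (F₁ t) (hF₁ t) _ _ fun f => rfl).trans
      (((x t).tangent_congr (hF₁ t) (hF t) fun f hf => ?_).trans (hY t))
    rw [hF₁a, hf, map_zero, sub_zero]
  exact ⟨w, hw, fun t => ⟨_, hxN t, x' t, hx' t, F₂ t, key t, hwF t⟩⟩

/-- The points of a local lift need not project into the domain of the chart. One constant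
automorphism corrects this at `t₀`, hence nearby. -/
theorem BundleChart.exists_local_vertical_coordinates (hex : AffineSequenceExact I hI)
    (hsq : ∀ a ∈ I, ∀ b ∈ I, a * b = 0) (C : BundleChart n M I) {k : ℕ}
    {p : EuclideanSpace ℝ (Fin k) → JetTangent n M A} (hp : IsPlot p)
    (hU : ∀ t, jetMap I (p t).1 ∈ C.U) (hV : ∀ t, (p t).2 ∈ (p t).1.vertical I)
    (t₀ : EuclideanSpace ℝ (Fin k)) :
    ∃ u, IsOpen u ∧ t₀ ∈ u ∧ ∀ {m : ℕ} (f : EuclideanSpace ℝ (Fin m) → _), ContDiff ℝ ∞ f →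
      (∀ t, f t ∈ u) →
      ∃ w : EuclideanSpace ℝ (Fin m) → EuclideanSpace ℝ (Fin C.r), ContDiff ℝ ∞ w ∧
        ∀ t, ∃ y ∈ C.N, ∃ (x : RegularPoint n M A) (hx : x.proj I = C.s y)
          (F : idealDer I (C.s y).1),
          x.tangent F.1 (idealDer_leibniz (RegularPoint.proj_eq_iff.1 hx) F.2) = p (f t) ∧
          ∀ f, (C.s y).1 f = 0 → F.1 f = C.E (C.s y) (w t) f := by
  obtain ⟨u, hu, htu, h⟩ := JetTangent.exists_local_lift hp t₀
  obtain ⟨c, hc, hc0, hcu, hcs⟩ := exists_ball_reparam hu htu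
  obtain ⟨x, F, hF, hx, hFs, hxF⟩ := h c hc hcu
  obtain ⟨y', hy', hyp⟩ := hU t₀
  have hj : (x 0).jet = (p t₀).1 := by
    rw [← hc0, ← hxF 0]
    rfl
  obtain ⟨z, hz, hzy⟩ := hex.exists_proj_eq hyp.symm
  obtain ⟨σ, hσ⟩ := RegularPoint.jet_eq_iff.1 (hj.trans hz.symm)
  have hzσ : (x 0).map σ = z := Subtype.ext (AlgHom.ext fun f => (hσ f).symm)
  have hxσ : IsPlot fun t => (x t).map σ := (RegularPoint.dSmooth_map σ) _ _ hx
  obtain ⟨v, -, hv, htv, hvs⟩ := hcs _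
    (C.isOpen _ ((RegularPoint.dSmooth_proj I) _ _ hxσ)) (by
      change ((x 0).map σ).proj I ∈ C.N
      rw [hzσ, hzy]
      exact hy')
  refine ⟨v, hv, htv, fun {k'} f hf hfv => ?_⟩
  obtain ⟨g, hg, hgs, rfl⟩ := hvs f hf hfv
  have hσF : ∀ t f f', (σ.toLinearMap ∘ₗ F (g t)) (f * f') =
      ((x (g t)).map σ).1 f * (σ.toLinearMap ∘ₗ F (g t)) f' +
        ((x (g t)).map σ).1 f' * (σ.toLinearMap ∘ₗ F (g t)) f := fun t f f' => by
    have := congrArg σ (hF (g t) f f')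
    rw [map_add, map_mul σ, map_mul σ] at this
    exact this
  exact C.exists_vertical_coordinates hex hsq (p := fun t => p (c (g t))) (fun t => hV _)
    (x := fun t => (x (g t)).map σ) (isPlot_reparam hxσ hg) hgs hσF
    (fun f => ((hFs f).map σ.toLinearMap).comp_left hg.contDiffOn fun _ _ => Set.mem_univ _)
    fun t => ((x (g t)).tangent_map σ (F (g t)) (hF (g t)) _ _ fun f => rfl).trans (hxF (g t))

theorem BundleChart.dSmooth_of_vertical_coordinates (hex : AffineSequenceExact I hI)
    (hsq : ∀ a ∈ I, ∀ b ∈ I, a * b = 0) (C : BundleChart n M I)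
    {q : {y : JetTangent n M A // jetMap I y.1 ∈ C.U ∧ y.2 ∈ y.1.vertical I} →
      EuclideanSpace ℝ (Fin C.r)}
    (hq : ∀ Y w, ∀ y ∈ C.N, ∀ (x : RegularPoint n M A) (hx : x.proj I = C.s y)
      (F : idealDer I (C.s y).1),
      x.tangent F.1 (idealDer_leibniz (RegularPoint.proj_eq_iff.1 hx) F.2) = Y.1 →
      (∀ f, (C.s y).1 f = 0 → F.1 f = C.E (C.s y) w f) → q Y = w) : DSmooth q := by
  intro k p hp
  have hp' : IsPlot fun t => (p t).1 := hp
  refine Diffeology.isPlot_of_local fun t₀ => ?_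
  obtain ⟨u, hu, htu, h⟩ := C.exists_local_vertical_coordinates hex hsq hp' (fun t => (p t).2.1)
    (fun t => (p t).2.2) t₀
  refine ⟨u, hu, htu, fun {k'} f hf hfu => ?_⟩
  obtain ⟨w, hw, hwF⟩ := h f hf hfu
  have : ∀ t, q (p (f t)) = w t := fun t => by
    obtain ⟨y, hy, x, hx, F, hF, hFw⟩ := hwF t
    exact hq _ _ y hy x hx F hF hFw
  exact (congrArg IsPlot (funext this)).mpr (isPlot_iff_contDiff.2 hw)

variable (hex : AffineSequenceExact I hI) (hsq : ∀ a ∈ I, ∀ b ∈ I, a * b = 0)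
  (hm0 : ∀ b y hy E, m b y hy E = 0 ↔ ∀ f, y.1 f = 0 → E.1 f = 0)
  (hθ : ∀ (x : RegularPoint n M A) (y : RegularPoint n M (A ⧸ I)) (hx : x.proj I = y)
      (hy : y.jet = jetMap I x.jet) (E : idealDer I y.1),
      θ x.jet (x.jet.verticalClass I (x.toRelDer hI hx E)) = m _ y hy E)
  (he₁ : ∀ (b : C.U) (y : RegularPoint n M (A ⧸ I)) (hy : y ∈ C.N) (h : (C.s y).jet = b.1)
      (w : EuclideanSpace ℝ (Fin C.r)), (e b).linear w = m b.1 (C.s y) h (C.der hy w))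

include hex hsq hm0 hθ he₁ in
theorem BundleChart.dSmooth_linear_symm :
    DSmooth fun y : {y : JetTangent n M A // jetMap I y.1 ∈ C.U ∧ y.2 ∈ y.1.vertical I} =>
      (e ⟨jetMap I y.1.1, y.2.1⟩).linear.symm (θ y.1.1 ⟨y.1.2, y.2.2⟩) :=
  C.dSmooth_of_vertical_coordinates hex hsq fun Y _ _ hy _ hx F hF hw =>
    BundleChart.linear_symm_theta hm0 hθ he₁ Y.2.1 Y.2.2 hy hx F hF hw

end SmoothModelBundle

theorem AffineSequenceExact.additionLawIsAffineBundle {n : ℕ} {M : Type u} [TopologicalSpace M]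
    [ChartedSpace (EuclideanSpace ℝ (Fin n)) M] [IsManifold (𝓡 n) ∞ M] [T2Space M]
    [SecondCountableTopology M] {A : Type v} [CommRing A] [Algebra ℝ A] [IsWeilAlgebra A]
    {I : Ideal A} {hI : IsInvariantIdeal I} (hex : AffineSequenceExact I hI)
    (hsq : ∀ a ∈ I, ∀ b ∈ I, a * b = 0) (hm : I ≤ IsLocalRing.maximalIdeal A ^ 2) :
    AdditionLawIsAffineBundle n M I := by
  have : IsWeilAlgebra (A ⧸ I) := isWeilAlgebra_quotient (hm.trans (Ideal.pow_le_self two_ne_zero))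
  obtain ⟨S, m, hms, hm0, hmadd⟩ := hex.exists_affineFibres hsq hm
    (exists_regularPoint_lift (n := n) (M := M) hm)
  obtain ⟨θ, hθadd, hθ⟩ := hex.exists_theta hsq hm hms hm0 hmadd
  have hT : ∀ y : RegularPoint n M (A ⧸ I), ∃ (C : BundleChart n M I) (_ : y ∈ C.N)
      (e : ∀ b : C.U, EuclideanSpace ℝ (Fin C.r) ≃ᵃ[ℝ] S.Point (b : JetSpace n M (A ⧸ I))),
      ∀ (b : C.U) (y : RegularPoint n M (A ⧸ I)) (hy : y ∈ C.N) (h : (C.s y).jet = b.1)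
        (w : EuclideanSpace ℝ (Fin C.r)),
        (e b).linear w = m b.1 (C.s y) h (C.der hy w) ∧
        ∀ x' : RegularPoint n M A, (∀ f, x'.1 f = (C.x (C.s y)).1 f + C.E (C.s y) w f) →
          (e b w).1 = x'.jet := fun y => by
    obtain ⟨C, hC⟩ := hex.exists_bundleChart hsq hm y
    exact ⟨C, hC, C.exists_fibreChart hI hms hm0 hmadd⟩
  choose C hC e he using hT
  have hb : ∀ b : JetSpace n M (A ⧸ I), b ∈ (C b.rep).U := fun b => ⟨b.rep, hC _, b.jet_rep⟩
  have he₁ := fun z b y hy h w => (he z b y hy h w).1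
  have he₂ := fun z b y hy h w => (he z b y hy h w).2
  let T : RegularPoint n M (A ⧸ I) → S.LocalTriv := fun z =>
    { U := (C z).U
      isOpen := (C z).isOpen_U
      r := (C z).r
      toFibre := e z
      smooth_toFun := BundleChart.dSmooth_toFibre hsq hm (he₂ z)
      smooth_invFun := BundleChart.dSmooth_toFibre_symm hex hsq hm (he₂ z) }
  exact ⟨S, θ, dSmooth_jetMap hI, hex.verticalClass_surjective, hθadd, fun b => ⟨T b.rep, hb b,
    BundleChart.dSmooth_linear hex hθ (he₁ b.rep),
    BundleChart.dSmooth_linear_symm hex hsq hm0 hθ (he₁ b.rep)⟩⟩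

/-! ### Exactness from the addition law -/

section Converse

variable {n : ℕ} {M : Type u} [TopologicalSpace M] [ChartedSpace (EuclideanSpace ℝ (Fin n)) M]
variable {A : Type v} [CommRing A] [Algebra ℝ A] [IsWeilAlgebra A] {I : Ideal A}

/-- The translate depends only on the class, and the class at `ker x` only on the values on `ker x`.
-/
theorem AdditionLawIsAffineBundle.jet_eq_of_verticalClass_eq
    (h : AdditionLawIsAffineBundle n M I) (hI : IsInvariantIdeal I) {x x₁ x₂ : RegularPoint n M A}
    {y : RegularPoint n M (A ⧸ I)} (hx : x.proj I = y) {E₁ E₂ : idealDer I y.1}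
    (h₁ : ∀ f, x₁.1 f = x.1 f + E₁.1 f) (h₂ : ∀ f, x₂.1 f = x.1 f + E₂.1 f)
    (hE : ∀ f, x.1 f = 0 → E₁.1 f = E₂.1 f) : x₁.jet = x₂.jet := by
  obtain ⟨S, θ, -, -, hadd, -⟩ := h
  have hcl : x.jet.verticalClass I (x.toRelDer hI hx E₁) =
      x.jet.verticalClass I (x.toRelDer hI hx E₂) :=
    Subtype.ext ((x.mkQ_eq_iff _ _).2 fun f hf =>
      (x.coord_toRelDer hI hx E₁ f).trans
        ((hE f hf).trans (x.coord_toRelDer hI hx E₂ f).symm))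
  refine Subtype.ext (Submodule.restrictScalars_injective ℝ _ _ ?_)
  rw [RegularPoint.restrictScalars_jet_eq_addKer hI hx E₁ h₁,
    RegularPoint.restrictScalars_jet_eq_addKer hI hx E₂ h₂, ← hadd, ← hadd, hcl]

/-- An automorphism of `A` that induces the identity of `A ⧸ I` fixes the values of those
derivations with values in `I` that vanish on enough functions. -/
theorem AdditionLawIsAffineBundle.apply_eq_of_idealDer (h : AdditionLawIsAffineBundle n M I)
    (hI : IsInvariantIdeal I) (hsq : ∀ a ∈ I, ∀ b ∈ I, a * b = 0)
    (hm : I ≤ IsLocalRing.maximalIdeal A ^ 2) {x : RegularPoint n M A}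
    {y : RegularPoint n M (A ⧸ I)} (hx : x.proj I = y) (E : idealDer I y.1)
    (hE : Algebra.adjoin ℝ (x.1 '' {f | E.1 f = 0}) = ⊤) {g : SmoothFn n M} (hg : x.1 g = 0)
    {σ : A ≃ₐ[ℝ] A} (hσ : ∀ a, σ a - a ∈ I) : σ (E.1 g) = E.1 g := by
  have hxσ : (x.map σ).proj I = y := by
    rw [← hx]
    exact Subtype.ext (AlgHom.ext fun f => mkₐ_eq_iff.2 (hσ (x.1 f)))
  obtain ⟨F, hF⟩ := RegularPoint.exists_eq_add hsq hx hxσ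
  obtain ⟨x₁, -, h₁⟩ := x.exists_add hsq hm hx E
  obtain ⟨x₂, -, h₂⟩ := (x.map σ).exists_add hsq hm hxσ E
  -- Since `F = σ ∘ x - x` vanishes on `ker x`, `E` and `E + F` have the same class at `ker x`.
  have hF' : ∀ f, x.1 f = 0 → F.1 f = 0 := fun f hf => by
    have := hF f
    rw [RegularPoint.map_apply, hf, map_zero, zero_add] at this
    exact this.symm
  have hj : x₁.jet = x₂.jet :=
    h.jet_eq_of_verticalClass_eq hI hx (E₂ := E + F) h₁
      (fun f => by
        rw [h₂, hF]
        change x.1 f + F.1 f + E.1 f = x.1 f + (E.1 f + F.1 f)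
        ring)
      fun f hf => by
        change E.1 f = E.1 f + F.1 f
        rw [hF' f hf, add_zero]
  obtain ⟨τ, hτ⟩ := RegularPoint.jet_eq_iff.1 hj
  -- Where `E` vanishes, the two points take the values `x f` and `σ (x f)`, and these `x f`
  -- generate `A`.
  have hστ : (σ : A →ₐ[ℝ] A) = τ := by
    refine AlgHom.ext_of_adjoin_eq_top hE ?_
    rintro _ ⟨f, hf, rfl⟩
    have hf' : E.1 f = 0 := hf
    have := hτ f
    rw [h₁, h₂, hf', add_zero, add_zero] at this
    exact this
  have hg' := hτ g
  rw [h₁, h₂, RegularPoint.map_apply, hg, map_zero, zero_add] at hg'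
  exact (DFunLike.congr_fun hστ _).trans hg'.symm

/-- A lift `x'` of `τ ∘ φ ∘ x` has its jet in the fibre of `ker x`. Transitivity of the action and
the representation of vertical vectors by derivations into `I` give `E` with `ker (x + E) = ker x'`;
the resulting automorphism of `A` induces `τ`. -/
theorem AdditionLawIsAffineBundle.autMap_surjective (h : AdditionLawIsAffineBundle n M I)
    (hI : IsInvariantIdeal I) (hsq : ∀ a ∈ I, ∀ b ∈ I, a * b = 0)
    (hm : I ≤ IsLocalRing.maximalIdeal A ^ 2) (x : RegularPoint n M A)
    (hL : ∀ y : RegularPoint n M (A ⧸ I), ∃ x : RegularPoint n M A, x.proj I = y) :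
    Function.Surjective (autMap I hI) := by
  intro τ
  obtain ⟨x', hx'⟩ := hL ((x.proj I).map τ)
  obtain ⟨S, θ, -, hsurj, hadd, -⟩ := h
  have hxx : x.proj I = x.proj I := rfl
  have hj : jetMap I x'.jet = jetMap I x.jet := by
    rw [jetMap_jet I hI, jetMap_jet I hI, hx', RegularPoint.jet_map]
  obtain ⟨E, hE⟩ : ∃ E : idealDer I (x.proj I).1,
      (θ x.jet (x.jet.verticalClass I (x.toRelDer hI hxx E)) +ᵥ S.pt x.jet) =
        S.mkPoint x'.jet hj := by
    obtain ⟨D, hD⟩ := hsurj x.jet ((θ x.jet).symm (S.mkPoint x'.jet hj -ᵥ S.pt x.jet))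
    obtain ⟨E, rfl⟩ := x.toRelDer_surjective hI hsq hxx D
    exact ⟨E, by rw [hD, LinearEquiv.apply_symm_apply, vsub_vadd]⟩
  obtain ⟨x₁, hx₁, h₁⟩ := x.exists_add hsq hm hxx E
  have hj₁ : x₁.jet = x'.jet := by
    refine Subtype.ext (Submodule.restrictScalars_injective ℝ _ _ ?_)
    rw [RegularPoint.restrictScalars_jet_eq_addKer hI hxx E h₁, ← hadd, hE]
    rfl
  obtain ⟨σ, hσ⟩ := RegularPoint.jet_eq_iff.1 hj₁
  refine ⟨σ, AlgEquiv.ext fun b => ?_⟩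
  obtain ⟨f, rfl⟩ := (x₁.proj I).2 b
  have e1 : Ideal.Quotient.mkₐ ℝ I (x'.1 f) = τ ((x.proj I).1 f) :=
    DFunLike.congr_fun (RegularPoint.proj_eq_iff.1 hx') f
  rw [hσ] at e1
  refine Eq.trans ?_ (e1.trans (congrArg (fun z : RegularPoint n M (A ⧸ I) => τ (z.1 f)) hx₁.symm))
  exact autMap_mk hI σ (x₁.1 f)

end Converse

/-! ### A test manifold of dimension `dim A + 1` -/

section EuclideanManifold

/-- `ℝⁿ` as a manifold in any universe. -/
@[reducible] def uliftChartedSpace (n : ℕ) :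
    ChartedSpace (EuclideanSpace ℝ (Fin n)) (ULift.{u} (EuclideanSpace ℝ (Fin n))) :=
  (Homeomorph.ulift.toOpenPartialHomeomorph).singletonChartedSpace rfl

theorem isManifold_ulift (n : ℕ) :
    @IsManifold ℝ _ _ _ _ _ _ (𝓡 n) ∞ (ULift.{u} (EuclideanSpace ℝ (Fin n))) _
      (uliftChartedSpace n) :=
  (Homeomorph.ulift.toOpenPartialHomeomorph).isManifold_singleton rfl

variable {A : Type v} [CommRing A] [Algebra ℝ A] [IsWeilAlgebra A] {I : Ideal A}

/-- The additional coordinate is free: the others already generate `A`, so a derivation can vanish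
on them and take any value in `I` on the last one. -/
theorem affineSequenceExact_of_additionLaw {M : Type u} [TopologicalSpace M]
    [ChartedSpace (EuclideanSpace ℝ (Fin (Module.finrank ℝ A + 1))) M]
    [IsManifold (𝓡 (Module.finrank ℝ A + 1)) ∞ M] [T2Space M] [SecondCountableTopology M]
    [Nonempty M] (hI : IsInvariantIdeal I) (hsq : ∀ a ∈ I, ∀ b ∈ I, a * b = 0)
    (hm : I ≤ IsLocalRing.maximalIdeal A ^ 2)
    (h : Nonempty (JetSpace (Module.finrank ℝ A + 1) M A) →
      AdditionLawIsAffineBundle (Module.finrank ℝ A + 1) M I) : AffineSequenceExact I hI := by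
  obtain ⟨p⟩ := ‹Nonempty M›
  let ε : SmoothFn (Module.finrank ℝ A + 1) M →ₐ[ℝ] ℝ :=
    (Pi.evalAlgHom ℝ (fun _ : M => ℝ) p).comp ContMDiffMap.coeFnAlgHom
  obtain ⟨c, hc⟩ := exists_localCoordinates ε
  obtain ⟨X, hX, -⟩ := c.exists_point A
  let e := Module.finBasis ℝ A
  -- The nilpotent parts of a basis, followed by `0`; with the constants, the basis elements span
  -- `A`.
  let a : Fin (Module.finrank ℝ A + 1) → A :=
    Fin.snoc (α := fun _ => A) (fun j => e j - algebraMap ℝ A (aug A (e j))) 0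
  have ha : ∀ j, a j ∈ IsLocalRing.maximalIdeal A := Fin.lastCases
    (by simp [a]) fun j => by rw [← aug_eq_zero_iff]; simp [a]
  obtain ⟨hXf, hXε⟩ := hX ε a hc ha
  have htop : ∀ P : Subalgebra ℝ A, (∀ j : Fin (Module.finrank ℝ A), X ε a (c.f j.castSucc) ∈ P) →
      P = ⊤ := fun P hP => by
    refine Algebra.eq_top_iff.2 fun b => ?_
    have he : ∀ j, e j ∈ P := fun j => by
      have h1 := hP j
      rw [hXf] at h1
      have h2 : a j.castSucc = e j - algebraMap ℝ A (aug A (e j)) := by simp [a]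
      rw [h2] at h1
      have h3 := P.sub_mem h1 (P.algebraMap_mem (ε (c.f j.castSucc) - aug A (e j)))
      rw [map_sub] at h3
      convert h3 using 1
      ring
    rw [← e.sum_repr b]
    exact P.sum_mem fun j _ => P.smul_mem (he j) _
  let x : RegularPoint (Module.finrank ℝ A + 1) M A :=
    ⟨X ε a, AlgHom.range_eq_top _ |>.1 (htop _ fun j => ⟨_, rfl⟩)⟩
  have hAL := h ⟨x.jet⟩
  refine ⟨le_antisymm (fun σ hσ => ?_) fun σ hσ => ?_,
    hAL.autMap_surjective hI hsq hm x (exists_regularPoint_lift hm)⟩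
  · rw [MonoidHom.mem_ker]
    ext z
    obtain ⟨b, rfl⟩ := Ideal.Quotient.mkₐ_surjective ℝ I z
    rw [autMap_mk]
    exact mkₐ_eq_iff.2 (hσ.1 b)
  · have hσI : ∀ b, σ b - b ∈ I := fun b => mkₐ_eq_iff.1 (by
      rw [← autMap_mk hI, MonoidHom.mem_ker.1 hσ]
      rfl)
    refine ⟨hσI, fun b hb => ?_⟩
    have hχ : aug A (x.1 c.χ) ≠ 0 := by rwa [hXε]
    -- The derivation is `b` on the last coordinate, whose increment lies in `ker x`, and `0` on the
    -- generating ones.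
    let w : Fin (Module.finrank ℝ A + 1) → I := Fin.snoc (α := fun _ => I) (fun _ => 0) ⟨b, hb⟩
    let E : idealDer I (x.proj I).1 := ⟨c.coordDer I x.1 w, c.coordDer_mem hsq rfl w⟩
    have hE : ∀ j, E.1 (c.f j) = w j := c.coordDer_apply_f hχ w
    have hxx : x.proj I = x.proj I := rfl
    have hE1 : ∀ r : ℝ, E.1 (algebraMap ℝ _ r) = 0 := fun r => by
      change c.coordDer I x.1 w _ = 0
      rw [c.coordDer_apply]
      simp
    have key := hAL.apply_eq_of_idealDer hI hsq hm hxx E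
      (htop _ fun j => Algebra.subset_adjoin ⟨_, by
        change E.1 (c.f j.castSucc) = 0
        rw [hE]
        simp [w], rfl⟩)
      (g := c.f (Fin.last _) - algebraMap ℝ _ (ε (c.f (Fin.last _)))) (by
        rw [map_sub, AlgHom.commutes, hXf]
        simp [a]) hσI
    rw [map_sub, hE1, sub_zero, hE] at key
    simpa [w] using key

end EuclideanManifold

end

theorem mainTheorem1 {A : Type v} [CommRing A] [Algebra ℝ A] [IsWeilAlgebra A]
    (I : Ideal A) (hinv : IsInvariantIdeal I)
    (hI : I ≤ Submodule.annihilator I ⊓ IsLocalRing.maximalIdeal A ^ 2) :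
    (∀ (n : ℕ) (M : Type u) [TopologicalSpace M] [ChartedSpace (EuclideanSpace ℝ (Fin n)) M]
      [IsManifold (𝓡 n) ∞ M] [T2Space M] [SecondCountableTopology M],
      Nonempty (JetSpace n M A) → AdditionLawIsAffineBundle n M I) ↔
    AffineSequenceExact I hinv := by
  have hsq : ∀ a ∈ I, ∀ b ∈ I, a * b = 0 := fun a ha b hb =>
    Submodule.mem_annihilator.1 (hI ha).1 b hb
  have hm : I ≤ IsLocalRing.maximalIdeal A ^ 2 := fun a ha => (hI ha).2
  refine ⟨fun h => ?_, fun hex n M _ _ _ _ _ _ => hex.additionLawIsAffineBundle hsq hm⟩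
  -- A single manifold in the required universe suffices for the converse.
  let M := ULift.{u} (EuclideanSpace ℝ (Fin (Module.finrank ℝ A + 1)))
  let _ : ChartedSpace (EuclideanSpace ℝ (Fin (Module.finrank ℝ A + 1))) M := uliftChartedSpace _
  have : IsManifold (𝓡 (Module.finrank ℝ A + 1)) ∞ M := isManifold_ulift _
  have : SecondCountableTopology M := Homeomorph.ulift.secondCountableTopology
  exact affineSequenceExact_of_additionLaw (M := M) hinv hsq hm (h _ M)
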